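/- **Setting.** Fix $\theta=(\theta_1,\theta_2)$ with $\theta_1,\theta_2>0$ and an integer $N\ge 1$. A *surface* is a function $h:\mathbb Z^2\to\mathbb Z$ (on the unit squares of $\mathbb Z^2$) with $h(x_1+N,x_2)=h(x_1,x_2)-\lfloor\theta_1N\rfloor$ and $h(x_1,x_2+N)=h(x_1,x_2)-\lfloor\theta_2N\rfloor$. It is viewed as the set of plaquettes of $\mathbb Z^3$ consisting of one horizontal plaquette at height $h(x)$ over each square $x$ and the $|h(x)-h(y)|$ vertical plaquettes between each pair of neighbouring squares $x,y$. A *tiling* is a surface that is non-increasing in both coordinates. Numbers of faces $|\cdot|$ are counted modulo the period translations $(N,0,-\lfloor\theta_1N\rfloor)$ and $(0,N,-\lfloor\theta_2N\rfloor)$. For a surface $h$, $\hat\alpha>0$ and a function $F$ on tilings, $$\mu_{h,\hat\alpha}(F)=\frac{\sum_\psi F(\psi)e^{-\hat\alpha\,\overline G_h(\psi)}}{\sum_\psi e^{-\hat\alpha\,\overline G_h(\psi)}},\qquad \overline G_h(\psi)=\max_{\psi_0}|h\cap\psi_0|-|h\cap\psi|,$$ where the sums run over the (finitely many) tilings $\psi$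 having a face in common with $h$, and $\psi_0$ ranges over tilings. For a tiling $\varphi$ and $\alpha,\bar\alpha>0$, let $\nu_{\varphi,\bar\alpha}$ be the probability measure on the tilings $\eta$ having a face in common with $\varphi$ given by $$\nu_{\varphi,\bar\alpha}(\eta)\propto\exp\Big[-\tfrac12\bar\alpha|\eta\vartriangle\varphi|-\int_\alpha^\infty\mu_{\eta,\hat\alpha}\big(\tfrac12|\eta\vartriangle\psi|\big)\,d\hat\alpha\Big],$$ and write $\nu_{\varphi,\bar\alpha}(F)$ for the expectation of $F$. Projecting along $(1,1,1)$ turns $\mathbb Z^3$ into the triangular lattice $\mathbb T$ and a tiling $\varphi$ into a periodic lozenge tiling of $\mathbb T$; $\mathbb T_N$ is the (finite) quotient of the vertex set of $\mathbb T$ by the projections of the two period translations. $B(x,r)$ is the union of the triangles all of whose vertices are at graph distance at most $r$ from $x$ in $\mathbb T$, and $\varphi\restriction_{B(x,r)}$ is the set of lozenges of $\varphi$ containing a triangle of $B(x,r)$, translated by $-x$ and so regarded as a lozenge tiling of $B(o,r)$, where $o$ is the origin of $\mathbb T$. **Theorem.** There is an absolute constant $C>0$ such that for all real $\alpha,\beta,\lambda$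 with $\alpha\wedge\beta>C$ and $\lambda>C/(\alpha\wedge\beta)$ there are real-valued functions $\mathfrak g^\mu_r,\mathfrak g^\nu_r$, for $r=2^k$, $k=0,1,2,\dots$, defined on lozenge tilings of $B(o,r)\subset\mathbb T$, with $$\|\mathfrak g^\mu_r\|_\infty\le Ce^{-\alpha r/C},\qquad \|\mathfrak g^\nu_r\|_\infty\le Ce^{-\alpha r/C}\qquad\text{for every } r=2^k,\ k\ge 0,$$ such that for all $\theta_1,\theta_2>0$, every $N\ge1$ and every tiling $\varphi$ with slope $\theta$ on the $N\times N$ torus, both integrals below converge absolutely and $$\bigg|\int_\alpha^\infty\mu_{\varphi,\hat\alpha}\big(\tfrac12|\varphi\vartriangle\psi|\big)\,d\hat\alpha-\sum_{x\in\mathbb T_N}\ \sum_{r=2^k<N/2}\mathfrak g^\mu_r(\varphi\restriction_{B(x,r)})\bigg|\le Ce^{-\alpha N/C},$$ $$\bigg|\int_\alpha^\infty\nu_{\varphi,\bar\alpha}\big(\tfrac12|\eta\vartriangle\varphi|\big)\,d\bar\alpha-\sum_{x\in\mathbb T_N}\ \sum_{r=2^k<N/2}\mathfrak g^\nu_r(\varphi\restriction_{B(x,r)})\bigg|\le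 Ce^{-\alpha N/C}.$$ -/

import Mathlib

open MeasureTheory

noncomputable section

namespace TiltedSOS

/-! ### Surfaces and tilings on the torus with slope -/

/-- A plaquette of `ℤ³`: the unit square with lower corner `(x, y, z)` that is orthogonal to the
coordinate axis `dir` (so `dir = 2` is a horizontal face, `dir = 0` and `dir = 1` are the two kinds
of vertical faces). -/
@[ext]
structure Plaquette where
  dir : Fin 3
  x : ℤ
  y : ℤ
  z : ℤ

/-- An integer height function on the unit squares of `ℤ²` (the square `(x₁, x₂)` has lower corner
`(x₁, x₂)`), periodic with slope `θ = (θ₁, θ₂)` on the `N × N` torus. -/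
@[ext]
structure Surface (θ : ℝ × ℝ) (N : ℕ) where
  height : ℤ × ℤ → ℤ
  period_fst : ∀ x₁ x₂ : ℤ, height (x₁ + N, x₂) = height (x₁, x₂) - ⌊θ.1 * N⌋
  period_snd : ∀ x₁ x₂ : ℤ, height (x₁, x₂ + N) = height (x₁, x₂) - ⌊θ.2 * N⌋

/-- A tiling: a periodic surface that is monotone (non-increasing in both coordinates). -/
structure Tiling (θ : ℝ × ℝ) (N : ℕ) extends Surface θ N where
  antitone : Antitone height

variable {θ : ℝ × ℝ} {N : ℕ}

/-- The surface as a set of plaquettes of `ℤ³`: one horizontal plaquette at height `h(x)` over every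
square `x`, and `|h(x) - h(x')|` vertical plaquettes over the common edge of neighbouring squares
`x, x'`. The set is invariant under the translations by `(N, 0, -⌊θ₁N⌋)` and `(0, N, -⌊θ₂N⌋)`. -/
def Surface.faces (h : Surface θ N) : Set Plaquette :=
  {f | (f.dir = 2 ∧ f.z = h.height (f.x, f.y)) ∨
    (f.dir = 0 ∧ min (h.height (f.x - 1, f.y)) (h.height (f.x, f.y)) ≤ f.z ∧
      f.z < max (h.height (f.x - 1, f.y)) (h.height (f.x, f.y))) ∨
    (f.dir = 1 ∧ min (h.height (f.x, f.y - 1)) (h.height (f.x, f.y)) ≤ f.z ∧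
      f.z < max (h.height (f.x, f.y - 1)) (h.height (f.x, f.y)))}

/-- The number of faces, on the torus, of a set of plaquettes that is invariant under the two period
translations: every orbit has exactly one member whose corner lies over `[0, N) × [0, N)`. -/
def torusCard (N : ℕ) (S : Set Plaquette) : ℕ :=
  Set.ncard {f ∈ S | 0 ≤ f.x ∧ f.x < N ∧ 0 ≤ f.y ∧ f.y < N}

/-- `½ |φ △ ψ|`, half the number of faces that belong to exactly one of the two tilings. -/
def halfDiff (φ ψ : Tiling θ N) : ℝ :=
  (torusCard N (symmDiff φ.faces ψ.faces) : ℝ) / 2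

/-- `|h ∩ ψ|`, the number of common faces. -/
def overlap (h : Surface θ N) (ψ : Tiling θ N) : ℕ :=
  torusCard N (h.faces ∩ ψ.faces)

/-- The energy `max_{ψ₀} |h ∩ ψ₀| - |h ∩ ψ|` of a tiling `ψ` relative to a surface `h`. -/
def Gbar (h : Surface θ N) (ψ : Tiling θ N) : ℝ :=
  ((⨆ ψ₀ : Tiling θ N, overlap h ψ₀ : ℕ) : ℝ) - (overlap h ψ : ℝ)

/-- The tilings that have a face in common with `h`. For `N ≥ 1` there are finitely many of them
(`finite_meeting`), so that the sums over `Meeting h` below are finite sums. -/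
def Meeting (h : Surface θ N) : Type :=
  {ψ : Tiling θ N // (h.faces ∩ ψ.faces).Nonempty}

/-! ### The sums below are finite -/

theorem Surface.height_add (h : Surface θ N) (a b x₁ x₂ : ℤ) :
    h.height (x₁ + a * N, x₂ + b * N) =
      h.height (x₁, x₂) - a * ⌊θ.1 * N⌋ - b * ⌊θ.2 * N⌋ := by
  have h1 : ∀ (a x₁ x₂ : ℤ), h.height (x₁ + a * N, x₂) = h.height (x₁, x₂) - a * ⌊θ.1 * N⌋ := by
    intro a
    induction a with
    | zero => intro x₁ x₂; simp
    | succ n ih =>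
      intro x₁ x₂
      have e := h.period_fst (x₁ + n * N) x₂
      rw [ih] at e
      rw [show x₁ + ((n : ℤ) + 1) * N = x₁ + n * N + N by ring, e]
      ring
    | pred n ih =>
      intro x₁ x₂
      have e := h.period_fst (x₁ + (-(n : ℤ) - 1) * N) x₂
      rw [show x₁ + (-(n : ℤ) - 1) * N + N = x₁ + (-(n : ℤ)) * N by ring, ih] at e
      linarith
  have h2 : ∀ (b x₁ x₂ : ℤ), h.height (x₁, x₂ + b * N) = h.height (x₁, x₂) - b * ⌊θ.2 * N⌋ := by
    intro b
    induction b with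
    | zero => intro x₁ x₂; simp
    | succ n ih =>
      intro x₁ x₂
      have e := h.period_snd x₁ (x₂ + n * N)
      rw [ih] at e
      rw [show x₂ + ((n : ℤ) + 1) * N = x₂ + n * N + N by ring, e]
      ring
    | pred n ih =>
      intro x₁ x₂
      have e := h.period_snd x₁ (x₂ + (-(n : ℤ) - 1) * N)
      rw [show x₂ + (-(n : ℤ) - 1) * N + N = x₂ + (-(n : ℤ)) * N by ring, ih] at e
      linarith
  rw [h1, h2]
  ring

/-- The set of faces is invariant under the period translations. -/
theorem Surface.mem_faces_add (h : Surface θ N) (a b : ℤ) (f : Plaquette) :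
    (⟨f.dir, f.x + a * N, f.y + b * N, f.z - a * ⌊θ.1 * N⌋ - b * ⌊θ.2 * N⌋⟩ : Plaquette) ∈ h.faces ↔
      f ∈ h.faces := by
  have e0 := h.height_add a b f.x f.y
  have e1 := h.height_add a b (f.x - 1) f.y
  have e2 := h.height_add a b f.x (f.y - 1)
  rw [show f.x - 1 + a * N = f.x + a * N - 1 by ring] at e1
  rw [show f.y - 1 + b * N = f.y + b * N - 1 by ring] at e2
  simp only [Surface.faces, Set.mem_ofPred_eq, e0, e1, e2]
  grind

theorem finite_meeting (hN : 1 ≤ N) (h : Surface θ N) : Finite (Meeting h) := by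
  have hN' : (0 : ℤ) < N := by exact_mod_cast hN
  set m₁ := ⌊θ.1 * N⌋ with hm₁
  set m₂ := ⌊θ.2 * N⌋ with hm₂
  obtain ⟨M, hM⟩ : ∃ M : ℤ, ∀ x y : ℤ, -1 ≤ x → x < N → -1 ≤ y → y < N → |h.height (x, y)| ≤ M := by
    obtain ⟨M, hM⟩ := ((Set.finite_Icc ((-1, -1) : ℤ × ℤ) (N, N)).image
      (fun p => |h.height p|)).bddAbove
    refine ⟨M, fun x y h1 h2 h3 h4 => hM ⟨(x, y), ?_, rfl⟩⟩
    exact ⟨⟨h1, h3⟩, ⟨h2.le, h4.le⟩⟩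
  have key : ∀ ψ : Meeting h, ∀ x y : ℤ, 0 ≤ x → x ≤ N → 0 ≤ y → y ≤ N →
      ψ.1.height (x, y) ∈ Set.Icc (-(M + 4 * (|m₁| + |m₂|))) (M + 4 * (|m₁| + |m₂|)) := by
    rintro ⟨ψ, f, hf, hf'⟩ x y hx hxN hy hyN
    have hx0 := Int.emod_nonneg f.x hN'.ne'
    have hx1 := Int.emod_lt_of_pos f.x hN'
    have hy0 := Int.emod_nonneg f.y hN'.ne'
    have hy1 := Int.emod_lt_of_pos f.y hN'
    have g1 := (h.mem_faces_add (-(f.x / N)) (-(f.y / N)) f).2 hf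
    have g2 := (ψ.toSurface.mem_faces_add (-(f.x / N)) (-(f.y / N)) f).2 hf'
    have ex : f.x + -(f.x / N) * N = f.x % N := by have := Int.emod_add_ediv_mul f.x N; linarith
    have ey : f.y + -(f.y / N) * N = f.y % N := by have := Int.emod_add_ediv_mul f.y N; linarith
    rw [ex, ey] at g1 g2
    generalize f.x % N = p at *
    generalize f.y % N = q at *
    generalize f.z - -(f.x / ↑N) * ⌊θ.1 * ↑N⌋ - -(f.y / ↑N) * ⌊θ.2 * ↑N⌋ = z at *
    have b0 := abs_le.1 (hM p q (by lia) hx1 (by lia) hy1)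
    have b1 := abs_le.1 (hM (p - 1) q (by lia) (by lia) (by lia) hy1)
    have b2 := abs_le.1 (hM p (q - 1) (by lia) hx1 (by lia) (by lia))
    have hz : |z| ≤ M := by
      rw [abs_le]
      simp only [Surface.faces, Set.mem_ofPred_eq] at g1
      grind
    have A : ψ.height ((N : ℤ), (N : ℤ)) = ψ.height (0, 0) - m₁ - m₂ := by
      simpa using ψ.height_add 1 1 0 0
    have B : ψ.height (-(N : ℤ), -(N : ℤ)) = ψ.height (0, 0) + m₁ + m₂ := by
      simpa using ψ.height_add (-1) (-1) 0 0
    have a1 : ∀ u v : ℤ, -N ≤ u → u ≤ N → -N ≤ v → v ≤ N →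
        ψ.height ((N : ℤ), (N : ℤ)) ≤ ψ.height (u, v) ∧
        ψ.height (u, v) ≤ ψ.height (-(N : ℤ), -(N : ℤ)) := fun u v h1 h2 h3 h4 =>
      ⟨ψ.antitone (Prod.mk_le_mk.2 ⟨h2, h4⟩), ψ.antitone (Prod.mk_le_mk.2 ⟨h1, h3⟩)⟩
    have c := a1 x y (by lia) hxN (by lia) hyN
    have c0 := a1 p q (by lia) (by lia) (by lia) (by lia)
    have c1 := a1 (p - 1) q (by lia) (by lia) (by lia) (by lia)
    have c2 := a1 p (q - 1) (by lia) (by lia) (by lia) (by lia)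
    rw [A, B] at c c0 c1 c2
    have hz' := abs_le.1 hz
    have d1 := abs_le.1 (le_refl |m₁|)
    have d2 := abs_le.1 (le_refl |m₂|)
    simp only [Surface.faces, Set.mem_ofPred_eq] at g2
    rw [Set.mem_Icc]
    rcases g2 with ⟨-, g⟩ | ⟨-, g, g'⟩ | ⟨-, g, g'⟩
    · constructor <;> lia
    · rw [min_le_iff] at g
      rw [lt_max_iff] at g'
      constructor <;> rcases g with g | g <;> rcases g' with g' | g' <;> lia
    · rw [min_le_iff] at g
      rw [lt_max_iff] at g'
      constructor <;> rcases g with g | g <;> rcases g' with g' | g' <;> lia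
  let K := M + 4 * (|m₁| + |m₂|)
  let box := Set.Icc (0 : ℤ) N
  let F : Meeting h → (box × box → Set.Icc (-K) K) := fun ψ p =>
    ⟨ψ.1.height (p.1, p.2), key ψ _ _ p.1.2.1 p.1.2.2 p.2.2.1 p.2.2.2⟩
  refine Finite.of_injective F fun ψ ψ' e => Subtype.ext ?_
  have : ψ.1.height = ψ'.1.height := by
    funext ⟨x, y⟩
    have hx0 := Int.emod_nonneg x hN'.ne'
    have hx1 := Int.emod_lt_of_pos x hN'
    have hy0 := Int.emod_nonneg y hN'.ne'
    have hy1 := Int.emod_lt_of_pos y hN'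
    have ee : ψ.1.height (x % N, y % N) = ψ'.1.height (x % N, y % N) :=
      congrArg Subtype.val (congrFun e (⟨x % N, hx0, hx1.le⟩, ⟨y % N, hy0, hy1.le⟩))
    have k1 := ψ.1.height_add (x / N) (y / N) (x % N) (y % N)
    have k2 := ψ'.1.height_add (x / N) (y / N) (x % N) (y % N)
    rw [Int.emod_add_ediv_mul, Int.emod_add_ediv_mul] at k1 k2
    rw [k1, k2, ee]
  rcases ψ with ⟨⟨⟨a, _, _⟩, _⟩, _⟩
  rcases ψ' with ⟨⟨⟨b, _, _⟩, _⟩, _⟩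
  simp only at this
  subst this
  rfl

/-! ### The measures `μ` and `ν` -/

/-- The expectation of `F` under the probability measure proportional to the weights `w`. -/
def gibbsMean {ι : Type*} (w F : ι → ℝ) : ℝ :=
  (∑' i, F i * w i) / ∑' i, w i

/-- `μ_{h, a}(F)`: expectation over the tilings `ψ` that meet `h`, with weights
`exp(-a * Gbar h ψ)`. -/
def muMean (h : Surface θ N) (a : ℝ) (F : Tiling θ N → ℝ) : ℝ :=
  gibbsMean (fun ψ : Meeting h => Real.exp (-a * Gbar h ψ.1)) (fun ψ => F ψ.1)

/-- `∫_α^∞ μ_{η, a}(½ |η △ ψ|) da`. -/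
def muIntegral (α : ℝ) (η : Tiling θ N) : ℝ :=
  ∫ a in Set.Ioi α, muMean η.toSurface a (fun ψ => halfDiff η ψ)

/-- `ν_{φ, b}(F)`: expectation over the tilings `η` that meet `φ`, with weights
`exp(-b * ½ |η △ φ| - ∫_α^∞ μ_{η, a}(½ |η △ ψ|) da)`. -/
def nuMean (α : ℝ) (φ : Tiling θ N) (b : ℝ) (F : Tiling θ N → ℝ) : ℝ :=
  gibbsMean
    (fun η : Meeting φ.toSurface => Real.exp (-b * halfDiff η.1 φ - muIntegral α η.1))
    (fun η => F η.1)

/-- `∫_α^∞ ν_{φ, b}(½ |η △ φ|) db`. -/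
def nuIntegral (α : ℝ) (φ : Tiling θ N) : ℝ :=
  ∫ b in Set.Ioi α, nuMean α φ b (fun η => halfDiff η φ)

/-! ### The triangular lattice, its lozenges and local patterns

The triangular lattice `𝕋` is the projection of `ℤ³` along `(1, 1, 1)`; the projection of
`(x, y, z)` is recorded by the coordinates `(x - z, y - z) : ℤ × ℤ`. -/

/-- The projection of the plaquette corner. -/
def Plaquette.proj (f : Plaquette) : ℤ × ℤ := (f.x - f.z, f.y - f.z)

/-- The projections of the three unit vectors of `ℤ³`; the neighbours of `v` in `𝕋` are
`v ± unitVec i`. -/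
def unitVec : Fin 3 → ℤ × ℤ := ![(1, 0), (0, 1), (-1, -1)]

/-- The graph distance of the triangular lattice. -/
def triDist (v w : ℤ × ℤ) : ℤ :=
  max (max |v.1 - w.1| |v.2 - w.2|) |(v.1 - w.1) - (v.2 - w.2)|

/-- A lozenge of `𝕋`: the projection of a plaquette orthogonal to the axis `dir` with lower corner
projecting to `base`. -/
@[ext]
structure Lozenge where
  dir : Fin 3
  base : ℤ × ℤ

/-- The two triangles (given by their vertices) of which the lozenge consists. -/
def Lozenge.triangles (l : Lozenge) : Set (Set (ℤ × ℤ)) :=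
  {{l.base, l.base + unitVec (l.dir + 1), l.base + unitVec (l.dir + 1) + unitVec (l.dir + 2)},
   {l.base, l.base + unitVec (l.dir + 2), l.base + unitVec (l.dir + 1) + unitVec (l.dir + 2)}}

/-- The full-plane (periodic) lozenge tiling of `𝕋` given by the monotone surface. -/
def Tiling.lozenges (φ : Tiling θ N) : Set Lozenge :=
  (fun f : Plaquette => ⟨f.dir, f.proj⟩) '' φ.faces

/-- The lozenge has a triangle that is contained in the ball of radius `r` about the origin. -/
def Lozenge.MeetsBall (r : ℕ) (l : Lozenge) : Prop :=
  ∃ t ∈ l.triangles, ∀ v ∈ t, triDist v 0 ≤ r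

/-- `φ` restricted to `B(x, r)`: all lozenges of `φ` that intersect a triangle of `B(x, r)`,
translated by `-x` so as to be a lozenge tiling of `B(0, r)`. -/
def Tiling.restrict (φ : Tiling θ N) (x : ℤ × ℤ) (r : ℕ) : Set Lozenge :=
  {l | (⟨l.dir, x + l.base⟩ : Lozenge) ∈ φ.lozenges ∧ l.MeetsBall r}

/-- The projections `(N + ⌊θ₁N⌋, ⌊θ₁N⌋)` of `(N, 0, -⌊θ₁N⌋)` and `(⌊θ₂N⌋, N + ⌊θ₂N⌋)` of
`(0, N, -⌊θ₂N⌋)` generate the periods of the torus. -/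
def periodLattice (θ : ℝ × ℝ) (N : ℕ) : AddSubgroup (ℤ × ℤ) :=
  AddSubgroup.closure
    {((N : ℤ) + ⌊θ.1 * N⌋, ⌊θ.1 * N⌋), (⌊θ.2 * N⌋, (N : ℤ) + ⌊θ.2 * N⌋)}

/-- The vertex set `𝕋_N` of the triangular lattice on the torus. -/
abbrev TorusVertex (θ : ℝ × ℝ) (N : ℕ) : Type :=
  (ℤ × ℤ) ⧸ periodLattice θ N

theorem Tiling.mem_lozenges_add (φ : Tiling θ N) (a b : ℤ) (d : Fin 3) (v : ℤ × ℤ)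
    (hv : (⟨d, v⟩ : Lozenge) ∈ φ.lozenges) :
    (⟨d, a • ((N : ℤ) + ⌊θ.1 * N⌋, ⌊θ.1 * N⌋) + b • (⌊θ.2 * N⌋, (N : ℤ) + ⌊θ.2 * N⌋) + v⟩ :
      Lozenge) ∈ φ.lozenges := by
  obtain ⟨f, hf, e⟩ := hv
  refine ⟨_, (φ.toSurface.mem_faces_add a b f).2 hf, ?_⟩
  simp only [Lozenge.mk.injEq, Plaquette.proj] at e ⊢
  obtain ⟨rfl, rfl⟩ := e
  refine ⟨rfl, Prod.ext ?_ ?_⟩ <;> simp <;> ring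

theorem restrict_add_period (φ : Tiling θ N) (x p : ℤ × ℤ) (hp : p ∈ periodLattice θ N) (r : ℕ) :
    φ.restrict (x + p) r = φ.restrict x r := by
  obtain ⟨a, b, rfl⟩ := AddSubgroup.mem_closure_pair.1 hp
  ext ⟨d, v⟩
  simp only [Tiling.restrict, Set.mem_ofPred_eq]
  refine and_congr_left fun _ => ⟨fun h => ?_, fun h => ?_⟩
  · convert φ.mem_lozenges_add (-a) (-b) d _ h using 2
    module
  · convert φ.mem_lozenges_add a b d _ h using 2
    module

theorem finite_torusVertex (h₁ : 0 < θ.1) (h₂ : 0 < θ.2) (hN : 1 ≤ N) :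
    Finite (TorusVertex θ N) := by
  have hN' : (0 : ℤ) < N := by exact_mod_cast hN
  have k₁ : (0 : ℤ) ≤ ⌊θ.1 * N⌋ := Int.floor_nonneg.2 (by positivity)
  have k₂ : (0 : ℤ) ≤ ⌊θ.2 * N⌋ := Int.floor_nonneg.2 (by positivity)
  have hu : ((N : ℤ) + ⌊θ.1 * N⌋, ⌊θ.1 * N⌋) ∈ periodLattice θ N :=
    AddSubgroup.subset_closure (by simp)
  have hw : (⌊θ.2 * N⌋, (N : ℤ) + ⌊θ.2 * N⌋) ∈ periodLattice θ N :=
    AddSubgroup.subset_closure (by simp)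
  generalize ⌊θ.1 * N⌋ = m₁ at *
  generalize ⌊θ.2 * N⌋ = m₂ at *
  let D : ℤ := N * (N + m₁ + m₂)
  have hD : 0 < D := by positivity
  have e₁ : ∀ a : ℤ, (a * D, 0) ∈ periodLattice θ N := fun a => by
    convert (periodLattice θ N).sub_mem ((periodLattice θ N).zsmul_mem hu (a * (N + m₂)))
      ((periodLattice θ N).zsmul_mem hw (a * m₁)) using 1
    refine Prod.ext ?_ ?_ <;> simp [D] <;> ring
  have e₂ : ∀ a : ℤ, (0, a * D) ∈ periodLattice θ N := fun a => by
    convert (periodLattice θ N).sub_mem ((periodLattice θ N).zsmul_mem hw (a * (N + m₁)))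
      ((periodLattice θ N).zsmul_mem hu (a * m₂)) using 1
    refine Prod.ext ?_ ?_ <;> simp [D] <;> ring
  let F : Set.Icc (0 : ℤ) D × Set.Icc (0 : ℤ) D → TorusVertex θ N :=
    fun p => QuotientAddGroup.mk ((p.1 : ℤ), (p.2 : ℤ))
  refine Finite.of_surjective F fun x => ?_
  obtain ⟨⟨x, y⟩, rfl⟩ := QuotientAddGroup.mk_surjective x
  refine ⟨(⟨x % D, Int.emod_nonneg _ hD.ne', (Int.emod_lt_of_pos _ hD).le⟩,
    ⟨y % D, Int.emod_nonneg _ hD.ne', (Int.emod_lt_of_pos _ hD).le⟩), ?_⟩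
  refine QuotientAddGroup.eq.2 ?_
  convert (periodLattice θ N).add_mem (e₁ (x / D)) (e₂ (y / D)) using 1
  have := Int.emod_add_ediv_mul x D
  have := Int.emod_add_ediv_mul y D
  refine Prod.ext ?_ ?_ <;> simp <;> linarith

open Classical in
/-- The scales `r = 2 ^ k`, `k ≥ 0`, with `r < N / 2`. -/
def scales (N : ℕ) : Finset ℕ :=
  {r ∈ Finset.range N | (∃ k : ℕ, r = 2 ^ k) ∧ (r : ℝ) < (N : ℝ) / 2}

/-- `∑_{x ∈ 𝕋_N} ∑_r g_r(φ restricted to B(x, r))`. As `φ` is periodic, the summand does not depend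
on the representative of `x` in the plane (`restrict_add_period`), and `𝕋_N` is finite
(`finite_torusVertex`). -/
def localSum (g : ℕ → Set Lozenge → ℝ) (φ : Tiling θ N) : ℝ :=
  ∑' x : TorusVertex θ N, ∑ r ∈ scales N, g r (φ.restrict (Quotient.out x) r)

end TiltedSOS

end

open MeasureTheory

noncomputable section

namespace TiltedSOS

open scoped Classical

/-! ### The triangular distance -/

/-! Both integrals are logarithms of partition functions. The derivative of `-log ∑ exp(-a G) w` in
`a` is the Gibbs mean of `G`, so integrating up to infinity leaves the logarithm of the sum at `α`
minus that of the ground state weight (`integral_gibbsMean`). All tilings of a torus have equally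
many faces, so `Gbar` and `halfDiff` both count the faces of `φ` that the other tiling lacks. Hence
the first integral is a `freeEnergy` without interaction (`muIntegral_eq`). The second is, up to
twice the error in the first expansion, the `freeEnergy` whose interaction is the family of local
functions found for the first (`abs_nuIntegral_sub_le`). So `exists_local_expansion`, applied twice,
proves the theorem.

To localise a free energy, charge an extra `exp (-b)` for each horizontal lozenge lost and integrate
over `b > 0`. A tiling that loses no horizontal lozenge is the given one, so the free energy becomes
a sum over sites `x` of `loss`, the integrated probability that the horizontal lozenge based at `x`
is lost (`freeEnergy_eq_sum_loss`). Only bases of horizontal lozenges contribute, at most `N ^ 2` of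
them whatever the slope.

That `loss` is local is shown by comparing two tori that look alike near two centres. The
exponential of the interaction is expanded over sets of activated balls, and independent states of
the two tori are overlaid. When the cluster of the centre in the overlay is confined to radius `R`,
the two states are exchanged inside the cluster. This involution keeps the product of the weights
(`pairWeight_swapStates`) and interchanges the two loss events (`isLost_swapStates`), so confined
pairs cancel and the difference of the probabilities is bounded by the probability of escape
(`abs_lossProb_sub_le`). An escaping cluster contains a chain of distinct sites and balls
(`exists_chain`). The joint presence of given sites and balls is bounded by cutting out the
components through them (`peierls`), the entropy being controlled by `sum_rooted_le_one`, and
`sum_exists_chain_le` sums over chains.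

Finally, for each pattern of radius `r` the loss in some torus realising it is chosen. The local
functions are the increments between consecutive dyadic radii; they telescope to an approximation of
`loss` at radius of order `N` (`abs_loss_sub_sum_le`). -/

theorem triDist_le_iff {v w : ℤ × ℤ} {r : ℤ} :
    triDist v w ≤ r ↔ (-r ≤ v.1 - w.1 ∧ v.1 - w.1 ≤ r) ∧ (-r ≤ v.2 - w.2 ∧ v.2 - w.2 ≤ r) ∧
      (-r ≤ (v.1 - w.1) - (v.2 - w.2) ∧ (v.1 - w.1) - (v.2 - w.2) ≤ r) := by
  simp only [triDist, max_le_iff, abs_le, and_assoc]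

theorem triDist_nonneg (v w : ℤ × ℤ) : 0 ≤ triDist v w :=
  (abs_nonneg (v.1 - w.1)).trans ((le_max_left _ _).trans (le_max_left _ _))

theorem triDist_triangle (u v w : ℤ × ℤ) : triDist u w ≤ triDist u v + triDist v w := by
  have h1 := triDist_le_iff.1 (le_refl (triDist u v))
  have h2 := triDist_le_iff.1 (le_refl (triDist v w))
  rw [triDist_le_iff]
  omega

theorem triDist_comm (v w : ℤ × ℤ) : triDist v w = triDist w v := by
  have h1 := triDist_le_iff.1 (le_refl (triDist v w))
  have h2 := triDist_le_iff.1 (le_refl (triDist w v))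
  refine le_antisymm ?_ ?_ <;> rw [triDist_le_iff] <;> omega

theorem triDist_sub (v w : ℤ × ℤ) : triDist v w = triDist (v - w) 0 := by
  simp [triDist]

theorem triDist_self (v : ℤ × ℤ) : triDist v v = 0 := by simp [triDist]

/-- The ball of radius `n` about the origin of the triangular lattice. -/
def triBall (n : ℕ) : Finset (ℤ × ℤ) :=
  (Finset.Icc (-(n : ℤ)) n ×ˢ Finset.Icc (-(n : ℤ)) n).filter fun v => triDist v 0 ≤ n

theorem mem_triBall {n : ℕ} {v : ℤ × ℤ} : v ∈ triBall n ↔ triDist v 0 ≤ n := by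
  simp only [triBall, Finset.mem_filter, Finset.mem_product, Finset.mem_Icc, and_iff_right_iff_imp]
  intro h
  rw [triDist_le_iff] at h
  simp only [Prod.fst_zero, Prod.snd_zero] at h
  omega

theorem card_triBall_le (n : ℕ) : (triBall n).card ≤ (2 * n + 1) ^ 2 := by
  refine (Finset.card_filter_le _ _).trans ?_
  rw [Finset.card_product, Int.card_Icc, sq]
  apply Nat.mul_le_mul <;> omega

/-! ### Lozenge fields on finite quotients of the triangular lattice -/

/-- A finite quotient of the triangular lattice with a periodic lozenge tiling. The lozenge of
direction `i` with base `c` has its short diagonal between `c` and `c - u i`, and belongs to the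
tiling if `bit i c = 1`. Every triangle lies in exactly one lozenge of the tiling, and every line in
the direction `u 2` contains the base of a horizontal lozenge. -/
structure LozengeTorus where
  V : Type
  [grp : AddCommGroup V]
  [fin : Fintype V]
  size : ℕ
  proj : ℤ × ℤ →+ V
  proj_surj : Function.Surjective proj
  systole : ∀ v, proj v = 0 → v ≠ 0 → (size : ℤ) ≤ triDist v 0
  bit : Fin 3 → V → ℤ
  bit_nonneg : ∀ i c, 0 ≤ bit i c
  bit_le_one : ∀ i c, bit i c ≤ 1
  triangle : ∀ c, bit 0 (c + proj (1, 0)) + bit 1 (c + proj (1, 1)) + bit 2 c = 1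
  exists_bit_two : ∀ c, ∃ n : ℕ, bit 2 (c + n • proj (1, 1)) = 1
  card_bit_two : (Finset.univ.filter fun c => bit 2 c = 1).card ≤ size ^ 2

namespace LozengeTorus

attribute [instance] LozengeTorus.grp LozengeTorus.fin

variable (S : LozengeTorus)

/-- The image of the unit vector. -/
def u (i : Fin 3) : S.V := S.proj (unitVec i)

/-- The lozenge field of the tiling whose height differs by `Δ`. -/
def moved (Δ : S.V → ℤ) (i : Fin 3) (c : S.V) : ℤ := S.bit i c + Δ (c - S.u i) - Δ c

/-- Height differences to another tiling. -/
def Adm (Δ : S.V → ℤ) : Prop := ∀ i c, 0 ≤ S.moved Δ i c ∧ S.moved Δ i c ≤ 1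

/-- The two tilings have a common face. -/
def Meets (Δ : S.V → ℤ) : Prop := ∃ i c, S.bit i c = 1 ∧ Δ c = 0 ∧ Δ (c - S.u i) = 0

/-- The height differences to tilings that meet the given one. -/
abbrev Conf : Type := {Δ : S.V → ℤ // S.Adm Δ ∧ S.Meets Δ}

/-- The lozenge `p` is present in the given tiling and not shared. -/
def IsLost (Δ : S.V → ℤ) (p : Fin 3 × S.V) : Prop :=
  S.bit p.1 p.2 = 1 ∧ (Δ p.2 ≠ 0 ∨ Δ (p.2 - S.u p.1) ≠ 0)

/-- The set of lost faces. -/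
def lost (Δ : S.V → ℤ) : Finset (Fin 3 × S.V) := Finset.univ.filter (S.IsLost Δ)

/-- The sites where the height differs. -/
def supp (Δ : S.V → ℤ) : Finset S.V := Finset.univ.filter fun c => Δ c ≠ 0

variable {S}

theorem mem_supp {Δ : S.V → ℤ} {c : S.V} : c ∈ S.supp Δ ↔ Δ c ≠ 0 := by simp [supp]

theorem mem_lost {Δ : S.V → ℤ} {p : Fin 3 × S.V} : p ∈ S.lost Δ ↔ S.IsLost Δ p := by simp [lost]

theorem bit_eq_zero_or_one (i : Fin 3) (c : S.V) : S.bit i c = 0 ∨ S.bit i c = 1 := by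
  have := S.bit_nonneg i c
  have := S.bit_le_one i c
  omega

theorem u_zero : S.u 0 = S.proj (1, 0) := rfl

theorem u_one : S.u 1 = S.proj (1, 1) - S.proj (1, 0) := by
  rw [← map_sub]; rfl

theorem u_two : S.u 2 = - S.proj (1, 1) := by
  rw [← map_neg]; rfl

theorem exists_bit_eq_one (c : S.V) : ∃ p : Fin 3 × S.V, S.bit p.1 p.2 = 1 ∧
    ((p.2 = c + S.proj (1, 0) ∧ p.2 - S.u p.1 = c) ∨
      (p.2 = c + S.proj (1, 1) ∧ p.2 - S.u p.1 = c + S.proj (1, 0)) ∨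
      (p.2 = c ∧ p.2 - S.u p.1 = c + S.proj (1, 1))) := by
  have h := S.triangle c
  rcases bit_eq_zero_or_one 0 (c + S.proj (1, 0)) with h0 | h0
  · rcases bit_eq_zero_or_one 1 (c + S.proj (1, 1)) with h1 | h1
    · exact ⟨(2, c), by lia, Or.inr (Or.inr ⟨rfl, by simp [u_two]⟩)⟩
    · exact ⟨(1, _), h1, Or.inr (Or.inl ⟨rfl, by simp only [u_one]; abel⟩)⟩
  · exact ⟨(0, _), h0, Or.inl ⟨rfl, by simp [u_zero]⟩⟩

theorem moved_zero (i : Fin 3) (c : S.V) : S.moved 0 i c = S.bit i c := by simp [moved]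

theorem adm_zero : S.Adm 0 := fun i c => by
  rw [moved_zero]
  exact ⟨S.bit_nonneg i c, S.bit_le_one i c⟩

theorem meets_of_triangle {Δ : S.V → ℤ} (c : S.V) (h0 : Δ c = 0)
    (h1 : Δ (c + S.proj (1, 0)) = 0) (h2 : Δ (c + S.proj (1, 1)) = 0) : S.Meets Δ := by
  obtain ⟨p, hp, h⟩ := exists_bit_eq_one c
  refine ⟨p.1, p.2, hp, ?_⟩
  rcases h with ⟨e, e'⟩ | ⟨e, e'⟩ | ⟨e, e'⟩ <;> rw [e', e] <;> simp [*]

/-- The configuration of the given tiling itself. -/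
def zeroConf : S.Conf := ⟨0, adm_zero, meets_of_triangle 0 rfl rfl rfl⟩

/-- The triangle with first vertex `c` lies in one lozenge of the tiling. If its short diagonal ends
at `c`, the lozenge is lost. Otherwise the diagonal is the edge opposite `c`; were that lozenge
kept, `Δ` would vanish at both its ends, and the two edges at `c`, whose bits are zero, would force
both `Δ c ≥ 0` and `Δ c ≤ 0`. -/
theorem exists_lost_of_ne_zero {Δ : S.V → ℤ} (hΔ : S.Adm Δ) {c : S.V} (hc : Δ c ≠ 0) :
    ∃ p : Fin 3 × S.V, S.IsLost Δ p ∧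
      (c = p.2 - S.proj (1, 0) ∨ c = p.2 ∨ c = p.2 - S.proj (1, 1)) := by
  have h := S.triangle c
  by_cases h0 : S.bit 0 (c + S.proj (1, 0)) = 1
  · exact ⟨(0, _), ⟨h0, Or.inr (by simpa [u_zero] using hc)⟩, by simp⟩
  by_cases h2 : S.bit 2 c = 1
  · exact ⟨(2, c), ⟨h2, Or.inl hc⟩, by simp⟩
  have h0' := (bit_eq_zero_or_one 0 (c + S.proj (1, 0))).resolve_right h0
  have h2' := (bit_eq_zero_or_one 2 c).resolve_right h2
  refine ⟨(1, c + S.proj (1, 1)), ⟨by lia, ?_⟩, by simp⟩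
  have e : c + S.proj (1, 1) - S.u 1 = c + S.proj (1, 0) := by simp only [u_one]; abel
  simp only [e]
  by_contra hcon
  push Not at hcon
  have a0 := (hΔ 0 (c + S.proj (1, 0))).1
  have a2 := (hΔ 2 c).1
  simp only [moved, u_zero, u_two, add_sub_cancel_right, sub_neg_eq_add, h0', h2', hcon.1,
    hcon.2] at a0 a2
  lia

theorem card_supp_le {Δ : S.V → ℤ} (hΔ : S.Adm Δ) :
    (S.supp Δ).card ≤ 3 * (S.lost Δ).card := by
  have hsub : S.supp Δ ⊆ (S.lost Δ).biUnion
      fun p => {p.2 - S.proj (1, 0), p.2, p.2 - S.proj (1, 1)} := by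
    intro c hc
    obtain ⟨p, hp, h⟩ := exists_lost_of_ne_zero hΔ (mem_supp.1 hc)
    exact Finset.mem_biUnion.2 ⟨p, mem_lost.2 hp, by simpa using h⟩
  refine (Finset.card_le_card hsub).trans ?_
  rw [mul_comm]
  exact Finset.card_biUnion_le_card_mul _ _ _ fun p _ => Finset.card_le_three

/-! ### A height difference is determined by its lozenges -/

theorem eq_of_gradient_eq {f : S.V → ℤ} (h : ∀ i c, f (c - S.u i) = f c) (c c' : S.V) :
    f c = f c' := by
  have h0 : ∀ c, f (c - S.proj (1, 0)) = f c := fun c => h 0 c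
  have h1 : ∀ c, f (c - S.proj (0, 1)) = f c := fun c => h 1 c
  have k : ∀ (w : ℤ × ℤ), (∀ c, f (c - S.proj w) = f c) → ∀ (n : ℤ) c, f (c + n • S.proj w) = f c := by
    intro w hw n
    induction n with
    | zero => simp
    | succ n ih =>
      intro c
      rw [← hw (c + ((n : ℤ) + 1) • S.proj w), ← ih c]
      congr 1
      module
    | pred n ih =>
      intro c
      rw [← ih c, ← hw (c + (-(n : ℤ)) • S.proj w)]
      congr 1
      module
  obtain ⟨⟨a, b⟩, hab⟩ := S.proj_surj (c' - c)
  have e : c' = c + a • S.proj (1, 0) + b • S.proj (0, 1) := by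
    rw [← map_zsmul, ← map_zsmul, add_assoc, ← map_add]
    simp [hab]
  rw [e, k _ h1, k _ h0]

theorem eq_of_moved_eq {Δ Δ' : S.V → ℤ} (h : ∀ i c, S.moved Δ i c = S.moved Δ' i c) (c₀ : S.V)
    (h₀ : Δ c₀ = Δ' c₀) : Δ = Δ' := by
  funext c
  have := eq_of_gradient_eq (f := fun c => Δ c - Δ' c) (fun i c => by
    have := h i c
    simp only [moved] at this
    lia) c c₀
  simp only [h₀, sub_self] at this
  lia

/-- Where the height difference does not vanish, and which lozenges the other tiling has. -/
def code (Δ : S.V → ℤ) (c : S.V) : Bool × (Fin 3 → Bool) :=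
  (decide (Δ c ≠ 0), fun i => decide (S.moved Δ i c = 1))

theorem moved_eq_of_code_eq {Δ Δ' : S.V → ℤ} (hΔ : S.Adm Δ) (hΔ' : S.Adm Δ') {c : S.V}
    (h : code Δ c = code Δ' c) (i : Fin 3) : S.moved Δ i c = S.moved Δ' i c := by
  have h2 := congrFun (congrArg Prod.snd h) i
  simp only [code, decide_eq_decide] at h2
  have := hΔ i c
  have := hΔ' i c
  lia

theorem ne_zero_iff_of_code_eq {Δ Δ' : S.V → ℤ} {c : S.V} (h : code Δ c = code Δ' c) :
    Δ c ≠ 0 ↔ Δ' c ≠ 0 := by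
  have h2 := congrArg Prod.fst h
  simpa only [code, decide_eq_decide] using h2

/-- The code fixes all gradients and the zero set. As the tilings meet, the zero set is not empty,
and this fixes the additive constant. -/
instance : Finite S.Conf := by
  refine Finite.of_injective (fun Δ : S.Conf => code Δ.1) fun Δ Δ' h => Subtype.ext ?_
  obtain ⟨i, c, -, hc, -⟩ := Δ.2.2
  refine eq_of_moved_eq (fun i c => moved_eq_of_code_eq Δ.2.1 Δ'.2.1 (congrFun h c) i) c ?_
  have := ne_zero_iff_of_code_eq (congrFun h c)
  rw [hc] at this ⊢
  simpa [eq_comm] using this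

instance : Fintype S.Conf := Fintype.ofFinite _

/-! ### Counting height differences with given roots -/

/-- Nearest neighbours. -/
def Nbr (c c' : S.V) : Prop := ∃ i, c' = c + S.u i ∨ c' = c - S.u i

/-- The sites connected to `Y` in the support of `Δ`. -/
def comp (Y : Finset S.V) (Δ : S.V → ℤ) : Set S.V :=
  {c | ∃ y ∈ Y, Relation.ReflTransGen (fun c c' => Nbr c c' ∧ Δ c' ≠ 0) y c}

/-- Every component of the support of `Δ` contains a point of `Y`, and every point of `Y` is in the
support. -/
def Rooted (Y : Finset S.V) (Δ : S.V → ℤ) : Prop :=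
  Y ⊆ S.supp Δ ∧ ∀ c, Δ c ≠ 0 → c ∈ comp Y Δ

/-- A set of sites together with its neighbours. -/
def nbhd (A : Finset S.V) : Finset S.V :=
  A ∪ (Finset.univ : Finset (Fin 3)).biUnion fun i => A.image (· + S.u i) ∪ A.image (· - S.u i)

theorem subset_nbhd {A : Finset S.V} {c : S.V} (hc : c ∈ A) : c ∈ nbhd A :=
  Finset.mem_union_left _ hc

theorem Nbr.mem_nbhd {A : Finset S.V} {c c' : S.V} (h : Nbr c c') (hc : c ∈ A) : c' ∈ nbhd A := by
  obtain ⟨i, h⟩ := h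
  refine Finset.mem_union_right _ (Finset.mem_biUnion.2 ⟨i, Finset.mem_univ i, ?_⟩)
  rw [Finset.mem_union, Finset.mem_image, Finset.mem_image]
  exact h.imp (fun e => ⟨c, hc, e.symm⟩) (fun e => ⟨c, hc, e.symm⟩)

theorem card_nbhd_le (A : Finset S.V) : (nbhd A).card ≤ 7 * A.card := by
  have h : ((Finset.univ : Finset (Fin 3)).biUnion
      fun i => A.image (· + S.u i) ∪ A.image (· - S.u i)).card ≤
        (Finset.univ : Finset (Fin 3)).card * (2 * A.card) := by
    refine Finset.card_biUnion_le_card_mul _ _ _ fun i _ => (Finset.card_union_le _ _).trans ?_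
    have := Finset.card_image_le (s := A) (f := (· + S.u i))
    have := Finset.card_image_le (s := A) (f := (· - S.u i))
    lia
  have := Finset.card_union_le A ((Finset.univ : Finset (Fin 3)).biUnion
    fun i => A.image (· + S.u i) ∪ A.image (· - S.u i))
  simp only [Finset.card_univ, Fintype.card_fin] at h
  unfold nbhd
  lia

/-- The codes that agree with the code of `Δ` near the support of `Δ`. -/
def codes (Δ : S.V → ℤ) : Finset (S.V → Bool × (Fin 3 → Bool)) :=
  Fintype.piFinset fun c => if c ∈ nbhd (S.supp Δ) then {code Δ c} else Finset.univ

theorem card_codes (Δ : S.V → ℤ) :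
    (codes Δ).card * 16 ^ (nbhd (S.supp Δ)).card = 16 ^ Fintype.card S.V := by
  have e : ∀ c, (if c ∈ nbhd (S.supp Δ) then ({code Δ c} : Finset (Bool × (Fin 3 → Bool)))
      else Finset.univ).card = if c ∈ nbhd (S.supp Δ) then 1 else 16 := by
    intro c
    split_ifs <;> simp
  simp only [codes, Fintype.card_piFinset, e]
  rw [Finset.prod_ite]
  simp only [Finset.prod_const_one, Finset.prod_const, one_mul]
  rw [← pow_add, ← Finset.card_univ]
  congr 1
  have := Finset.card_filter_add_card_filter_not (s := (Finset.univ : Finset S.V))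
    (fun c => c ∈ nbhd (S.supp Δ))
  rw [Finset.filter_mem_eq_inter, Finset.univ_inter] at this
  lia

/-- The support can be explored from `Y` by reading `F` alone: every site tested is a neighbour of a
site already known to be in both supports, and there `F` agrees with both codes. -/
theorem Rooted.supp_subset {Y : Finset S.V} {Δ Δ' : S.V → ℤ} (h : Rooted Y Δ) (h' : Rooted Y Δ')
    {F : S.V → Bool × (Fin 3 → Bool)} (hF : F ∈ codes Δ) (hF' : F ∈ codes Δ') {c : S.V}
    (hc : Δ c ≠ 0) : Δ' c ≠ 0 := by
  have k : ∀ {Δ : S.V → ℤ}, F ∈ codes Δ → ∀ c ∈ nbhd (S.supp Δ), F c = code Δ c := by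
    intro Δ hF c hc
    have := Fintype.mem_piFinset.1 hF c
    simpa [hc] using this
  obtain ⟨y, hy, hyc⟩ := h.2 c hc
  clear hc
  induction hyc with
  | refl => exact mem_supp.1 (h'.1 hy)
  | @tail b d _ hbd ih =>
    have e : code Δ d = code Δ' d :=
      (k hF d (subset_nbhd (mem_supp.2 hbd.2))).symm.trans
        (k hF' d (hbd.1.mem_nbhd (mem_supp.2 ih)))
    exact (ne_zero_iff_of_code_eq e).1 hbd.2

theorem Rooted.eq_of_mem_codes {Y : Finset S.V} {Δ Δ' : S.Conf} (h : Rooted Y Δ.1)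
    (h' : Rooted Y Δ'.1) {F : S.V → Bool × (Fin 3 → Bool)} (hF : F ∈ codes Δ.1)
    (hF' : F ∈ codes Δ'.1) : Δ = Δ' := by
  have hs : ∀ c, Δ.1 c ≠ 0 ↔ Δ'.1 c ≠ 0 := fun c =>
    ⟨h.supp_subset h' hF hF', h'.supp_subset h hF' hF⟩
  have hs' : S.supp Δ.1 = S.supp Δ'.1 := by
    ext c
    rw [mem_supp, mem_supp, hs]
  obtain ⟨-, c₀, -, hc₀, -⟩ := Δ.2.2
  refine Subtype.ext (eq_of_moved_eq (fun i c => ?_) c₀ ?_)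
  · by_cases hc : c ∈ nbhd (S.supp Δ.1)
    · have e := Fintype.mem_piFinset.1 hF c
      have e' := Fintype.mem_piFinset.1 hF' c
      rw [← hs'] at e'
      simp only [hc, if_true, Finset.mem_singleton] at e e'
      exact moved_eq_of_code_eq Δ.2.1 Δ'.2.1 (e.symm.trans e') i
    · have h1 : Δ.1 c = 0 := by
        by_contra hcon
        exact hc (subset_nbhd (mem_supp.2 hcon))
      have h2 : Δ.1 (c - S.u i) = 0 := by
        by_contra hcon
        exact hc (Nbr.mem_nbhd ⟨i, Or.inl (by simp)⟩ (mem_supp.2 hcon))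
      have h1' := not_not.1 ((not_congr (hs c)).1 (not_not.2 h1))
      have h2' := not_not.1 ((not_congr (hs (c - S.u i))).1 (not_not.2 h2))
      simp only [moved, h1, h2, h1', h2']
  · rw [hc₀]
    exact (not_not.1 ((not_congr (hs c₀)).1 (not_not.2 hc₀))).symm

/-- Choose a code uniformly at random, with 16 equally likely values at each site. It agrees with
the code of `Δ` near the support with probability at least `16 ^ (-7 |supp Δ|)`, a site having six
neighbours. For different rooted `Δ` these events are disjoint by `Rooted.eq_of_mem_codes`, so the
probabilities add up to at most one. -/
theorem sum_rooted_le_one (Y : Finset S.V) :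
    ∑ Δ : S.Conf, (if Rooted Y Δ.1 then ((16 : ℝ) ^ 7)⁻¹ ^ (S.supp Δ.1).card else 0) ≤ 1 := by
  rw [← Finset.sum_filter]
  set T := Finset.univ.filter fun Δ : S.Conf => Rooted Y Δ.1
  have hcard : ∑ Δ ∈ T, (codes Δ.1).card ≤ 16 ^ Fintype.card S.V := by
    rw [← Finset.card_biUnion]
    · refine (Finset.card_le_univ _).trans ?_
      simp
    · intro Δ hΔ Δ' hΔ' hne
      refine Finset.disjoint_left.2 fun F hF hF' => ?_
      exact hne (Rooted.eq_of_mem_codes (Finset.mem_filter.1 hΔ).2 (Finset.mem_filter.1 hΔ').2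
        hF hF')
  have hpos : (0 : ℝ) < 16 ^ Fintype.card S.V := by positivity
  have key : ∀ Δ : S.Conf, ((16 : ℝ) ^ 7)⁻¹ ^ (S.supp Δ.1).card ≤
      (codes Δ.1).card / 16 ^ Fintype.card S.V := by
    intro Δ
    have e : ((codes Δ.1).card : ℝ) * 16 ^ (nbhd (S.supp Δ.1)).card = 16 ^ Fintype.card S.V := by
      exact_mod_cast card_codes Δ.1
    rw [le_div_iff₀ hpos, ← e, inv_pow, ← pow_mul, inv_mul_le_iff₀ (by positivity), mul_comm]
    exact mul_le_mul_of_nonneg_right (pow_le_pow_right₀ (by norm_num) (card_nbhd_le _))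
      (Nat.cast_nonneg _)
  refine (Finset.sum_le_sum fun Δ _ => key Δ).trans ?_
  rw [← Finset.sum_div, div_le_one hpos]
  exact_mod_cast hcard

/-! ### Cutting out components -/

/-- The part of `Δ` on `A`. -/
def inPart (A : Set S.V) (Δ : S.V → ℤ) (c : S.V) : ℤ := if c ∈ A then Δ c else 0

/-- The part of `Δ` off `A`. -/
def outPart (A : Set S.V) (Δ : S.V → ℤ) (c : S.V) : ℤ := if c ∈ A then 0 else Δ c

/-- `A` is a union of components of the support of `Δ` (possibly with some more sites). -/
def IsCut (A : Set S.V) (Δ : S.V → ℤ) : Prop := ∀ c ∈ A, ∀ c', Nbr c c' → Δ c' ≠ 0 → c' ∈ A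

theorem isCut_comp (Y : Finset S.V) (Δ : S.V → ℤ) : IsCut (comp Y Δ) Δ := by
  rintro c ⟨y, hy, h⟩ c' hn hc'
  exact ⟨y, hy, h.tail ⟨hn, hc'⟩⟩

/-- On an edge that leaves `A`, the difference vanishes at the outer end, so the edge may be counted
wholly with the inner part. Admissibility and the edge weights therefore split. -/
theorem IsCut.edge {A : Set S.V} {Δ : S.V → ℤ} (h : IsCut A Δ) (i : Fin 3) (c : S.V) :
    (inPart A Δ c = Δ c ∧ inPart A Δ (c - S.u i) = Δ (c - S.u i) ∧
      outPart A Δ c = 0 ∧ outPart A Δ (c - S.u i) = 0) ∨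
    (inPart A Δ c = 0 ∧ inPart A Δ (c - S.u i) = 0 ∧
      outPart A Δ c = Δ c ∧ outPart A Δ (c - S.u i) = Δ (c - S.u i)) := by
  have h1 := fun hc => h c hc (c - S.u i) ⟨i, Or.inr rfl⟩
  have h2 := fun hc => h (c - S.u i) hc c ⟨i, Or.inl (by simp)⟩
  simp only [inPart, outPart]
  by_cases hc : c ∈ A <;> by_cases hc' : c - S.u i ∈ A <;> simp_all

theorem IsCut.adm_inPart {A : Set S.V} {Δ : S.V → ℤ} (h : IsCut A Δ) (hΔ : S.Adm Δ) :
    S.Adm (inPart A Δ) := by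
  intro i c
  have := hΔ i c
  have := adm_zero (S := S) i c
  simp only [moved, Pi.zero_apply] at *
  rcases h.edge i c with ⟨e1, e2, -, -⟩ | ⟨e1, e2, -, -⟩ <;> (rw [e1, e2]; lia)

theorem IsCut.adm_outPart {A : Set S.V} {Δ : S.V → ℤ} (h : IsCut A Δ) (hΔ : S.Adm Δ) :
    S.Adm (outPart A Δ) := by
  intro i c
  have := hΔ i c
  have := adm_zero (S := S) i c
  simp only [moved, Pi.zero_apply] at *
  rcases h.edge i c with ⟨-, -, e1, e2⟩ | ⟨-, -, e1, e2⟩ <;> (rw [e1, e2]; lia)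

theorem meets_inPart (A : Set S.V) {Δ : S.V → ℤ} (h : S.Meets Δ) : S.Meets (inPart A Δ) := by
  obtain ⟨i, c, h1, h2, h3⟩ := h
  exact ⟨i, c, h1, by simp [inPart, h2], by simp [inPart, h3]⟩

theorem meets_outPart (A : Set S.V) {Δ : S.V → ℤ} (h : S.Meets Δ) : S.Meets (outPart A Δ) := by
  obtain ⟨i, c, h1, h2, h3⟩ := h
  exact ⟨i, c, h1, by simp [outPart, h2], by simp [outPart, h3]⟩

theorem inPart_add_outPart (A : Set S.V) (Δ : S.V → ℤ) (c : S.V) :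
    inPart A Δ c + outPart A Δ c = Δ c := by
  simp only [inPart, outPart]
  split_ifs <;> simp

theorem rooted_inPart {Y : Finset S.V} {Δ : S.V → ℤ} (hY : Y ⊆ S.supp Δ) :
    Rooted Y (inPart (comp Y Δ) Δ) := by
  have h0 : ∀ y ∈ Y, y ∈ comp Y Δ := fun y hy => ⟨y, hy, Relation.ReflTransGen.refl⟩
  refine ⟨fun y hy => mem_supp.2 ?_, fun c hc => ?_⟩
  · simpa [inPart, h0 y hy] using mem_supp.1 (hY hy)
  · have hcA : c ∈ comp Y Δ := by
      by_contra hcon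
      exact hc (by simp [inPart, hcon])
    obtain ⟨y, hy, hyc⟩ := hcA
    refine ⟨y, hy, ?_⟩
    clear hc
    induction hyc with
    | refl => exact Relation.ReflTransGen.refl
    | @tail b d hb hbd ih =>
      refine ih.tail ⟨hbd.1, ?_⟩
      have : d ∈ comp Y Δ := ⟨y, hy, hb.tail hbd⟩
      simpa [inPart, this] using hbd.2

/-- The Boltzmann weight of the lost faces, with extra weight `b` for the horizontal ones. -/
def edgeWeight (α b : ℝ) (Δ : S.V → ℤ) (p : Fin 3 × S.V) : ℝ :=
  if S.IsLost Δ p then Real.exp (-(α + if p.1 = 2 then b else 0)) else 1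

theorem edgeWeight_pos (α b : ℝ) (Δ : S.V → ℤ) (p : Fin 3 × S.V) : 0 < edgeWeight α b Δ p := by
  unfold edgeWeight
  split_ifs <;> positivity

theorem IsCut.edgeWeight {A : Set S.V} {Δ : S.V → ℤ} (h : IsCut A Δ) (α b : ℝ)
    (p : Fin 3 × S.V) : edgeWeight α b Δ p =
      LozengeTorus.edgeWeight α b (inPart A Δ) p * LozengeTorus.edgeWeight α b (outPart A Δ) p := by
  unfold LozengeTorus.edgeWeight IsLost
  rcases h.edge p.1 p.2 with ⟨e1, e2, e3, e4⟩ | ⟨e1, e2, e3, e4⟩ <;> simp [e1, e2, e3, e4]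

theorem prod_edgeWeight (α b : ℝ) (Δ : S.V → ℤ) : ∏ p, edgeWeight α b Δ p =
    Real.exp (-α * (S.lost Δ).card - b * ((S.lost Δ).filter fun p => p.1 = 2).card) := by
  have : ∀ p, edgeWeight α b Δ p = Real.exp ((if S.IsLost Δ p then -α else 0) +
      if S.IsLost Δ p ∧ p.1 = 2 then -b else 0) := by
    intro p
    unfold edgeWeight
    by_cases h : S.IsLost Δ p <;> by_cases h' : p.1 = 2 <;> simp [h, h'] <;> ring
  simp only [this]
  rw [← Real.exp_sum, Finset.sum_add_distrib, ← Finset.sum_filter, ← Finset.sum_filter, lost,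
    Finset.filter_filter]
  simp only [Finset.sum_const, nsmul_eq_mul]
  congr 1
  ring

end LozengeTorus

/-! ### Local potentials, and the expansion over activated balls -/

/-- A family of local functions of lozenge patterns with bounds. -/
structure Potential where
  α : ℝ
  g : ℕ → Set Lozenge → ℝ
  ε : ℕ → ℝ
  abs_le : ∀ r T, |g r T| ≤ ε r

theorem Potential.eps_nonneg (m : Potential) (r : ℕ) : 0 ≤ m.ε r :=
  (abs_nonneg _).trans (m.abs_le r ∅)

theorem Lozenge.MeetsBall.mem {r : ℕ} {l : Lozenge} (h : l.MeetsBall r) :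
    l.base ∈ triBall r ∧ l.base - unitVec l.dir ∈ triBall r := by
  obtain ⟨t, ht, hv⟩ := h
  have e : l.base - unitVec l.dir = l.base + unitVec (l.dir + 1) + unitVec (l.dir + 2) := by
    obtain ⟨d, v⟩ := l
    fin_cases d <;> ext <;> simp [unitVec, sub_eq_add_neg]
  rw [mem_triBall, mem_triBall, e]
  rcases ht with rfl | rfl
  · exact ⟨hv _ (by simp), hv _ (by simp)⟩
  · exact ⟨hv _ (by simp), hv _ (by simp)⟩

namespace LozengeTorus

variable {S : LozengeTorus}

/-- The lozenges around `c`, translated to the origin, of the tiling with height difference `Δ`. -/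
def pattern (S : LozengeTorus) (Δ : S.V → ℤ) (c : S.V) (r : ℕ) : Set Lozenge :=
  {l | S.moved Δ l.dir (c + S.proj l.base) = 1 ∧ l.MeetsBall r}

theorem pattern_congr {Δ Δ' : S.V → ℤ} {c : S.V} {r : ℕ}
    (h : ∀ v ∈ triBall r, Δ (c + S.proj v) = Δ' (c + S.proj v)) :
    S.pattern Δ c r = S.pattern Δ' c r := by
  ext l
  refine and_congr_left fun hl => ?_
  have h1 := h _ hl.mem.1
  have h2 := h _ hl.mem.2
  rw [map_sub, ← add_sub_assoc] at h2
  simp only [moved, u, h1, h2]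

/-- The (shifted, non-negative) change of the potential at the ball `q`. -/
def tilt (S : LozengeTorus) (m : Potential) (M : ℕ) (Δ : S.V → ℤ) (q : S.V × Fin M) : ℝ :=
  if (q.2 : ℕ) ∈ scales S.size then
    m.g q.2 (S.pattern 0 q.1 q.2) - m.g q.2 (S.pattern Δ q.1 q.2) + 2 * m.ε q.2
  else 0

theorem tilt_congr {m : Potential} {M : ℕ} {Δ Δ' : S.V → ℤ} {q : S.V × Fin M}
    (h : ∀ v ∈ triBall q.2, Δ (q.1 + S.proj v) = Δ' (q.1 + S.proj v)) :
    S.tilt m M Δ q = S.tilt m M Δ' q := by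
  unfold tilt
  rw [pattern_congr h]

theorem tilt_nonneg (m : Potential) (M : ℕ) (Δ : S.V → ℤ) (q : S.V × Fin M) :
    0 ≤ S.tilt m M Δ q := by
  unfold tilt
  split_ifs
  · have h1 := abs_le.1 (m.abs_le q.2 (S.pattern 0 q.1 q.2))
    have h2 := abs_le.1 (m.abs_le q.2 (S.pattern Δ q.1 q.2))
    linarith
  · exact le_rfl

theorem tilt_le (m : Potential) (M : ℕ) (Δ : S.V → ℤ) (q : S.V × Fin M) :
    S.tilt m M Δ q ≤ 4 * m.ε q.2 := by
  unfold tilt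
  split_ifs
  · have h1 := abs_le.1 (m.abs_le q.2 (S.pattern 0 q.1 q.2))
    have h2 := abs_le.1 (m.abs_le q.2 (S.pattern Δ q.1 q.2))
    linarith
  · have := m.eps_nonneg q.2
    linarith

/-- The weight of a pair of a height difference and a set of activated balls. -/
def weight (m : Potential) (b : ℝ) (M : ℕ) (ω : S.Conf × Finset (S.V × Fin M)) : ℝ :=
  (∏ p, edgeWeight m.α b ω.1.1 p) * ∏ q, if q ∈ ω.2 then Real.exp (S.tilt m M ω.1.1 q) - 1 else 1

theorem weight_nonneg (m : Potential) (b : ℝ) (M : ℕ) (ω : S.Conf × Finset (S.V × Fin M)) :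
    0 ≤ weight m b M ω := by
  refine mul_nonneg (Finset.prod_nonneg fun p _ => (edgeWeight_pos _ _ _ _).le)
    (Finset.prod_nonneg fun q _ => ?_)
  split_ifs
  · have := Real.one_le_exp (tilt_nonneg m M ω.1.1 q)
    linarith
  · exact zero_le_one

/-- The marginal weight of a height difference. -/
def confWeight (m : Potential) (b : ℝ) (M : ℕ) (Δ : S.V → ℤ) : ℝ :=
  (∏ p, edgeWeight m.α b Δ p) * ∏ q, Real.exp (S.tilt m M Δ q)

theorem confWeight_pos (m : Potential) (b : ℝ) (M : ℕ) (Δ : S.V → ℤ) :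
    0 < confWeight m b M Δ :=
  mul_pos (Finset.prod_pos fun _ _ => edgeWeight_pos _ _ _ _)
    (Finset.prod_pos fun _ _ => Real.exp_pos _)

/-- Expand the product over balls of `(exp tilt - 1) + 1`, the summand 1 being struck out for the
balls that must be active. -/
theorem sum_weight_superset (m : Potential) (b : ℝ) (M : ℕ) (Δ : S.Conf)
    (B₀ : Finset (S.V × Fin M)) :
    ∑ B, (if B₀ ⊆ B then weight m b M (Δ, B) else 0) = (∏ p, edgeWeight m.α b Δ.1 p) *
      ∏ q, if q ∈ B₀ then Real.exp (S.tilt m M Δ.1 q) - 1 else Real.exp (S.tilt m M Δ.1 q) := by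
  have e : ∀ q, (if q ∈ B₀ then Real.exp (S.tilt m M Δ.1 q) - 1 else Real.exp (S.tilt m M Δ.1 q)) =
      (Real.exp (S.tilt m M Δ.1 q) - 1) + if q ∈ B₀ then 0 else 1 := by
    intro q
    split_ifs <;> ring
  simp only [e]
  rw [Finset.prod_add, Finset.mul_sum, Finset.powerset_univ]
  refine Finset.sum_congr rfl fun B _ => ?_
  by_cases h : B₀ ⊆ B
  · have h1 : ∏ q ∈ Finset.univ \ B, (if q ∈ B₀ then (0 : ℝ) else 1) = 1 :=
      Finset.prod_eq_one fun q hq => if_neg fun hq' => (Finset.mem_sdiff.1 hq).2 (h hq')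
    rw [if_pos h, h1, weight, mul_one, Finset.prod_ite_mem, Finset.univ_inter]
  · obtain ⟨q, hq, hqB⟩ := Finset.not_subset.1 h
    have h1 : ∏ q ∈ Finset.univ \ B, (if q ∈ B₀ then (0 : ℝ) else 1) = 0 :=
      Finset.prod_eq_zero (Finset.mem_sdiff.2 ⟨Finset.mem_univ q, hqB⟩) (if_pos hq)
    rw [if_neg h, h1, mul_zero, mul_zero]

theorem sum_weight (m : Potential) (b : ℝ) (M : ℕ) (Δ : S.Conf) :
    ∑ B, weight m b M (Δ, B) = confWeight m b M Δ.1 := by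
  have := sum_weight_superset m b M Δ ∅
  simpa [confWeight] using this

/-- The partition function. -/
def partition (S : LozengeTorus) (m : Potential) (b : ℝ) (M : ℕ) : ℝ :=
  ∑ Δ : S.Conf, confWeight m b M Δ.1

theorem partition_pos (m : Potential) (b : ℝ) (M : ℕ) : 0 < S.partition m b M :=
  Finset.sum_pos (fun _ _ => confWeight_pos _ _ _ _) ⟨zeroConf, Finset.mem_univ _⟩

theorem sum_weight_eq_partition (m : Potential) (b : ℝ) (M : ℕ) :
    ∑ ω : S.Conf × Finset (S.V × Fin M), weight m b M ω = S.partition m b M := by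
  rw [Fintype.sum_prod_type]
  exact Finset.sum_congr rfl fun Δ _ => sum_weight m b M Δ

/-! ### The Peierls bound -/

/-- The total strength of the balls that contain a given site. -/
def strength (m : Potential) (M : ℕ) : ℝ := ∑ ρ : Fin M, 4 * m.ε ρ * (triBall ρ).card

/-- The price of a site of the support. -/
def siteCost (m : Potential) : ℝ := 16 ^ 7 * Real.exp (1 - m.α / 3)

/-- The price of an activated ball. -/
def ballCost (m : Potential) (ρ : ℕ) : ℝ := Real.exp (4 * m.ε ρ) - 1

theorem siteCost_pos (m : Potential) : 0 < siteCost m := by unfold siteCost; positivity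

theorem ballCost_nonneg (m : Potential) (ρ : ℕ) : 0 ≤ ballCost m ρ := by
  have := Real.one_le_exp (mul_nonneg zero_le_four (m.eps_nonneg ρ))
  unfold ballCost
  linarith

/-- At most `(triBall ρ).card` balls of radius `ρ` contain a given site, so the exponents add up to
at most `strength` per site of `A`. -/
theorem prod_touching_le (m : Potential) (M : ℕ) (hm : strength m M ≤ 1) (A : Finset S.V) :
    ∏ q : S.V × Fin M, (if ∃ v ∈ triBall q.2, q.1 + S.proj v ∈ A then Real.exp (4 * m.ε q.2)
      else 1) ≤ Real.exp A.card := by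
  have e : ∀ q : S.V × Fin M, (if ∃ v ∈ triBall q.2, q.1 + S.proj v ∈ A then
      Real.exp (4 * m.ε q.2) else 1) =
      Real.exp (if ∃ v ∈ triBall q.2, q.1 + S.proj v ∈ A then 4 * m.ε q.2 else 0) := by
    intro q
    split_ifs <;> simp
  simp only [e]
  rw [← Real.exp_sum, Real.exp_le_exp, Fintype.sum_prod_type_right]
  calc _ ≤ ∑ ρ : Fin M, 4 * m.ε ρ * ((triBall ρ).card * A.card : ℝ) := by
        refine Finset.sum_le_sum fun ρ _ => ?_
        rw [← Finset.sum_filter]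
        simp only [Finset.sum_const, nsmul_eq_mul]
        rw [mul_comm]
        refine mul_le_mul_of_nonneg_left ?_ (mul_nonneg zero_le_four (m.eps_nonneg ρ))
        have hsub : (Finset.univ.filter fun c : S.V => ∃ v ∈ triBall ρ, c + S.proj v ∈ A) ⊆
            (triBall ρ).biUnion fun v => A.image (· - S.proj v) := by
          intro c hc
          obtain ⟨v, hv, hcv⟩ := (Finset.mem_filter.1 hc).2
          exact Finset.mem_biUnion.2 ⟨v, hv, Finset.mem_image.2 ⟨_, hcv, by simp⟩⟩
        have := (Finset.card_le_card hsub).trans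
          (Finset.card_biUnion_le_card_mul _ _ _ fun v _ => Finset.card_image_le)
        exact_mod_cast this
    _ = strength m M * A.card := by
        rw [strength, Finset.sum_mul]
        exact Finset.sum_congr rfl fun ρ _ => by ring
    _ ≤ A.card := mul_le_of_le_one_left (Nat.cast_nonneg _) hm

/-- A ball that misses the support of the inner part sees only the outer part. A ball that touches
it, or that is prescribed, is bounded by its maximal factor, and the remaining factors on the right
are at least one because `tilt` was shifted to be non-negative. -/
theorem ball_factor_le (m : Potential) (M : ℕ) (A : Set S.V) (Δ : S.V → ℤ)
    (B₀ : Finset (S.V × Fin M)) (q : S.V × Fin M) :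
    (if q ∈ B₀ then Real.exp (S.tilt m M Δ q) - 1 else Real.exp (S.tilt m M Δ q)) ≤
      (if q ∈ B₀ then ballCost m q.2 else 1) *
        ((if ∃ v ∈ triBall q.2, q.1 + S.proj v ∈ S.supp (inPart A Δ) then
          Real.exp (4 * m.ε q.2) else 1) * Real.exp (S.tilt m M (outPart A Δ) q)) := by
  have h1 := Real.exp_le_exp.2 (tilt_le m M Δ q)
  have h2 := Real.one_le_exp (tilt_nonneg m M (outPart A Δ) q)
  have h3 := Real.one_le_exp (mul_nonneg zero_le_four (m.eps_nonneg q.2))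
  have h4 := ballCost_nonneg m q.2
  split_ifs with hB ht ht
  · rw [← mul_one (Real.exp _ - 1)]
    exact mul_le_mul (sub_le_sub_right h1 1) (one_le_mul_of_one_le_of_one_le h3 h2) zero_le_one h4
  · rw [← mul_one (Real.exp _ - 1)]
    exact mul_le_mul (sub_le_sub_right h1 1) (by simpa using h2) zero_le_one h4
  · rw [one_mul]
    exact h1.trans (le_mul_of_one_le_right (Real.exp_pos _).le h2)
  · rw [one_mul, one_mul]
    refine (congrArg Real.exp (tilt_congr fun v hv => ?_)).le
    have : inPart A Δ (q.1 + S.proj v) = 0 := by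
      by_contra hcon
      exact ht ⟨v, hv, mem_supp.2 hcon⟩
    have h5 := inPart_add_outPart A Δ (q.1 + S.proj v)
    lia

/-- Cut out the components of the support that contain points of `Y`. What is left is again a
configuration, and summing over it gives at most the partition function. The part cut out is rooted
at `Y`; its lost faces pay for its entropy, for the balls that touch it and for a factor `siteCost`
per point of `Y`. -/
theorem peierls (m : Potential) (b : ℝ) (M : ℕ) (hα : 0 ≤ m.α) (hm : strength m M ≤ 1)
    (hs : siteCost m ≤ 1) (Y : Finset S.V) (B₀ : Finset (S.V × Fin M)) (f : ℝ)
    (hf0 : 0 ≤ f) (hf : ∀ Δ : S.Conf, Y ⊆ S.supp Δ.1 →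
      Real.exp (-b * ((S.lost Δ.1).filter fun p => p.1 = 2).card) ≤ f) :
    ∑ ω : S.Conf × Finset (S.V × Fin M),
      (if Y ⊆ S.supp ω.1.1 ∧ B₀ ⊆ ω.2 then weight m b M ω else 0) ≤
        f * (siteCost m ^ Y.card * ∏ q ∈ B₀, ballCost m q.2) * S.partition m b M := by
  set P : ℝ := ∏ q ∈ B₀, ballCost m q.2 with hP
  have hP0 : 0 ≤ P := Finset.prod_nonneg fun q _ => ballCost_nonneg m q.2
  let ι : S.Conf → S.Conf × S.Conf := fun Δ =>
    (⟨inPart (comp Y Δ.1) Δ.1, (isCut_comp Y Δ.1).adm_inPart Δ.2.1, meets_inPart _ Δ.2.2⟩,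
      ⟨outPart (comp Y Δ.1) Δ.1, (isCut_comp Y Δ.1).adm_outPart Δ.2.1, meets_outPart _ Δ.2.2⟩)
  have hι : Function.Injective ι := by
    intro Δ Δ' h
    refine Subtype.ext (funext fun c => ?_)
    have h1 := congrFun (congrArg (fun z => z.1.1) h) c
    have h2 := congrFun (congrArg (fun z => z.2.1) h) c
    simp only [ι] at h1 h2
    rw [← inPart_add_outPart (comp Y Δ.1) Δ.1 c, ← inPart_add_outPart (comp Y Δ'.1) Δ'.1 c, h1, h2]
  let Φ : S.Conf × S.Conf → ℝ := fun z =>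
    (f * (siteCost m ^ Y.card * P)) *
      ((if Rooted Y z.1.1 then ((16 : ℝ) ^ 7)⁻¹ ^ (S.supp z.1.1).card else 0) *
        confWeight m b M z.2.1)
  have hΦ0 : ∀ z, 0 ≤ Φ z := by
    intro z
    have := (confWeight_pos m b M z.2.1).le
    have := (siteCost_pos m).le
    simp only [Φ]
    split_ifs <;> positivity
  have key : ∀ Δ : S.Conf, Y ⊆ S.supp Δ.1 →
      (∏ p, edgeWeight m.α b Δ.1 p) * (∏ q, if q ∈ B₀ then Real.exp (S.tilt m M Δ.1 q) - 1
        else Real.exp (S.tilt m M Δ.1 q)) ≤ Φ (ι Δ) := by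
    intro Δ hY
    have hr : Rooted Y (ι Δ).1.1 := rooted_inPart hY
    set Δi := (ι Δ).1 with hΔi
    set Δo := (ι Δ).2 with hΔo
    have e1 : (∏ p, edgeWeight m.α b Δ.1 p) =
        (∏ p, edgeWeight m.α b Δi.1 p) * ∏ p, edgeWeight m.α b Δo.1 p := by
      rw [← Finset.prod_mul_distrib]
      exact Finset.prod_congr rfl fun p _ => (isCut_comp Y Δ.1).edgeWeight m.α b p
    have e2 : (∏ q, if q ∈ B₀ then Real.exp (S.tilt m M Δ.1 q) - 1
        else Real.exp (S.tilt m M Δ.1 q)) ≤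
        P * (Real.exp (S.supp Δi.1).card * ∏ q, Real.exp (S.tilt m M Δo.1 q)) := by
      refine (Finset.prod_le_prod (fun q _ => ?_)
        fun q _ => ball_factor_le m M (comp Y Δ.1) Δ.1 B₀ q).trans ?_
      · have := Real.one_le_exp (tilt_nonneg m M Δ.1 q)
        split_ifs <;> linarith
      · rw [Finset.prod_mul_distrib, Finset.prod_mul_distrib, Finset.prod_ite_mem,
          Finset.univ_inter]
        refine mul_le_mul_of_nonneg_left ?_ hP0
        exact mul_le_mul_of_nonneg_right (prod_touching_le m M hm _)
          (Finset.prod_nonneg fun q _ => (Real.exp_pos _).le)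
    -- Energy against entropy: there is at least one lost face per three sites of the support, which
    -- gives `exp (1 - α / 3)` per site, and `16 ^ (-7)` of this is set aside for
    -- `sum_rooted_le_one`.
    have e3 : (∏ p, edgeWeight m.α b Δi.1 p) * Real.exp (S.supp Δi.1).card ≤
        f * siteCost m ^ Y.card * ((16 : ℝ) ^ 7)⁻¹ ^ (S.supp Δi.1).card := by
      have hc : ((S.supp Δi.1).card : ℝ) ≤ 3 * (S.lost Δi.1).card := by
        exact_mod_cast card_supp_le Δi.2.1
      have hs' : siteCost m ^ (S.supp Δi.1).card ≤ siteCost m ^ Y.card :=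
        pow_le_pow_of_le_one (siteCost_pos m).le hs (Finset.card_le_card hr.1)
      calc _ = Real.exp (-b * ((S.lost Δi.1).filter fun p => p.1 = 2).card) *
            Real.exp (-m.α * (S.lost Δi.1).card + (S.supp Δi.1).card) := by
            rw [prod_edgeWeight, ← Real.exp_add, ← Real.exp_add]
            congr 1
            ring
        _ ≤ f * Real.exp ((S.supp Δi.1).card * (1 - m.α / 3)) := by
            refine mul_le_mul (hf Δi hr.1) (Real.exp_le_exp.2 ?_) (Real.exp_pos _).le hf0
            nlinarith
        _ = f * (siteCost m ^ (S.supp Δi.1).card * ((16 : ℝ) ^ 7)⁻¹ ^ (S.supp Δi.1).card) := by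
            rw [siteCost, ← mul_pow, Real.exp_nat_mul]
            congr 2
            field_simp
        _ ≤ _ := by
            rw [mul_assoc]
            exact mul_le_mul_of_nonneg_left (mul_le_mul_of_nonneg_right hs' (by positivity)) hf0
    have p1 : 0 ≤ ∏ p, edgeWeight m.α b Δi.1 p :=
      Finset.prod_nonneg fun p _ => (edgeWeight_pos _ _ _ _).le
    have p2 : 0 ≤ ∏ p, edgeWeight m.α b Δo.1 p :=
      Finset.prod_nonneg fun p _ => (edgeWeight_pos _ _ _ _).le
    have p3 : 0 ≤ ∏ q, Real.exp (S.tilt m M Δo.1 q) :=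
      Finset.prod_nonneg fun q _ => (Real.exp_pos _).le
    have h16 := mul_le_mul_of_nonneg_right e3 (mul_nonneg hP0 (mul_nonneg p2 p3))
    rw [e1]
    refine (mul_le_mul_of_nonneg_left e2 (mul_nonneg p1 p2)).trans ?_
    simp only [Φ, ← hΔi, ← hΔo, if_pos hr, confWeight]
    refine le_trans (le_of_eq ?_) (h16.trans (le_of_eq ?_)) <;> ring
  rw [Fintype.sum_prod_type]
  calc _ ≤ ∑ Δ : S.Conf, Φ (ι Δ) := by
        refine Finset.sum_le_sum fun Δ _ => ?_
        by_cases hY : Y ⊆ S.supp Δ.1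
        · simp only [hY, true_and]
          rw [sum_weight_superset]
          exact key Δ hY
        · simp only [hY, false_and, if_false, Finset.sum_const_zero]
          exact hΦ0 _
    _ = ∑ z ∈ Finset.univ.image ι, Φ z := by
        rw [Finset.sum_image fun a _ b _ h => hι h]
    _ ≤ ∑ z, Φ z := Finset.sum_le_sum_of_subset_of_nonneg (Finset.subset_univ _) fun z _ _ => hΦ0 z
    _ = (f * (siteCost m ^ Y.card * P)) *
        ((∑ Δ : S.Conf, (if Rooted Y Δ.1 then ((16 : ℝ) ^ 7)⁻¹ ^ (S.supp Δ.1).card else 0)) *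
          S.partition m b M) := by
        rw [partition, Finset.sum_mul_sum, ← Fintype.sum_prod_type', Finset.mul_sum]
    _ ≤ _ := by
        have := (siteCost_pos m).le
        refine mul_le_mul_of_nonneg_left ?_ (by positivity)
        exact mul_le_of_le_one_left (partition_pos m b M).le (sum_rooted_le_one Y)

end LozengeTorus

/-! ### Chains of distinct objects -/

/-- There is a chain of `n` moves from `v` to the outside of the ball of radius `R`, each of which
uses a new object that is present. -/
def Chain {Obj Mv : Type} (present : Obj → Prop) (obj : ℤ × ℤ → Mv → Obj) (disp : Mv → ℤ × ℤ)
    (mv : Finset Mv) (R : ℕ) : ℕ → ℤ × ℤ → Finset Obj → Prop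
  | 0, v, _ => (R : ℤ) < triDist v 0
  | n + 1, v, U => ∃ x ∈ mv, obj v x ∉ U ∧ present (obj v x) ∧
      Chain present obj disp mv R n (v + disp x) (insert (obj v x) U)

/-- A union bound over the first move, by induction on the length. The object used is new, so its
price is one more factor in the product, and `exp (t * len)` compensates for the change of distance
to the origin. The hypothesis `h` concerns sets of objects, which is why chains must not repeat any.
-/
theorem sum_chain_le {Ω Obj Mv : Type} [Fintype Ω] {W : Ω → ℝ} (hW : ∀ ω, 0 ≤ W ω)
    {E : Ω → Prop} {present : Ω → Obj → Prop} {obj : ℤ × ℤ → Mv → Obj} {disp : Mv → ℤ × ℤ}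
    {mv : Finset Mv} {R : ℕ} {wt : Obj → ℝ} (hwt : ∀ o, 0 ≤ wt o) {κ : ℝ} (hκ : 0 ≤ κ)
    (h : ∀ U : Finset Obj, ∑ ω, (if E ω ∧ ∀ o ∈ U, present ω o then W ω else 0) ≤ κ * ∏ o ∈ U, wt o)
    {t : ℝ} (ht : 0 ≤ t) {mw len : Mv → ℝ} (hmw : ∀ v x, wt (obj v x) ≤ mw x)
    (hlen : ∀ x ∈ mv, (triDist (disp x) 0 : ℝ) ≤ len x) {σ : ℝ}
    (hσ : ∑ x ∈ mv, mw x * Real.exp (t * len x) ≤ σ) (n : ℕ) :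
    ∀ v U, ∑ ω, (if E ω ∧ (∀ o ∈ U, present ω o) ∧ Chain (present ω) obj disp mv R n v U
      then W ω else 0) ≤ κ * (∏ o ∈ U, wt o) * Real.exp (t * (triDist v 0 - R)) * σ ^ n := by
  have hmw0 : ∀ x, 0 ≤ mw x := fun x => (hwt _).trans (hmw 0 x)
  have hσ0 : 0 ≤ σ := (Finset.sum_nonneg fun x _ =>
    mul_nonneg (hmw0 x) (Real.exp_pos _).le).trans hσ
  induction n with
  | zero =>
    intro v U
    have hU : 0 ≤ κ * ∏ o ∈ U, wt o := mul_nonneg hκ (Finset.prod_nonneg fun o _ => hwt o)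
    rw [pow_zero, mul_one]
    by_cases hv : (R : ℤ) < triDist v 0
    · refine le_trans (Finset.sum_le_sum fun ω _ => ?_) ((h U).trans (le_mul_of_one_le_right hU ?_))
      · simp [Chain, hv]
      · refine Real.one_le_exp (mul_nonneg ht (sub_nonneg.2 ?_))
        exact_mod_cast hv.le
    · simp only [Chain, hv, and_false, if_false, Finset.sum_const_zero]
      exact mul_nonneg hU (Real.exp_pos _).le
  | succ n ih =>
    intro v U
    have hU : 0 ≤ κ * ∏ o ∈ U, wt o := mul_nonneg hκ (Finset.prod_nonneg fun o _ => hwt o)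
    calc _ ≤ ∑ ω, ∑ x ∈ mv, (if obj v x ∉ U then
            (if E ω ∧ (∀ o ∈ insert (obj v x) U, present ω o) ∧
              Chain (present ω) obj disp mv R n (v + disp x) (insert (obj v x) U)
              then W ω else 0) else 0) := by
          refine Finset.sum_le_sum fun ω _ => ?_
          have hnn : ∀ x ∈ mv, 0 ≤ (if obj v x ∉ U then
            (if E ω ∧ (∀ o ∈ insert (obj v x) U, present ω o) ∧
              Chain (present ω) obj disp mv R n (v + disp x) (insert (obj v x) U)
              then W ω else 0) else 0) := by
            intro x _
            split_ifs <;> first | exact hW ω | exact le_rfl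
          split_ifs with hc
          · obtain ⟨hE, hp, x, hx, hxU, hxp, hxc⟩ := hc
            have hp' : ∀ o ∈ insert (obj v x) U, present ω o := fun o ho =>
              (Finset.mem_insert.1 ho).elim (fun e => e ▸ hxp) (hp o)
            refine le_trans (le_of_eq ?_) (Finset.single_le_sum hnn hx)
            rw [if_pos hxU, if_pos ⟨hE, hp', hxc⟩]
          · exact Finset.sum_nonneg hnn
      _ = ∑ x ∈ mv, (if obj v x ∉ U then ∑ ω,
            (if E ω ∧ (∀ o ∈ insert (obj v x) U, present ω o) ∧
              Chain (present ω) obj disp mv R n (v + disp x) (insert (obj v x) U)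
              then W ω else 0) else 0) := by
          rw [Finset.sum_comm]
          exact Finset.sum_congr rfl fun x _ => by split_ifs <;> simp
      _ ≤ ∑ x ∈ mv, κ * (∏ o ∈ U, wt o) * Real.exp (t * (triDist v 0 - R)) * σ ^ n *
            (mw x * Real.exp (t * len x)) := by
          refine Finset.sum_le_sum fun x hx => ?_
          split_ifs with hxU
          · exact mul_nonneg (mul_nonneg (mul_nonneg hU (Real.exp_pos _).le) (pow_nonneg hσ0 n))
              (mul_nonneg (hmw0 x) (Real.exp_pos _).le)
          · refine (ih _ _).trans ?_
            rw [Finset.prod_insert hxU]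
            have hd : (triDist (v + disp x) 0 : ℝ) ≤ triDist v 0 + len x := by
              have h1 := triDist_triangle (v + disp x) v 0
              rw [triDist_sub (v + disp x) v, add_sub_cancel_left] at h1
              have h2 : (triDist (v + disp x) 0 : ℝ) ≤ triDist (disp x) 0 + triDist v 0 := by
                exact_mod_cast h1
              linarith [hlen x hx]
            have he : Real.exp (t * (triDist (v + disp x) 0 - R)) ≤
                Real.exp (t * (triDist v 0 - R)) * Real.exp (t * len x) := by
              rw [← Real.exp_add, Real.exp_le_exp, ← mul_add]
              exact mul_le_mul_of_nonneg_left (by linarith) ht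
            calc _ = κ * (∏ o ∈ U, wt o) * σ ^ n *
                  (wt (obj v x) * Real.exp (t * (triDist (v + disp x) 0 - R))) := by ring
              _ ≤ κ * (∏ o ∈ U, wt o) * σ ^ n *
                  (mw x * (Real.exp (t * (triDist v 0 - R)) * Real.exp (t * len x))) := by
                refine mul_le_mul_of_nonneg_left ?_ (mul_nonneg hU (pow_nonneg hσ0 n))
                exact mul_le_mul (hmw v x) he (Real.exp_pos _).le (hmw0 x)
              _ = _ := by ring
      _ ≤ _ := by
          rw [← Finset.mul_sum, pow_succ, ← mul_assoc]
          exact mul_le_mul_of_nonneg_left hσ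
            (mul_nonneg (mul_nonneg hU (Real.exp_pos _).le) (pow_nonneg hσ0 n))

theorem sum_exists_chain_le {Ω Obj Mv : Type} [Fintype Ω] {W : Ω → ℝ} (hW : ∀ ω, 0 ≤ W ω)
    {E : Ω → Prop} {present : Ω → Obj → Prop} {obj : ℤ × ℤ → Mv → Obj} {disp : Mv → ℤ × ℤ}
    {mv : Finset Mv} {R : ℕ} {wt : Obj → ℝ} (hwt : ∀ o, 0 ≤ wt o) {κ : ℝ} (hκ : 0 ≤ κ)
    (h : ∀ U : Finset Obj, ∑ ω, (if E ω ∧ ∀ o ∈ U, present ω o then W ω else 0) ≤ κ * ∏ o ∈ U, wt o)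
    {t : ℝ} (ht : 0 ≤ t) {mw len : Mv → ℝ} (hmw : ∀ v x, wt (obj v x) ≤ mw x)
    (hlen : ∀ x ∈ mv, (triDist (disp x) 0 : ℝ) ≤ len x)
    (hσ : ∑ x ∈ mv, mw x * Real.exp (t * len x) ≤ 1 / 2) :
    ∑ ω, (if E ω ∧ ∃ n, Chain (present ω) obj disp mv R n 0 ∅ then W ω else 0) ≤
      2 * κ * Real.exp (-t * R) := by
  -- There are finitely many `ω`, so the lengths needed are bounded and the union over lengths is a
  -- finite sum.
  obtain ⟨n₀, hn₀⟩ : ∃ n₀ : ℕ, ∀ ω, (∃ n, Chain (present ω) obj disp mv R n 0 ∅) →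
      ∃ n < n₀, Chain (present ω) obj disp mv R n 0 ∅ := by
    have : ∀ ω, ∃ k : ℕ, (∃ n, Chain (present ω) obj disp mv R n 0 ∅) →
        Chain (present ω) obj disp mv R k 0 ∅ := by
      intro ω
      by_cases hex : ∃ n, Chain (present ω) obj disp mv R n 0 ∅
      · exact ⟨hex.choose, fun _ => hex.choose_spec⟩
      · exact ⟨0, fun hh => (hex hh).elim⟩
    choose k hk using this
    refine ⟨Finset.univ.sup k + 1, fun ω hω => ⟨k ω, ?_, hk ω hω⟩⟩
    exact Nat.lt_succ_of_le (Finset.le_sup (Finset.mem_univ ω))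
  calc _ ≤ ∑ ω, ∑ n ∈ Finset.range n₀,
        (if E ω ∧ (∀ o ∈ (∅ : Finset Obj), present ω o) ∧ Chain (present ω) obj disp mv R n 0 ∅
          then W ω else 0) := by
        refine Finset.sum_le_sum fun ω _ => ?_
        have hnn : ∀ n ∈ Finset.range n₀, 0 ≤ (if E ω ∧ (∀ o ∈ (∅ : Finset Obj), present ω o) ∧
            Chain (present ω) obj disp mv R n 0 ∅ then W ω else 0) := by
          intro n _
          split_ifs <;> first | exact hW ω | exact le_rfl
        split_ifs with hc
        · obtain ⟨n, hn, hnc⟩ := hn₀ ω hc.2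
          refine le_trans (le_of_eq ?_) (Finset.single_le_sum hnn (Finset.mem_range.2 hn))
          rw [if_pos ⟨hc.1, by simp, hnc⟩]
        · exact Finset.sum_nonneg hnn
    _ ≤ ∑ n ∈ Finset.range n₀, κ * Real.exp (-t * R) * (1 / 2) ^ n := by
        rw [Finset.sum_comm]
        refine Finset.sum_le_sum fun n _ => ?_
        refine (sum_chain_le hW hwt hκ h ht hmw hlen hσ n 0 ∅).trans (le_of_eq ?_)
        rw [triDist_self]
        simp
    _ ≤ _ := by
        rw [← Finset.mul_sum, mul_comm 2 κ, mul_assoc, mul_assoc]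
        refine mul_le_mul_of_nonneg_left ?_ hκ
        rw [mul_comm]
        refine mul_le_mul_of_nonneg_right ?_ (Real.exp_pos _).le
        have := Summable.sum_le_tsum (Finset.range n₀) (fun n _ => by positivity)
          summable_geometric_two
        rwa [tsum_geometric_two] at this

/-! ### Clusters -/

/-- A step to an occupied site at distance at most two, or inside an active ball. -/
def Step {M : ℕ} (occ : ℤ × ℤ → Prop) (act : ℤ × ℤ → Fin M → Prop) (v w : ℤ × ℤ) : Prop :=
  (triDist v w ≤ 2 ∧ occ w) ∨ ∃ y ρ, act y ρ ∧ triDist v y ≤ (ρ : ℕ) ∧ triDist w y ≤ (ρ : ℕ)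

/-- The sites that can be reached from the origin. -/
def cluster {M : ℕ} (occ : ℤ × ℤ → Prop) (act : ℤ × ℤ → Fin M → Prop) : Set (ℤ × ℤ) :=
  {v | Relation.ReflTransGen (Step occ act) 0 v}

/-- The moves of a chain: a step to an occupied site, or through a ball. -/
abbrev Move (M : ℕ) : Type := Bool × ((ℤ × ℤ) ⊕ (Σ _ : Fin M, (ℤ × ℤ) × (ℤ × ℤ)))

/-- The displacement of a move. -/
def Move.disp {M : ℕ} : Move M → ℤ × ℤ
  | (_, Sum.inl d) => d
  | (_, Sum.inr q) => q.2.1 + q.2.2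

/-- The set of moves. -/
def moves (M : ℕ) : Finset (Move M) :=
  Finset.univ ×ˢ ((triBall 2).disjSum (Finset.univ.sigma fun ρ : Fin M => triBall ρ ×ˢ triBall ρ))

/-- The object used by a move from `v`. -/
def Move.obj {M : ℕ} {Obj : Type} (kS : Bool → ℤ × ℤ → Obj) (kB : Bool → ℤ × ℤ → Fin M → Obj)
    (v : ℤ × ℤ) : Move M → Obj
  | (s, Sum.inl d) => kS s (v + d)
  | (s, Sum.inr q) => kB s (v + q.2.1) q.1

/-- `w` can be reached from `v` in `n` steps. -/
def ReachIn (step : ℤ × ℤ → ℤ × ℤ → Prop) : ℕ → ℤ × ℤ → ℤ × ℤ → Prop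
  | 0, v, w => v = w
  | n + 1, v, w => ∃ z, step v z ∧ ReachIn step n z w

theorem ReachIn.trans {step : ℤ × ℤ → ℤ × ℤ → Prop} {n k : ℕ} {v w z : ℤ × ℤ}
    (h : ReachIn step n v w) (h' : ReachIn step k w z) : ReachIn step (n + k) v z := by
  induction n generalizing v with
  | zero =>
    obtain rfl : v = w := h
    simpa using h'
  | succ n ih =>
    obtain ⟨y, hy, hyw⟩ := h
    rw [Nat.add_right_comm]
    exact ⟨y, hy, ih hyw⟩

theorem ReachIn.single {step : ℤ × ℤ → ℤ × ℤ → Prop} {v w : ℤ × ℤ} (h : step v w) :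
    ReachIn step 1 v w := ⟨w, h, rfl⟩

theorem exists_reachIn {step : ℤ × ℤ → ℤ × ℤ → Prop} {v w : ℤ × ℤ}
    (h : Relation.ReflTransGen step v w) : ∃ n, ReachIn step n v w := by
  induction h with
  | refl => exact ⟨0, rfl⟩
  | tail _ hs ih =>
    obtain ⟨n, hn⟩ := ih
    exact ⟨n + 1, hn.trans (ReachIn.single hs)⟩

/-- One of the four displacements by `±ρ` along a coordinate axis increases the distance to the
origin by `ρ`. So a ball that is not inside the ball of radius `R` offers an exit in one step. -/
theorem exists_mem_ball_far (y : ℤ × ℤ) (ρ : ℕ) :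
    ∃ z, triDist z y ≤ ρ ∧ triDist y 0 + ρ ≤ triDist z 0 := by
  have key : ∀ d : ℤ × ℤ, triDist d 0 ≤ ρ → triDist y 0 + ρ ≤ triDist (y + d) 0 →
      ∃ z, triDist z y ≤ ρ ∧ triDist y 0 + ρ ≤ triDist z 0 := by
    intro d h1 h2
    refine ⟨y + d, ?_, h2⟩
    rwa [triDist_sub, add_sub_cancel_left]
  have hρ : ∀ z : ℤ × ℤ, (z = ((ρ : ℤ), 0) ∨ z = (-(ρ : ℤ), 0) ∨ z = (0, (ρ : ℤ)) ∨ z = (0, -(ρ : ℤ))) →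
      triDist z 0 ≤ ρ := by
    rintro z (rfl | rfl | rfl | rfl) <;> (rw [triDist_le_iff]; simp)
  have hm := triDist_le_iff.1 (le_refl (triDist (y + ((ρ : ℤ), 0)) 0))
  have hm' := triDist_le_iff.1 (le_refl (triDist (y + (-(ρ : ℤ), 0)) 0))
  have hn := triDist_le_iff.1 (le_refl (triDist (y + (0, (ρ : ℤ))) 0))
  have hn' := triDist_le_iff.1 (le_refl (triDist (y + (0, -(ρ : ℤ))) 0))
  by_contra hcon
  have c1 := fun h => hcon (key ((ρ : ℤ), 0) (hρ _ (by simp)) h)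
  have c2 := fun h => hcon (key (-(ρ : ℤ), 0) (hρ _ (by simp)) h)
  have c3 := fun h => hcon (key (0, (ρ : ℤ)) (hρ _ (by simp)) h)
  have c4 := fun h => hcon (key (0, -(ρ : ℤ)) (hρ _ (by simp)) h)
  simp only [imp_false, not_le] at c1 c2 c3 c4
  have : triDist y 0 ≤ triDist y 0 - 1 := by
    rw [triDist_le_iff]
    simp only [Prod.fst_add, Prod.snd_add, Prod.fst_zero, Prod.snd_zero] at *
    omega
  omega

/-- A path of minimal length that leaves the ball of radius `R` never uses an object twice, since
reuse would provide a shortcut. Objects live on the torus, so equal objects come from equal lattice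
points only at moderate distances; this is where the distance bounds in `hSS` and `hBB` enter. -/
theorem exists_chain {M : ℕ} {Obj : Type} {occ : Bool → ℤ × ℤ → Prop}
    {act : Bool → ℤ × ℤ → Fin M → Prop} {kS : Bool → ℤ × ℤ → Obj}
    {kB : Bool → ℤ × ℤ → Fin M → Obj} {present : Obj → Prop}
    (hpS : ∀ s v, occ s v → present (kS s v)) (hpB : ∀ s v ρ, act s v ρ → present (kB s v ρ))
    {R : ℕ} (hSB : ∀ s v s' v' ρ, kS s v ≠ kB s' v' ρ)
    (hSS : ∀ s v s' v', kS s v = kS s' v' → triDist v v' ≤ 2 * R + 2 → v = v')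
    (hBB : ∀ s v ρ s' v' ρ', kB s v ρ = kB s' v' ρ' →
      s = s' ∧ ρ = ρ' ∧ (triDist v v' ≤ 2 * R → v = v'))
    {z : ℤ × ℤ} (hz : z ∈ cluster (fun v => ∃ s, occ s v) fun y ρ => ∃ s, act s y ρ)
    (hzR : (R : ℤ) < triDist z 0) :
    ∃ n, Chain present (Move.obj kS kB) Move.disp (moves M) R n 0 ∅ := by
  set step := Step (fun v => ∃ s, occ s v) fun y (ρ : Fin M) => ∃ s, act s y ρ with hstep
  have hex : ∃ n, ∃ z, ReachIn step n 0 z ∧ (R : ℤ) < triDist z 0 := by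
    obtain ⟨n, hn⟩ := exists_reachIn hz
    exact ⟨n, z, hn, hzR⟩
  obtain ⟨z, hz, hzR⟩ := Nat.find_spec hex
  have hmin : ∀ k z, ReachIn step k 0 z → (R : ℤ) < triDist z 0 → Nat.find hex ≤ k :=
    fun k z h1 h2 => Nat.find_min' hex ⟨z, h1, h2⟩
  generalize hn₀ : Nat.find hex = n₀ at *
  -- The invariant for used objects: the sites, and the balls with their whole extent, lie within
  -- distance `R` of the origin, and they were reached no later than step `k`.
  let Old : ℕ → Obj → Prop := fun k o =>
    (∃ s w i, o = kS s w ∧ ReachIn step i 0 w ∧ i ≤ k ∧ triDist w 0 ≤ R) ∨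
    (∃ s y ρ w i, o = kB s y ρ ∧ act s y ρ ∧ ReachIn step i 0 w ∧ i < k ∧
      triDist w y ≤ (ρ : ℕ) ∧ triDist y 0 + (ρ : ℕ) ≤ R)
  have hOld : ∀ k o, Old k o → Old (k + 1) o := by
    rintro k o (⟨s, w, i, h1, h2, h3, h4⟩ | ⟨s, y, ρ, w, i, h1, h2, h3, h4, h5⟩)
    · exact Or.inl ⟨s, w, i, h1, h2, by omega, h4⟩
    · exact Or.inr ⟨s, y, ρ, w, i, h1, h2, h3, by omega, h5⟩
  have main : ∀ j k v U, k + j = n₀ → ReachIn step k 0 v → ReachIn step j v z →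
      (∀ o ∈ U, Old k o) → Chain present (Move.obj kS kB) Move.disp (moves M) R j v U := by
    intro j
    induction j with
    | zero =>
      intro k v U _ _ hvz _
      obtain rfl : v = z := hvz
      exact hzR
    | succ j ih =>
      intro k v U hk hv hvz hU
      obtain ⟨w, hvw, hwz⟩ := hvz
      have hvR : triDist v 0 ≤ R := by
        by_contra hcon
        have := hmin k v hv (not_le.1 hcon)
        omega
      have hw : ReachIn step (k + 1) 0 w := hv.trans (ReachIn.single hvw)
      have hshort : ∀ i, ReachIn step i 0 w → k + 1 ≤ i := by
        intro i hi
        have := hmin _ z (hi.trans hwz) hzR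
        omega
      have hnext : ∀ U, (triDist w 0 ≤ R → ∀ o ∈ U, Old (k + 1) o) →
          Chain present (Move.obj kS kB) Move.disp (moves M) R j w U := by
        intro U hU
        by_cases hwR : triDist w 0 ≤ R
        · exact ih (k + 1) w U (by omega) hw hwz (hU hwR)
        · have := hmin _ w hw (not_le.1 hwR)
          obtain rfl : j = 0 := by omega
          exact not_le.1 hwR
      rcases hvw with ⟨hd, s, ho⟩ | ⟨y, ρ, ⟨s, ha⟩, hvy, hwy⟩
      · refine ⟨(s, Sum.inl (w - v)), ?_, ?_, ?_, ?_⟩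
        · rw [triDist_comm, triDist_sub] at hd
          simpa [moves, mem_triBall] using hd
        · intro hmem
          simp only [Move.obj, add_sub_cancel] at hmem
          rcases hU _ hmem with ⟨s', w', i, h1, h2, h3, h4⟩ | ⟨s', y, ρ, w', i, h1, -⟩
          · have := triDist_triangle w v w'
            have := triDist_triangle v 0 w'
            rw [triDist_comm v w] at hd
            rw [triDist_comm 0 w'] at this
            obtain rfl := hSS _ _ _ _ h1 (by omega)
            have := hshort i h2
            omega
          · exact hSB _ _ _ _ _ h1
        · simpa [Move.obj] using hpS s w ho
        · have e : v + Move.disp ((s, Sum.inl (w - v)) : Move M) = w := by simp [Move.disp]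
          rw [e]
          refine hnext _ fun hwR o ho' => ?_
          rcases Finset.mem_insert.1 ho' with rfl | ho'
          · exact Or.inl ⟨s, w, k + 1, by simp [Move.obj], hw, le_rfl, hwR⟩
          · exact hOld _ _ (hU o ho')
      · have hreach : ∀ z', triDist z' y ≤ (ρ : ℕ) → ∀ i v, ReachIn step i 0 v →
            triDist v y ≤ (ρ : ℕ) → ReachIn step (i + 1) 0 z' := fun z' hz' i v hv hvy =>
          hv.trans (ReachIn.single (Or.inr ⟨y, ρ, ⟨s, ha⟩, hvy, hz'⟩))
        refine ⟨(s, Sum.inr ⟨ρ, (y - v, w - y)⟩), ?_, ?_, ?_, ?_⟩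
        · rw [triDist_comm, triDist_sub] at hvy
          rw [triDist_sub] at hwy
          simpa [moves, mem_triBall] using ⟨hvy, hwy⟩
        · intro hmem
          simp only [Move.obj, add_sub_cancel] at hmem
          rcases hU _ hmem with ⟨s', w', i, h1, -⟩ | ⟨s', y', ρ', w', i, h1, h2, h3, h4, h5, h6⟩
          · exact hSB _ _ _ _ _ h1.symm
          · obtain ⟨rfl, rfl, h7⟩ := hBB _ _ _ _ _ _ h1
            have := triDist_triangle y v y'
            have := triDist_triangle v 0 y'
            rw [triDist_comm 0 y'] at this
            have := triDist_comm v y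
            obtain rfl := h7 (by omega)
            have := hshort (i + 1) (hreach w hwy i w' h3 h5)
            omega
        · simpa [Move.obj] using hpB s y ρ ha
        · have e : v + Move.disp ((s, Sum.inr ⟨ρ, (y - v, w - y)⟩) : Move M) = w := by
            simp [Move.disp]
          rw [e]
          refine hnext _ fun hwR o ho' => ?_
          rcases Finset.mem_insert.1 ho' with rfl | ho'
          · refine Or.inr ⟨s, y, ρ, v, k, by simp [Move.obj], ha, hv, by omega, hvy, ?_⟩
            obtain ⟨z', hz', hz''⟩ := exists_mem_ball_far y ρ
            -- A ball that sticks out would let the path exit at this very step, so by minimality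
            -- the step is the last one and ends outside, contrary to `hwR`.
            by_contra hcon
            have := hmin (k + 1) z' (hreach z' hz' k v hv hvy) (by omega)
            have : j = 0 := by omega
            subst this
            obtain rfl : w = z := hwz
            omega
          · exact hOld _ _ (hU o ho')
  exact ⟨n₀, main n₀ 0 0 ∅ (by omega) rfl hz (by simp)⟩

/-- The labels in `l` index factors of both products; exchanging these factors and leaving the
others alone does not change the total. -/
theorem prod_mul_prod_swap {I I' L : Type} {s : Finset I} {s' : Finset I'} {l : Finset L}
    {j : L → I} {j' : L → I'} (hj : Set.InjOn j l) (hj' : Set.InjOn j' l)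
    (hs : ∀ a ∈ l, j a ∈ s) (hs' : ∀ a ∈ l, j' a ∈ s') {F G : I → ℝ} {F' G' : I' → ℝ}
    (h1 : ∀ a ∈ l, G (j a) = F' (j' a)) (h2 : ∀ a ∈ l, G' (j' a) = F (j a))
    (h3 : ∀ i, (∀ a ∈ l, j a ≠ i) → G i = F i) (h4 : ∀ i, (∀ a ∈ l, j' a ≠ i) → G' i = F' i) :
    (∏ i ∈ s, G i) * ∏ i ∈ s', G' i = (∏ i ∈ s, F i) * ∏ i ∈ s', F' i := by
  have hsub : l.image j ⊆ s := Finset.image_subset_iff.2 hs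
  have hsub' : l.image j' ⊆ s' := Finset.image_subset_iff.2 hs'
  rw [← Finset.prod_sdiff hsub, ← Finset.prod_sdiff hsub', ← Finset.prod_sdiff (f := F) hsub,
    ← Finset.prod_sdiff (f := F') hsub', Finset.prod_image hj, Finset.prod_image hj',
    Finset.prod_image hj, Finset.prod_image hj', Finset.prod_congr rfl h1,
    Finset.prod_congr rfl h2,
    Finset.prod_congr rfl fun i hi => h3 i fun a ha e =>
      (Finset.mem_sdiff.1 hi).2 (Finset.mem_image.2 ⟨a, ha, e⟩),
    Finset.prod_congr rfl fun i hi => h4 i fun a ha e =>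
      (Finset.mem_sdiff.1 hi).2 (Finset.mem_image.2 ⟨a, ha, e⟩)]
  ring

/-- The ball of radius `ρ` about `y` is contained in `K`. -/
def BallIn (K : Set (ℤ × ℤ)) (y : ℤ × ℤ) (ρ : ℕ) : Prop := ∀ z, triDist z y ≤ ρ → z ∈ K

theorem BallIn.center_mem {K : Set (ℤ × ℤ)} {y : ℤ × ℤ} {ρ : ℕ} (h : BallIn K y ρ) : y ∈ K :=
  h y (by rw [triDist_self]; positivity)

/-! ### Exchanging the states of two tori inside a cluster -/

namespace LozengeTorus

/-- The lozenge fields of `S` about `x` and of `S'` about `x'` agree up to distance `R + 1`, and the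
ball is embedded in both tori. -/
structure Agree (S S' : LozengeTorus) (x : S.V) (x' : S'.V) (R : ℕ) : Prop where
  size_left : 2 * R + 2 < S.size
  size_right : 2 * R + 2 < S'.size
  bit_eq : ∀ i v, triDist v 0 ≤ R + 1 → S.bit i (x + S.proj v) = S'.bit i (x' + S'.proj v)

theorem Agree.symm {S S' : LozengeTorus} {x : S.V} {x' : S'.V} {R : ℕ} (h : Agree S S' x x' R) :
    Agree S' S x' x R :=
  ⟨h.size_right, h.size_left, fun i v hv => (h.bit_eq i v hv).symm⟩

theorem Agree.proj_inj {S S' : LozengeTorus} {x : S.V} {x' : S'.V} {R : ℕ}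
    (h : Agree S S' x x' R) {v w : ℤ × ℤ} (hvw : x + S.proj v = x + S.proj w)
    (hd : triDist v w ≤ 2 * R + 2) : v = w := by
  by_contra hne
  have h0 : S.proj (v - w) = 0 := by
    rw [map_sub, sub_eq_zero]
    exact add_left_cancel hvw
  have := S.systole _ h0 (sub_ne_zero.2 hne)
  rw [← triDist_sub] at this
  have := h.size_left
  lia

/-- Radii up to `R` pass the cut-off at half the size, so two tori of different sizes use the same
ones inside the cluster. -/
theorem mem_scales_iff_of_le {N R ρ : ℕ} (hN : 2 * R + 2 < N) (hρ : ρ ≤ R) :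
    ρ ∈ scales N ↔ ∃ k : ℕ, ρ = 2 ^ k := by
  simp only [scales, Finset.mem_filter, Finset.mem_range]
  refine ⟨fun h => h.2.1, fun h => ⟨by lia, h, ?_⟩⟩
  rw [lt_div_iff₀ two_pos]
  exact_mod_cast (by lia : ρ * 2 < N)

section Mix

variable (S S' : LozengeTorus) (x : S.V) (x' : S'.V) {M : ℕ}

/-- Replace `Δ` on the copy of `K` by the values of `Δ'`. -/
def mixFun (K : Set (ℤ × ℤ)) (Δ : S.V → ℤ) (Δ' : S'.V → ℤ) (c : S.V) : ℤ :=
  if h : ∃ v ∈ K, x + S.proj v = c then Δ' (x' + S'.proj h.choose) else Δ c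

/-- Replace the balls of `B` inside the copy of `K` by those of `B'`. -/
def mixBalls (K : Set (ℤ × ℤ)) (B : Finset (S.V × Fin M)) (B' : Finset (S'.V × Fin M)) :
    Finset (S.V × Fin M) :=
  Finset.univ.filter fun q =>
    if h : ∃ y, BallIn K y q.2 ∧ x + S.proj y = q.1 then (x' + S'.proj h.choose, q.2) ∈ B'
    else q ∈ B

/-- The sites connected to the centres through occupied sites and active balls. -/
def pairCluster (Δ : S.V → ℤ) (B : Finset (S.V × Fin M)) (Δ' : S'.V → ℤ)
    (B' : Finset (S'.V × Fin M)) : Set (ℤ × ℤ) :=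
  cluster (fun v => Δ (x + S.proj v) ≠ 0 ∨ Δ' (x' + S'.proj v) ≠ 0)
    fun y ρ => (x + S.proj y, ρ) ∈ B ∨ (x' + S'.proj y, ρ) ∈ B'

/-- No occupied site is near `K` and no active ball meets `K`, other than those inside `K`. -/
structure IsolatedIn (K : Set (ℤ × ℤ)) (Δ : S.V → ℤ) (B : Finset (S.V × Fin M)) (Δ' : S'.V → ℤ)
    (B' : Finset (S'.V × Fin M)) : Prop where
  zero_mem : (0 : ℤ × ℤ) ∈ K
  site : ∀ v ∈ K, ∀ w, triDist v w ≤ 2 → Δ (x + S.proj w) ≠ 0 ∨ Δ' (x' + S'.proj w) ≠ 0 → w ∈ K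
  ball : ∀ v ∈ K, ∀ y (ρ : Fin M), triDist v y ≤ (ρ : ℕ) →
    (x + S.proj y, ρ) ∈ B ∨ (x' + S'.proj y, ρ) ∈ B' → BallIn K y ρ

variable {S S' x x'} {K : Set (ℤ × ℤ)} {Δ : S.V → ℤ} {Δ' : S'.V → ℤ}
  {B : Finset (S.V × Fin M)} {B' : Finset (S'.V × Fin M)} {R : ℕ}

theorem IsolatedIn.symm (h : IsolatedIn S S' x x' K Δ B Δ' B') :
    IsolatedIn S' S x' x K Δ' B' Δ B :=
  ⟨h.zero_mem, fun v hv w hw ho => h.site v hv w hw ho.symm,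
    fun v hv y ρ hy ho => h.ball v hv y ρ hy ho.symm⟩

theorem isolatedIn_pairCluster :
    IsolatedIn S S' x x' (pairCluster S S' x x' Δ B Δ' B') Δ B Δ' B' :=
  ⟨Relation.ReflTransGen.refl, fun _ hv _ hw ho => hv.tail (Or.inl ⟨hw, ho⟩),
    fun _ hv y ρ hy ho _ hz => hv.tail (Or.inr ⟨y, ρ, ho, hy, hz⟩)⟩

theorem pairCluster_symm :
    pairCluster S' S x' x Δ' B' Δ B = pairCluster S S' x x' Δ B Δ' B' := by
  simp only [pairCluster, or_comm]

theorem triDist_le_add {v w : ℤ × ℤ} {a b : ℤ} (hv : triDist v 0 ≤ a) (hw : triDist w 0 ≤ b) :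
    triDist v w ≤ a + b := by
  have := triDist_triangle v 0 w
  rw [triDist_comm 0 w] at this
  lia

theorem mixFun_mem (hA : Agree S S' x x' R) (hK : ∀ v ∈ K, triDist v 0 ≤ R) {v : ℤ × ℤ}
    (hv : v ∈ K) : mixFun S S' x x' K Δ Δ' (x + S.proj v) = Δ' (x' + S'.proj v) := by
  have h : ∃ w ∈ K, x + S.proj w = x + S.proj v := ⟨v, hv, rfl⟩
  rw [mixFun, dif_pos h]
  have := hA.proj_inj h.choose_spec.2 ((triDist_le_add (hK _ h.choose_spec.1) (hK v hv)).trans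
    (by lia))
  rw [this]

theorem mixFun_of_forall_ne {c : S.V} (h : ∀ v ∈ K, x + S.proj v ≠ c) :
    mixFun S S' x x' K Δ Δ' c = Δ c := by
  rw [mixFun, dif_neg]
  rintro ⟨v, hv, e⟩
  exact h v hv e

theorem mixFun_not_mem (hA : Agree S S' x x' R) (hK : ∀ v ∈ K, triDist v 0 ≤ R) {v : ℤ × ℤ}
    (hv : v ∉ K) (hvR : triDist v 0 ≤ R + 2) :
    mixFun S S' x x' K Δ Δ' (x + S.proj v) = Δ (x + S.proj v) := by
  refine mixFun_of_forall_ne fun w hw e => hv ?_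
  rwa [← hA.proj_inj e ((triDist_le_add (hK w hw) hvR).trans (by lia))]

theorem near_le (hK : ∀ v ∈ K, triDist v 0 ≤ R) {v w : ℤ × ℤ} (hv : v ∈ K)
    (hw : triDist v w ≤ 2) : triDist w 0 ≤ R + 2 := by
  have := triDist_triangle w v 0
  rw [triDist_comm w v] at this
  have := hK v hv
  lia

/-- Close to `K` but outside it, isolation makes both height differences vanish, so the exchange
leaves no seam. -/
theorem mixFun_near (hA : Agree S S' x x' R) (hK : ∀ v ∈ K, triDist v 0 ≤ R)
    (hI : IsolatedIn S S' x x' K Δ B Δ' B') {v w : ℤ × ℤ} (hv : v ∈ K) (hw : triDist v w ≤ 2) :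
    mixFun S S' x x' K Δ Δ' (x + S.proj w) = Δ' (x' + S'.proj w) := by
  by_cases hwK : w ∈ K
  · exact mixFun_mem hA hK hwK
  · have h := mt (hI.site v hv w hw) hwK
    push Not at h
    rw [mixFun_not_mem hA hK hwK (near_le hK hv hw), h.1, h.2]

theorem triDist_sub_unitVec (v : ℤ × ℤ) (i : Fin 3) : triDist v (v - unitVec i) ≤ 1 := by
  rw [triDist_le_iff]
  fin_cases i <;> simp [unitVec]

theorem add_proj_sub_u (v : ℤ × ℤ) (i : Fin 3) :
    x + S.proj v - S.u i = x + S.proj (v - unitVec i) := by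
  rw [map_sub, add_sub_assoc]
  rfl

/-- The lozenge `p` touches the copy of `K`. -/
def EdgeAt (K : Set (ℤ × ℤ)) (p : Fin 3 × (ℤ × ℤ)) : Prop := p.2 ∈ K ∨ p.2 - unitVec p.1 ∈ K

theorem mixFun_edge (hA : Agree S S' x x' R) (hK : ∀ v ∈ K, triDist v 0 ≤ R)
    (hI : IsolatedIn S S' x x' K Δ B Δ' B') {p : Fin 3 × (ℤ × ℤ)} (hp : EdgeAt K p) :
    triDist p.2 0 ≤ R + 1 ∧
    mixFun S S' x x' K Δ Δ' (x + S.proj p.2) = Δ' (x' + S'.proj p.2) ∧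
    mixFun S S' x x' K Δ Δ' (x + S.proj p.2 - S.u p.1) = Δ' (x' + S'.proj p.2 - S'.u p.1) := by
  rw [add_proj_sub_u, add_proj_sub_u]
  have h1 := triDist_sub_unitVec p.2 p.1
  rcases hp with hp | hp
  · exact ⟨(hK _ hp).trans (by lia), mixFun_near hA hK hI hp (by rw [triDist_self]; norm_num),
      mixFun_near hA hK hI hp (by lia)⟩
  · have h2 := triDist_triangle p.2 (p.2 - unitVec p.1) 0
    have h3 := hK _ hp
    rw [triDist_comm] at h1
    refine ⟨?_, mixFun_near hA hK hI hp (by lia),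
      mixFun_near hA hK hI hp (by rw [triDist_self]; norm_num)⟩
    rw [triDist_comm] at h1
    lia

theorem mixFun_off {i : Fin 3} {c : S.V}
    (h : ∀ v, EdgeAt K (i, v) → x + S.proj v ≠ c) :
    mixFun S S' x x' K Δ Δ' c = Δ c ∧
      mixFun S S' x x' K Δ Δ' (c - S.u i) = Δ (c - S.u i) := by
  refine ⟨mixFun_of_forall_ne fun v hv => h v (Or.inl hv), mixFun_of_forall_ne fun v hv e => ?_⟩
  refine h (v + unitVec i) (Or.inr (by simpa using hv)) ?_
  have : S.proj (unitVec i) = S.u i := rfl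
  rw [map_add, ← add_assoc, e, this, sub_add_cancel]

theorem adm_mixFun (hA : Agree S S' x x' R) (hK : ∀ v ∈ K, triDist v 0 ≤ R)
    (hI : IsolatedIn S S' x x' K Δ B Δ' B') (hΔ : S.Adm Δ) (hΔ' : S'.Adm Δ') :
    S.Adm (mixFun S S' x x' K Δ Δ') := by
  intro i c
  by_cases h : ∃ v, EdgeAt K (i, v) ∧ x + S.proj v = c
  · obtain ⟨v, hv, rfl⟩ := h
    obtain ⟨h0, h1, h2⟩ := mixFun_edge hA hK hI hv
    simp only [moved]
    rw [h1, h2, hA.bit_eq i v h0]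
    exact hΔ' i _
  · push Not at h
    obtain ⟨h1, h2⟩ := mixFun_off (Δ := Δ) (Δ' := Δ') (x' := x') h
    simp only [moved]
    rw [h1, h2]
    exact hΔ i c

/-- Take a point of `K` with the largest first coordinate. The triangle just beyond it is outside
`K`, all its vertices are at distance at most two, and isolation makes the difference vanish there.
Steps of length two in a cluster are allowed for this reason. -/
theorem meets_mixFun (hA : Agree S S' x x' R) (hK : ∀ v ∈ K, triDist v 0 ≤ R)
    (hI : IsolatedIn S S' x x' K Δ B Δ' B') : S.Meets (mixFun S S' x x' K Δ Δ') := by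
  have hfin : K.Finite := (triBall R).finite_toSet.subset fun v hv => mem_triBall.2 (hK v hv)
  obtain ⟨v, hv, hmax⟩ := Set.exists_max_image K Prod.fst hfin ⟨0, hI.zero_mem⟩
  have key : ∀ w : ℤ × ℤ, triDist v w ≤ 2 → v.1 < w.1 →
      mixFun S S' x x' K Δ Δ' (x + S.proj w) = 0 := by
    intro w hw hlt
    have hwK : w ∉ K := fun hwK => (hmax w hwK).not_gt hlt
    rw [mixFun_near hA hK hI hv hw]
    by_contra hne
    exact hwK (hI.site v hv w hw (Or.inr hne))
  refine meets_of_triangle (x + S.proj (v + (1, 0))) (key _ ?_ (by simp)) ?_ ?_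
  · rw [triDist_le_iff]; simp
  · rw [add_assoc, ← map_add]
    refine key _ ?_ (by simp [add_assoc])
    rw [triDist_le_iff]; simp [add_assoc]
  · rw [add_assoc, ← map_add]
    refine key _ ?_ (by simp [add_assoc])
    rw [triDist_le_iff]; simp [add_assoc]

theorem isLost_mixFun (hA : Agree S S' x x' R) (hK : ∀ v ∈ K, triDist v 0 ≤ R)
    (hI : IsolatedIn S S' x x' K Δ B Δ' B') {p : Fin 3 × (ℤ × ℤ)} (hp : EdgeAt K p) :
    S.IsLost (mixFun S S' x x' K Δ Δ') (p.1, x + S.proj p.2) ↔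
      S'.IsLost Δ' (p.1, x' + S'.proj p.2) := by
  obtain ⟨h0, h1, h2⟩ := mixFun_edge hA hK hI hp
  simp only [IsLost]
  rw [h1, h2, hA.bit_eq p.1 p.2 h0]

/-- Lozenges that touch `K` trade their status of being lost, because the two tilings have the same
bits there; all the others keep theirs. -/
theorem edgeWeight_mixFun (hA : Agree S S' x x' R) (hK : ∀ v ∈ K, triDist v 0 ≤ R)
    (hI : IsolatedIn S S' x x' K Δ B Δ' B') (α b : ℝ) :
    (∏ p, edgeWeight α b (mixFun S S' x x' K Δ Δ') p) *
      ∏ p, edgeWeight α b (mixFun S' S x' x K Δ' Δ) p =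
    (∏ p, edgeWeight α b Δ p) * ∏ p, edgeWeight α b Δ' p := by
  have hinj : ∀ {S S' : LozengeTorus} {x : S.V} {x' : S'.V}, Agree S S' x x' R →
      Set.InjOn (fun p : Fin 3 × (ℤ × ℤ) => (p.1, x + S.proj p.2))
      ((Finset.univ ×ˢ triBall (R + 1)).filter (EdgeAt K) : Finset _) := by
    intro S S' x x' hA p hp q hq e
    simp only [Finset.coe_filter, Finset.mem_product, mem_triBall, Set.mem_ofPred_eq] at hp hq
    simp only [Prod.mk.injEq] at e
    exact Prod.ext e.1 (hA.proj_inj e.2 ((triDist_le_add hp.1.2 hq.1.2).trans (by push_cast; lia)))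
  have hoff : ∀ {S S' : LozengeTorus} {x : S.V} {x' : S'.V} {Δ : S.V → ℤ} {Δ' : S'.V → ℤ}
      (p : Fin 3 × S.V), (∀ a ∈ (Finset.univ ×ˢ triBall (R + 1)).filter (EdgeAt K),
        (a.1, x + S.proj a.2) ≠ p) →
      edgeWeight α b (mixFun S S' x x' K Δ Δ') p = edgeWeight α b Δ p := by
    intro S S' x x' Δ Δ' p hp
    obtain ⟨h1, h2⟩ := mixFun_off (Δ := Δ) (Δ' := Δ') (x := x) (x' := x') (K := K) (i := p.1)
      (c := p.2) (by
        intro v hv e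
        refine hp (p.1, v) (Finset.mem_filter.2 ⟨?_, hv⟩) (by rw [e])
        rw [Finset.mem_product, mem_triBall]
        refine ⟨Finset.mem_univ _, ?_⟩
        push_cast
        rcases hv with hv | hv
        · exact (hK _ hv).trans (by lia)
        · have := hK _ hv
          have h1 := triDist_triangle v (v - unitVec p.1) 0
          have := triDist_sub_unitVec v p.1
          lia)
    have : S.IsLost (mixFun S S' x x' K Δ Δ') p ↔ S.IsLost Δ p := by simp only [IsLost, h1, h2]
    simp only [edgeWeight, this]
  refine prod_mul_prod_swap (l := (Finset.univ ×ˢ triBall (R + 1)).filter (EdgeAt K))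
    (j := fun p => (p.1, x + S.proj p.2)) (j' := fun p => (p.1, x' + S'.proj p.2))
    (hinj hA) (hinj hA.symm) (fun _ _ => Finset.mem_univ _) (fun _ _ => Finset.mem_univ _)
    (fun p hp => ?_) (fun p hp => ?_) (fun p hp => hoff p hp) (fun p hp => hoff p hp)
  · simp only [edgeWeight]
    rw [isLost_mixFun hA hK hI (Finset.mem_filter.1 hp).2]
  · simp only [edgeWeight]
    rw [isLost_mixFun hA.symm hK hI.symm (Finset.mem_filter.1 hp).2]

theorem BallIn.radius_le (hK : ∀ v ∈ K, triDist v 0 ≤ R) {y : ℤ × ℤ} {ρ : ℕ}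
    (h : BallIn K y ρ) : triDist y 0 + ρ ≤ R := by
  obtain ⟨z, hz, hz'⟩ := exists_mem_ball_far y ρ
  exact hz'.trans (hK z (h z hz))

theorem mem_mixBalls (hA : Agree S S' x x' R) (hK : ∀ v ∈ K, triDist v 0 ≤ R) {y : ℤ × ℤ}
    {ρ : Fin M} (hy : BallIn K y ρ) :
    (x + S.proj y, ρ) ∈ mixBalls S S' x x' K B B' ↔ (x' + S'.proj y, ρ) ∈ B' := by
  have h : ∃ w, BallIn K w ρ ∧ x + S.proj w = x + S.proj y := ⟨y, hy, rfl⟩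
  simp only [mixBalls, Finset.mem_filter, Finset.mem_univ, true_and]
  rw [dif_pos h]
  have := hA.proj_inj h.choose_spec.2
    ((triDist_le_add (hK _ h.choose_spec.1.center_mem) (hK y hy.center_mem)).trans (by lia))
  rw [this]

theorem mem_mixBalls_off {q : S.V × Fin M} (h : ∀ y, BallIn K y q.2 → x + S.proj y ≠ q.1) :
    q ∈ mixBalls S S' x x' K B B' ↔ q ∈ B := by
  simp only [mixBalls, Finset.mem_filter, Finset.mem_univ, true_and]
  rw [dif_neg]
  rintro ⟨y, hy, e⟩
  exact h y hy e

theorem pattern_eq_of_agree (hA : Agree S S' x x' R) (hK : ∀ v ∈ K, triDist v 0 ≤ R)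
    (h : ∀ v ∈ K, Δ (x + S.proj v) = Δ' (x' + S'.proj v)) {y : ℤ × ℤ} {ρ : ℕ}
    (hy : BallIn K y ρ) :
    S.pattern Δ (x + S.proj y) ρ = S'.pattern Δ' (x' + S'.proj y) ρ := by
  ext l
  refine and_congr_left fun hl => ?_
  have hmem : ∀ v ∈ triBall ρ, y + v ∈ K := by
    intro v hv
    refine hy _ ?_
    rw [triDist_sub, add_sub_cancel_left]
    exact mem_triBall.1 hv
  have h1 := hmem _ hl.mem.1
  have h2 := hmem _ hl.mem.2
  rw [← add_sub_assoc] at h2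
  rw [add_assoc, ← map_add, add_assoc, ← map_add]
  simp only [moved]
  rw [add_proj_sub_u, add_proj_sub_u, h _ h1, h _ h2, hA.bit_eq _ _ ((hK _ h1).trans (by lia))]

theorem tilt_mixFun (hA : Agree S S' x x' R) (hK : ∀ v ∈ K, triDist v 0 ≤ R) (m : Potential)
    {y : ℤ × ℤ} {ρ : Fin M} (hy : BallIn K y ρ) :
    S.tilt m M (mixFun S S' x x' K Δ Δ') (x + S.proj y, ρ) =
      S'.tilt m M Δ' (x' + S'.proj y, ρ) := by
  have hρ : (ρ : ℕ) ≤ R := by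
    have := BallIn.radius_le hK hy
    have := triDist_nonneg y 0
    lia
  simp only [tilt]
  rw [pattern_eq_of_agree hA hK (fun v hv => mixFun_mem hA hK hv) hy,
    pattern_eq_of_agree (Δ := 0) (Δ' := 0) hA hK (fun v hv => rfl) hy]
  simp only [mem_scales_iff_of_le hA.size_left hρ, mem_scales_iff_of_le hA.size_right hρ]

/-- Balls inside `K` trade their factors. An active ball not inside `K` does not meet `K`, by
isolation, so its pattern and its tilt are unchanged. -/
theorem ballWeight_mix (hA : Agree S S' x x' R) (hK : ∀ v ∈ K, triDist v 0 ≤ R)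
    (hI : IsolatedIn S S' x x' K Δ B Δ' B') (m : Potential) :
    (∏ q, if q ∈ mixBalls S S' x x' K B B' then
        Real.exp (S.tilt m M (mixFun S S' x x' K Δ Δ') q) - 1 else 1) *
      (∏ q, if q ∈ mixBalls S' S x' x K B' B then
        Real.exp (S'.tilt m M (mixFun S' S x' x K Δ' Δ) q) - 1 else 1) =
    (∏ q, if q ∈ B then Real.exp (S.tilt m M Δ q) - 1 else 1) *
      ∏ q, if q ∈ B' then Real.exp (S'.tilt m M Δ' q) - 1 else 1 := by
  have hinj : ∀ {S S' : LozengeTorus} {x : S.V} {x' : S'.V}, Agree S S' x x' R →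
      Set.InjOn (fun p : (ℤ × ℤ) × Fin M => (x + S.proj p.1, p.2))
      ((triBall R ×ˢ Finset.univ).filter (fun p => BallIn K p.1 p.2) : Finset ((ℤ × ℤ) × Fin M)) := by
    intro S S' x x' hA p hp q hq e
    simp only [Finset.coe_filter, Finset.mem_product, mem_triBall, Set.mem_ofPred_eq] at hp hq
    simp only [Prod.mk.injEq] at e
    exact Prod.ext (hA.proj_inj e.1 ((triDist_le_add hp.1.1 hq.1.1).trans (by lia))) e.2
  have hoff : ∀ {S S' : LozengeTorus} {x : S.V} {x' : S'.V} {Δ : S.V → ℤ} {Δ' : S'.V → ℤ}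
      {B : Finset (S.V × Fin M)} {B' : Finset (S'.V × Fin M)},
      IsolatedIn S S' x x' K Δ B Δ' B' →
      ∀ q : S.V × Fin M, (∀ a ∈ (triBall R ×ˢ (Finset.univ : Finset (Fin M))).filter
        (fun p => BallIn K p.1 p.2), (x + S.proj a.1, a.2) ≠ q) →
      (if q ∈ mixBalls S S' x x' K B B' then
        Real.exp (S.tilt m M (mixFun S S' x x' K Δ Δ') q) - 1 else 1) =
      if q ∈ B then Real.exp (S.tilt m M Δ q) - 1 else 1 := by
    intro S S' x x' Δ Δ' B B' hI q hq
    have hq' : ∀ y, BallIn K y q.2 → x + S.proj y ≠ q.1 := by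
      intro y hy e
      refine hq (y, q.2) (Finset.mem_filter.2 ⟨?_, hy⟩) (by rw [e])
      rw [Finset.mem_product, mem_triBall]
      exact ⟨hK _ hy.center_mem, Finset.mem_univ _⟩
    simp only [mem_mixBalls_off hq']
    split_ifs with hqB
    · rw [tilt_congr fun v hv => ?_]
      refine mixFun_of_forall_ne fun w hw e => ?_
      have e' : x + S.proj (w - v) = q.1 := by
        rw [map_sub, ← add_sub_assoc, e, add_sub_cancel_right]
      refine hq' (w - v) (hI.ball w hw _ _ ?_ (Or.inl ?_)) e'
      · rw [triDist_sub, sub_sub_cancel]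
        exact mem_triBall.1 hv
      · rwa [e']
    · rfl
  refine prod_mul_prod_swap
    (l := (triBall R ×ˢ (Finset.univ : Finset (Fin M))).filter (fun p => BallIn K p.1 p.2))
    (j := fun p => (x + S.proj p.1, p.2)) (j' := fun p => (x' + S'.proj p.1, p.2))
    (hinj hA) (hinj hA.symm) (fun _ _ => Finset.mem_univ _) (fun _ _ => Finset.mem_univ _)
    (fun p hp => ?_) (fun p hp => ?_) (hoff hI) (hoff hI.symm)
  · have hp' := (Finset.mem_filter.1 hp).2
    simp only [mem_mixBalls hA hK hp', tilt_mixFun hA hK m hp']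
  · have hp' := (Finset.mem_filter.1 hp).2
    simp only [mem_mixBalls hA.symm hK hp', tilt_mixFun hA.symm hK m hp']

theorem mixFun_mixFun (hA : Agree S S' x x' R) (hK : ∀ v ∈ K, triDist v 0 ≤ R) :
    mixFun S S' x x' K (mixFun S S' x x' K Δ Δ') (mixFun S' S x' x K Δ' Δ) = Δ := by
  funext c
  by_cases h : ∃ v ∈ K, x + S.proj v = c
  · obtain ⟨v, hv, rfl⟩ := h
    rw [mixFun_mem hA hK hv, mixFun_mem hA.symm hK hv]
  · push Not at h
    rw [mixFun_of_forall_ne h, mixFun_of_forall_ne h]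

theorem mixBalls_mixBalls (hA : Agree S S' x x' R) (hK : ∀ v ∈ K, triDist v 0 ≤ R) :
    mixBalls S S' x x' K (mixBalls S S' x x' K B B') (mixBalls S' S x' x K B' B) = B := by
  ext q
  by_cases h : ∃ y, BallIn K y q.2 ∧ x + S.proj y = q.1
  · obtain ⟨c, ρ⟩ := q
    obtain ⟨y, hy, rfl⟩ := h
    rw [mem_mixBalls hA hK hy, mem_mixBalls hA.symm hK hy]
  · push Not at h
    rw [mem_mixBalls_off h, mem_mixBalls_off h]

theorem mem_mixBalls_near (hA : Agree S S' x x' R) (hK : ∀ v ∈ K, triDist v 0 ≤ R) {v y : ℤ × ℤ}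
    {ρ : Fin M} (hv : v ∈ K) (hvy : triDist v y ≤ (ρ : ℕ)) (hy : ¬ BallIn K y ρ)
    (h : (x + S.proj y, ρ) ∈ mixBalls S S' x x' K B B') : (x + S.proj y, ρ) ∈ B := by
  refine (mem_mixBalls_off fun w hw e => hy ?_).1 h
  have h1 := BallIn.radius_le hK hw
  have h2 := triDist_triangle y v 0
  have h3 := hK v hv
  rw [triDist_comm v y] at hvy
  rwa [← hA.proj_inj e ((triDist_le_add (le_sub_iff_add_le.2 h1) (h2.trans
    (add_le_add hvy h3))).trans (by lia))]

/-- Inside the cluster the union of the two states is the same after the exchange, and the isolation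
around it persists, so exploring from the origin finds the same set. This makes the exchange an
involution. -/
theorem pairCluster_mix (hA : Agree S S' x x' R)
    (hK : ∀ v ∈ pairCluster S S' x x' Δ B Δ' B', triDist v 0 ≤ R) :
    pairCluster S S' x x'
      (mixFun S S' x x' (pairCluster S S' x x' Δ B Δ' B') Δ Δ')
      (mixBalls S S' x x' (pairCluster S S' x x' Δ B Δ' B') B B')
      (mixFun S' S x' x (pairCluster S S' x x' Δ B Δ' B') Δ' Δ)
      (mixBalls S' S x' x (pairCluster S S' x x' Δ B Δ' B') B' B) =
      pairCluster S S' x x' Δ B Δ' B' := by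
  have hI : IsolatedIn S S' x x' (pairCluster S S' x x' Δ B Δ' B') Δ B Δ' B' :=
    isolatedIn_pairCluster
  set K := pairCluster S S' x x' Δ B Δ' B' with hKdef
  refine Set.Subset.antisymm (fun v hv => ?_) fun v hv => ?_
  · induction hv with
    | refl => exact hI.zero_mem
    | @tail v w _ hs hv =>
      rcases hs with ⟨hd, ho⟩ | ⟨y, ρ, ha, hvy, hwy⟩
      · rw [mixFun_near hA hK hI hv hd, mixFun_near hA.symm hK hI.symm hv hd] at ho
        exact hI.site v hv w hd ho.symm
      · by_cases hy : BallIn K y ρ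
        · exact hy w hwy
        · exact hI.ball v hv y ρ hvy (ha.imp (mem_mixBalls_near hA hK hv hvy hy)
            (mem_mixBalls_near hA.symm hK hv hvy hy)) w hwy
  · have hv' := hv
    rw [hKdef] at hv
    induction hv with
    | refl => exact Relation.ReflTransGen.refl
    | @tail v w hv hs ih =>
      refine (ih hv).tail ?_
      rcases hs with ⟨hd, ho⟩ | ⟨y, ρ, ha, hvy, hwy⟩
      · refine Or.inl ⟨hd, ?_⟩
        beta_reduce
        rw [mixFun_near hA hK hI hv hd, mixFun_near hA.symm hK hI.symm hv hd]
        exact ho.symm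
      · have hy := hI.ball v hv y ρ hvy ha
        refine Or.inr ⟨y, ρ, ?_, hvy, hwy⟩
        beta_reduce
        rw [mem_mixBalls hA hK hy, mem_mixBalls hA.symm hK hy]
        exact ha.symm

end Mix

end LozengeTorus

/-! ### Probability that the cluster escapes -/

/-- The price of a move. -/
def Move.cost (m : Potential) {M : ℕ} : Move M → ℝ
  | (_, Sum.inl _) => LozengeTorus.siteCost m
  | (_, Sum.inr q) => LozengeTorus.ballCost m q.1

/-- A bound on the length of a move. -/
def Move.length {M : ℕ} : Move M → ℝ
  | (_, Sum.inl _) => 2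
  | (_, Sum.inr q) => 2 * (q.1 : ℕ)

theorem Move.disp_le_length {M : ℕ} {x : Move M} (hx : x ∈ moves M) :
    (triDist x.disp 0 : ℝ) ≤ x.length := by
  rcases x with ⟨s, d | ⟨ρ, a, d⟩⟩
  · simp only [moves, Finset.mem_product, Finset.inl_mem_disjSum, mem_triBall] at hx
    simp only [Move.disp, Move.length]
    exact_mod_cast hx.2
  · simp only [moves, Finset.mem_product, Finset.inr_mem_disjSum, Finset.mem_sigma,
      mem_triBall] at hx
    simp only [Move.disp, Move.length]
    have h1 := triDist_triangle (a + d) a 0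
    rw [triDist_sub (a + d) a, add_sub_cancel_left] at h1
    have : triDist (a + d) 0 ≤ 2 * (ρ : ℕ) := by lia
    exact_mod_cast this

/-- The potential is small enough for the chain bound with rate `t`. -/
structure Potential.Small (m : Potential) (t : ℝ) : Prop where
  alpha_nonneg : 0 ≤ m.α
  rate_nonneg : 0 ≤ t
  siteCost_le : LozengeTorus.siteCost m ≤ 1
  strength_le : ∀ M, LozengeTorus.strength m M ≤ 1
  sum_moves_le : ∀ M, ∑ x ∈ moves M, Move.cost m x * Real.exp (t * x.length) ≤ 1 / 2

namespace LozengeTorus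

/-- Pairs of a height difference and a set of activated balls. -/
abbrev State (S : LozengeTorus) (M : ℕ) : Type := S.Conf × Finset (S.V × Fin M)

/-- Sites and balls. -/
abbrev Item (S : LozengeTorus) (M : ℕ) : Type := S.V ⊕ S.V × Fin M

/-- The site is in the support, or the ball is activated. -/
def Present {S : LozengeTorus} {M : ℕ} (ω : S.State M) : S.Item M → Prop
  | Sum.inl c => ω.1.1 c ≠ 0
  | Sum.inr q => q ∈ ω.2

/-- The price of a site or a ball. -/
def Item.cost (m : Potential) {S : LozengeTorus} {M : ℕ} : S.Item M → ℝ
  | Sum.inl _ => siteCost m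
  | Sum.inr q => ballCost m q.2

theorem Item.cost_nonneg (m : Potential) {S : LozengeTorus} {M : ℕ} (o : S.Item M) :
    0 ≤ Item.cost m o := by
  rcases o with c | q
  · exact (siteCost_pos m).le
  · exact ballCost_nonneg m q.2

variable {S S' : LozengeTorus} {m : Potential} {t b : ℝ} {M : ℕ}

/-- The sites of `Q` serve only to secure the factor `f`; their own price, at most one, is given
away. -/
theorem sum_present_le (hm : m.Small t) (Q : Finset S.V) (f : ℝ) (hf0 : 0 ≤ f)
    (hf : ∀ Δ : S.Conf, Q ⊆ S.supp Δ.1 →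
      Real.exp (-b * ((S.lost Δ.1).filter fun p => p.1 = 2).card) ≤ f) (U : Finset (S.Item M)) :
    ∑ ω : S.State M, (if Q ⊆ S.supp ω.1.1 ∧ ∀ o ∈ U, Present ω o then weight m b M ω else 0) ≤
      f * (∏ o ∈ U, Item.cost m o) * S.partition m b M := by
  have h := peierls m b M hm.alpha_nonneg (hm.strength_le M) hm.siteCost_le (Q ∪ U.toLeft)
    U.toRight f hf0 (fun Δ hΔ => hf Δ (Finset.union_subset_left hΔ))
  refine (Finset.sum_le_sum fun ω _ => ?_).trans (h.trans ?_)
  · have hw := weight_nonneg m b M ω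
    by_cases hc : Q ⊆ S.supp ω.1.1 ∧ ∀ o ∈ U, Present ω o
    · rw [if_pos hc, if_pos]
      refine ⟨Finset.union_subset hc.1 fun c hct => mem_supp.2 ?_, fun q hq => ?_⟩
      · exact hc.2 (Sum.inl c) (Finset.mem_toLeft.1 hct)
      · exact hc.2 (Sum.inr q) (Finset.mem_toRight.1 hq)
    · rw [if_neg hc]
      split_ifs <;> first | exact hw | exact le_rfl
  · have hc : ∏ o ∈ U, Item.cost m o =
        siteCost m ^ U.toLeft.card * ∏ q ∈ U.toRight, ballCost m q.2 := by
      conv_lhs => rw [← Finset.toLeft_disjSum_toRight (u := U)]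
      rw [Finset.prod_disjSum]
      simp [Item.cost]
    rw [hc]
    have h0 := siteCost_pos m
    have h1 : siteCost m ^ (Q ∪ U.toLeft).card ≤ siteCost m ^ U.toLeft.card :=
      pow_le_pow_of_le_one h0.le hm.siteCost_le (Finset.card_le_card Finset.subset_union_right)
    exact mul_le_mul_of_nonneg_right (mul_le_mul_of_nonneg_left (mul_le_mul_of_nonneg_right h1
      (Finset.prod_nonneg fun q _ => ballCost_nonneg m q.2)) hf0) (partition_pos m b M).le

/-- The weight of a pair of states. -/
def pairWeight (m : Potential) (b : ℝ) (M : ℕ) (z : S.State M × S'.State M) : ℝ :=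
  weight m b M z.1 * weight m b M z.2

theorem pairWeight_nonneg (m : Potential) (b : ℝ) (M : ℕ) (z : S.State M × S'.State M) :
    0 ≤ pairWeight m b M z :=
  mul_nonneg (weight_nonneg m b M z.1) (weight_nonneg m b M z.2)

/-- The item of one of the two tori is present in the corresponding state. -/
def PairPresent (z : S.State M × S'.State M) : S.Item M ⊕ S'.Item M → Prop
  | Sum.inl o => Present z.1 o
  | Sum.inr o => Present z.2 o

/-- The price of an item of one of the two tori. -/
def pairCost (m : Potential) : S.Item M ⊕ S'.Item M → ℝ
  | Sum.inl o => Item.cost m o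
  | Sum.inr o => Item.cost m o

theorem pairCost_nonneg (m : Potential) (o : S.Item M ⊕ S'.Item M) : 0 ≤ pairCost m o := by
  rcases o with o | o <;> exact Item.cost_nonneg m o

theorem sum_pairPresent_le (hm : m.Small t) (Q : Finset S.V) (Q' : Finset S'.V) (f f' : ℝ)
    (hf0 : 0 ≤ f) (hf0' : 0 ≤ f')
    (hf : ∀ Δ : S.Conf, Q ⊆ S.supp Δ.1 →
      Real.exp (-b * ((S.lost Δ.1).filter fun p => p.1 = 2).card) ≤ f)
    (hf' : ∀ Δ : S'.Conf, Q' ⊆ S'.supp Δ.1 →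
      Real.exp (-b * ((S'.lost Δ.1).filter fun p => p.1 = 2).card) ≤ f')
    (U : Finset (S.Item M ⊕ S'.Item M)) :
    ∑ z : S.State M × S'.State M, (if (Q ⊆ S.supp z.1.1.1 ∧ Q' ⊆ S'.supp z.2.1.1) ∧
        ∀ o ∈ U, PairPresent z o then pairWeight m b M z else 0) ≤
      f * f' * (S.partition m b M * S'.partition m b M) * ∏ o ∈ U, pairCost m o := by
  have h1 := sum_present_le (M := M) hm Q f hf0 hf U.toLeft
  have h2 := sum_present_le (M := M) hm Q' f' hf0' hf' U.toRight
  have hc : ∏ o ∈ U, pairCost m o =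
      (∏ o ∈ U.toLeft, Item.cost m o) * ∏ o ∈ U.toRight, Item.cost m o := by
    conv_lhs => rw [← Finset.toLeft_disjSum_toRight (u := U)]
    rw [Finset.prod_disjSum]
    simp [pairCost]
  have e : ∀ z : S.State M × S'.State M, (if (Q ⊆ S.supp z.1.1.1 ∧ Q' ⊆ S'.supp z.2.1.1) ∧
        ∀ o ∈ U, PairPresent z o then pairWeight m b M z else 0) =
      (if Q ⊆ S.supp z.1.1.1 ∧ ∀ o ∈ U.toLeft, Present z.1 o then weight m b M z.1 else 0) *
      (if Q' ⊆ S'.supp z.2.1.1 ∧ ∀ o ∈ U.toRight, Present z.2 o then weight m b M z.2 else 0) := by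
    intro z
    have hU : (∀ o ∈ U, PairPresent z o) ↔
        (∀ o ∈ U.toLeft, Present z.1 o) ∧ ∀ o ∈ U.toRight, Present z.2 o := by
      refine ⟨fun h => ⟨fun o ho => h _ (Finset.mem_toLeft.1 ho),
        fun o ho => h _ (Finset.mem_toRight.1 ho)⟩, ?_⟩
      rintro ⟨h, h'⟩ (o | o) ho
      · exact h o (Finset.mem_toLeft.2 ho)
      · exact h' o (Finset.mem_toRight.2 ho)
    rw [ite_zero_mul_ite_zero]
    refine if_congr ?_ rfl rfl
    rw [hU]
    tauto
  rw [Finset.sum_congr rfl fun z _ => e z, hc]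
  calc _ = (∑ ω : S.State M,
          if Q ⊆ S.supp ω.1.1 ∧ ∀ o ∈ U.toLeft, Present ω o then weight m b M ω else 0) *
        ∑ ω : S'.State M,
          if Q' ⊆ S'.supp ω.1.1 ∧ ∀ o ∈ U.toRight, Present ω o then weight m b M ω else 0 := by
        rw [Finset.sum_mul_sum, ← Fintype.sum_prod_type']
    _ ≤ _ := mul_le_mul h1 h2 (Finset.sum_nonneg fun ω _ => by
        split_ifs <;> first | exact weight_nonneg _ _ _ _ | exact le_rfl)
        (mul_nonneg (mul_nonneg hf0 (Finset.prod_nonneg fun o _ => Item.cost_nonneg m o))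
          (partition_pos m b M).le)
    _ = _ := by ring

/-- The cluster of the centres. -/
abbrev stateCluster (x : S.V) (x' : S'.V) (z : S.State M × S'.State M) : Set (ℤ × ℤ) :=
  pairCluster S S' x x' z.1.1.1 z.1.2 z.2.1.1 z.2.2

/-- The cluster stays in the ball of radius `R`. -/
def Confined (x : S.V) (x' : S'.V) (R : ℕ) (z : S.State M × S'.State M) : Prop :=
  ∀ v ∈ stateCluster x x' z, triDist v 0 ≤ R

/-- The sites of one of the two tori as items. -/
def siteItem (x : S.V) (x' : S'.V) : Bool → ℤ × ℤ → S.Item M ⊕ S'.Item M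
  | true, v => Sum.inl (Sum.inl (x + S.proj v))
  | false, v => Sum.inr (Sum.inl (x' + S'.proj v))

/-- The balls of one of the two tori as items. -/
def ballItem (x : S.V) (x' : S'.V) : Bool → ℤ × ℤ → Fin M → S.Item M ⊕ S'.Item M
  | true, v, ρ => Sum.inl (Sum.inr (x + S.proj v, ρ))
  | false, v, ρ => Sum.inr (Sum.inr (x' + S'.proj v, ρ))

theorem exists_chain_of_not_confined {x : S.V} {x' : S'.V} {R : ℕ} (hA : Agree S S' x x' R)
    {z : S.State M × S'.State M} (hz : ¬ Confined x x' R z) :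
    ∃ n, Chain (PairPresent z) (Move.obj (siteItem x x') (ballItem x x')) Move.disp (moves M)
      R n 0 ∅ := by
  simp only [Confined, not_forall] at hz
  obtain ⟨v, hv, hvR⟩ := hz
  refine exists_chain (occ := fun s v => PairPresent z (siteItem x x' s v))
    (act := fun s y ρ => PairPresent z (ballItem x x' s y ρ)) (fun _ _ h => h) (fun _ _ _ h => h)
    ?_ ?_ ?_ (z := v) ?_ (not_le.1 hvR)
  · rintro (_ | _) v (_ | _) v' ρ <;> simp [siteItem, ballItem]
  · rintro (_ | _) v (_ | _) v' <;> simp only [siteItem, Sum.inl.injEq, Sum.inr.injEq, reduceCtorEq,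
      false_imp_iff]
    · exact fun h hd => hA.symm.proj_inj h hd
    · exact fun h hd => hA.proj_inj h hd
  · rintro (_ | _) v ρ (_ | _) v' ρ' <;> simp only [ballItem, Sum.inl.injEq, Sum.inr.injEq,
      Prod.mk.injEq, reduceCtorEq, false_imp_iff]
    · exact fun h => ⟨trivial, h.2, fun hd => hA.symm.proj_inj h.1 (hd.trans (by lia))⟩
    · exact fun h => ⟨trivial, h.2, fun hd => hA.proj_inj h.1 (hd.trans (by lia))⟩
  · convert hv using 1
    simp only [Bool.exists_bool, siteItem, ballItem, PairPresent, Present, pairCluster, or_comm]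

theorem sum_not_confined_le (hm : m.Small t) {x : S.V} {x' : S'.V} {R : ℕ}
    (hA : Agree S S' x x' R) (Q : Finset S.V) (Q' : Finset S'.V) (f f' : ℝ)
    (hf0 : 0 ≤ f) (hf0' : 0 ≤ f')
    (hf : ∀ Δ : S.Conf, Q ⊆ S.supp Δ.1 →
      Real.exp (-b * ((S.lost Δ.1).filter fun p => p.1 = 2).card) ≤ f)
    (hf' : ∀ Δ : S'.Conf, Q' ⊆ S'.supp Δ.1 →
      Real.exp (-b * ((S'.lost Δ.1).filter fun p => p.1 = 2).card) ≤ f') :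
    ∑ z : S.State M × S'.State M, (if (Q ⊆ S.supp z.1.1.1 ∧ Q' ⊆ S'.supp z.2.1.1) ∧
        ¬ Confined x x' R z then pairWeight m b M z else 0) ≤
      2 * (f * f') * Real.exp (-t * R) * (S.partition m b M * S'.partition m b M) := by
  have hZ := mul_pos (partition_pos (S := S) m b M) (partition_pos (S := S') m b M)
  have hmw : ∀ v (y : Move M), pairCost m (Move.obj (siteItem x x')
      (ballItem x x') v y) ≤ Move.cost m y := by
    rintro v ⟨_ | _, d | ⟨ρ, a, d⟩⟩
    · exact le_of_eq rfl
    · exact le_of_eq rfl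
    · exact le_of_eq rfl
    · exact le_of_eq rfl
  have h := sum_exists_chain_le (R := R) (W := pairWeight (S := S) (S' := S') m b M)
    (E := fun z => Q ⊆ S.supp z.1.1.1 ∧ Q' ⊆ S'.supp z.2.1.1) (present := PairPresent)
    (obj := Move.obj (siteItem x x') (ballItem x x'))
    (disp := Move.disp) (mv := moves M) (wt := pairCost m) (pairWeight_nonneg m b M)
    (pairCost_nonneg m)
    (mul_nonneg (mul_nonneg hf0 hf0') hZ.le)
    (fun U => by convert sum_pairPresent_le (M := M) hm Q Q' f f' hf0 hf0' hf hf' U)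
    hm.rate_nonneg (mw := Move.cost m) (len := Move.length) hmw
    (fun x hx => Move.disp_le_length hx) (hm.sum_moves_le M)
  refine (Finset.sum_le_sum fun z _ => ?_).trans (h.trans (le_of_eq (by ring)))
  have hw := pairWeight_nonneg m b M z
  by_cases hc : (Q ⊆ S.supp z.1.1.1 ∧ Q' ⊆ S'.supp z.2.1.1) ∧ ¬ Confined x x' R z
  · rw [if_pos hc, if_pos ⟨hc.1, exists_chain_of_not_confined hA hc.2⟩]
  · rw [if_neg hc]
    split_ifs <;> first | exact hw | exact le_rfl

/-- Exchange the states of two tori inside the cluster. -/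
def swapStates {x : S.V} {x' : S'.V} {R : ℕ} (hA : Agree S S' x x' R)
    (z : S.State M × S'.State M) (hz : Confined x x' R z) : S.State M × S'.State M :=
  ((⟨mixFun S S' x x' (stateCluster x x' z) z.1.1.1 z.2.1.1,
      adm_mixFun hA hz isolatedIn_pairCluster z.1.1.2.1 z.2.1.2.1,
      meets_mixFun hA hz isolatedIn_pairCluster⟩,
    mixBalls S S' x x' (stateCluster x x' z) z.1.2 z.2.2),
   (⟨mixFun S' S x' x (stateCluster x x' z) z.2.1.1 z.1.1.1,
      adm_mixFun hA.symm hz isolatedIn_pairCluster.symm z.2.1.2.1 z.1.1.2.1,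
      meets_mixFun hA.symm hz isolatedIn_pairCluster.symm⟩,
    mixBalls S' S x' x (stateCluster x x' z) z.2.2 z.1.2))

theorem stateCluster_swapStates {x : S.V} {x' : S'.V} {R : ℕ} (hA : Agree S S' x x' R)
    (z : S.State M × S'.State M) (hz : Confined x x' R z) :
    stateCluster x x' (swapStates hA z hz) = stateCluster x x' z :=
  pairCluster_mix hA hz

theorem confined_swapStates {x : S.V} {x' : S'.V} {R : ℕ} (hA : Agree S S' x x' R)
    (z : S.State M × S'.State M) (hz : Confined x x' R z) :
    Confined x x' R (swapStates hA z hz) := by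
  intro v hv
  rw [stateCluster_swapStates] at hv
  exact hz v hv

theorem swapStates_swapStates {x : S.V} {x' : S'.V} {R : ℕ} (hA : Agree S S' x x' R)
    (z : S.State M × S'.State M) (hz : Confined x x' R z) :
    swapStates hA (swapStates hA z hz) (confined_swapStates hA z hz) = z := by
  have hK := stateCluster_swapStates hA z hz
  obtain ⟨⟨⟨Δ, hΔ⟩, B⟩, ⟨⟨Δ', hΔ'⟩, B'⟩⟩ := z
  refine Prod.ext (Prod.ext (Subtype.ext ?_) ?_) (Prod.ext (Subtype.ext ?_) ?_)
  · change mixFun S S' x x' (stateCluster x x' (swapStates hA _ hz)) _ _ = _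
    rw [hK]
    exact mixFun_mixFun hA hz
  · change mixBalls S S' x x' (stateCluster x x' (swapStates hA _ hz)) _ _ = _
    rw [hK]
    exact mixBalls_mixBalls hA hz
  · change mixFun S' S x' x (stateCluster x x' (swapStates hA _ hz)) _ _ = _
    rw [hK]
    exact mixFun_mixFun hA.symm hz
  · change mixBalls S' S x' x (stateCluster x x' (swapStates hA _ hz)) _ _ = _
    rw [hK]
    exact mixBalls_mixBalls hA.symm hz

/-- The edge factors and the ball factors of the two states are each preserved as products. -/
theorem pairWeight_swapStates {x : S.V} {x' : S'.V} {R : ℕ} (hA : Agree S S' x x' R)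
    (z : S.State M × S'.State M) (hz : Confined x x' R z) :
    pairWeight m b M (swapStates hA z hz) = pairWeight m b M z := by
  have h1 := edgeWeight_mixFun hA hz (isolatedIn_pairCluster (B := z.1.2) (B' := z.2.2)) m.α b
  have h2 := ballWeight_mix hA hz isolatedIn_pairCluster m
  simp only [pairWeight, weight, swapStates]
  calc _ = _ := mul_mul_mul_comm _ _ _ _
    _ = _ := congrArg₂ (· * ·) h1 h2
    _ = _ := mul_mul_mul_comm _ _ _ _

theorem isLost_swapStates {x : S.V} {x' : S'.V} {R : ℕ} (hA : Agree S S' x x' R)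
    (z : S.State M × S'.State M) (hz : Confined x x' R z) :
    (S.IsLost (swapStates hA z hz).1.1.1 (2, x) ↔ S'.IsLost z.2.1.1 (2, x')) ∧
    (S'.IsLost (swapStates hA z hz).2.1.1 (2, x') ↔ S.IsLost z.1.1.1 (2, x)) := by
  have hI : IsolatedIn S S' x x' (stateCluster x x' z) z.1.1.1 z.1.2 z.2.1.1 z.2.2 :=
    isolatedIn_pairCluster
  have h1 := isLost_mixFun hA hz hI (p := (2, 0)) (Or.inl hI.zero_mem)
  have h2 := isLost_mixFun hA.symm hz hI.symm (p := (2, 0)) (Or.inl hI.zero_mem)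
  simp only [map_zero, add_zero] at h1 h2
  exact ⟨h1, h2⟩

/-! ### Loss probabilities and their locality -/

/-- The probability that the horizontal lozenge with base `x` is lost. -/
def lossProb (S : LozengeTorus) (m : Potential) (b : ℝ) (M : ℕ) (x : S.V) : ℝ :=
  (∑ Δ : S.Conf, if S.IsLost Δ.1 (2, x) then confWeight m b M Δ.1 else 0) / S.partition m b M

theorem sum_state_isLost (x : S.V) :
    ∑ ω : S.State M, (if S.IsLost ω.1.1 (2, x) then weight m b M ω else 0) =
      S.lossProb m b M x * S.partition m b M := by
  rw [lossProb, div_mul_cancel₀ _ (partition_pos m b M).ne', Fintype.sum_prod_type]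
  refine Finset.sum_congr rfl fun Δ _ => ?_
  split_ifs
  · exact sum_weight m b M Δ
  · simp

theorem exp_horizontal_le (hb : 0 ≤ b) {x : S.V} {Δ : S.V → ℤ} (h : S.IsLost Δ (2, x)) :
    Real.exp (-b * ((S.lost Δ).filter fun p => p.1 = 2).card) ≤ Real.exp (-b) := by
  rw [Real.exp_le_exp]
  have : 1 ≤ ((S.lost Δ).filter fun p => p.1 = 2).card :=
    Finset.card_pos.2 ⟨(2, x), Finset.mem_filter.2 ⟨mem_lost.2 h, rfl⟩⟩
  have h1 : (1 : ℝ) ≤ ((S.lost Δ).filter fun p => p.1 = 2).card := by exact_mod_cast this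
  nlinarith

theorem exp_horizontal_le_one (hb : 0 ≤ b) (Δ : S.V → ℤ) :
    Real.exp (-b * ((S.lost Δ).filter fun p => p.1 = 2).card) ≤ 1 := by
  rw [Real.exp_le_one_iff]
  exact mul_nonpos_of_nonpos_of_nonneg (neg_nonpos.2 hb) (Nat.cast_nonneg _)

theorem lossProb_nonneg (x : S.V) : 0 ≤ S.lossProb m b M x := by
  refine div_nonneg (Finset.sum_nonneg fun Δ _ => ?_) (partition_pos m b M).le
  split_ifs <;> first | exact (confWeight_pos _ _ _ _).le | exact le_rfl

theorem lossProb_eq_zero {x : S.V} (hx : S.bit 2 x ≠ 1) : S.lossProb m b M x = 0 := by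
  have : ∀ Δ : S.Conf, ¬ S.IsLost Δ.1 (2, x) := fun Δ h => hx h.1
  simp [lossProb, this]

/-- A lost lozenge has an end of its short diagonal in the support, hence the factor 2. Being
horizontal, it contributes `exp (-b)` by itself, which makes the bound integrable in `b`. -/
theorem lossProb_le (hm : m.Small t) (hb : 0 ≤ b) (x : S.V) :
    S.lossProb m b M x ≤ 2 * siteCost m * Real.exp (-b) := by
  by_cases hx : S.bit 2 x = 1
  swap
  · rw [lossProb_eq_zero hx]
    have := siteCost_pos m
    positivity
  have hq : ∀ q, (q = x ∨ q = x - S.u 2) →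
      ∑ ω : S.State M, (if ω.1.1 q ≠ 0 then weight m b M ω else 0) ≤
        Real.exp (-b) * siteCost m * S.partition m b M := by
    intro q hq
    have h := sum_present_le (b := b) (M := M) hm {q} (Real.exp (-b)) (Real.exp_pos _).le
      (fun Δ hΔ => exp_horizontal_le hb (x := x) ⟨hx, by
        have := mem_supp.1 (hΔ (Finset.mem_singleton_self q))
        rcases hq with rfl | rfl
        · exact Or.inl this
        · exact Or.inr this⟩) {Sum.inl q}
    rw [Finset.prod_singleton] at h
    refine (Finset.sum_le_sum fun ω _ => ?_).trans h
    refine le_of_eq (if_congr ?_ rfl rfl)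
    simp [Present, mem_supp]
  have hZ := partition_pos (S := S) m b M
  rw [← mul_le_mul_iff_of_pos_right hZ, ← sum_state_isLost]
  calc _ ≤ ∑ ω : S.State M, ((if ω.1.1 x ≠ 0 then weight m b M ω else 0) +
        if ω.1.1 (x - S.u 2) ≠ 0 then weight m b M ω else 0) := by
        refine Finset.sum_le_sum fun ω _ => ?_
        have hw := weight_nonneg m b M ω
        by_cases h : S.IsLost ω.1.1 (2, x)
        · rw [if_pos h]
          rcases h.2 with h | h
          · rw [if_pos h]
            split_ifs <;> linarith
          · rw [if_pos h]
            split_ifs <;> linarith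
        · rw [if_neg h]
          split_ifs <;> linarith
    _ ≤ _ := by
        rw [Finset.sum_add_distrib]
        refine (add_le_add (hq x (Or.inl rfl)) (hq _ (Or.inr rfl))).trans (le_of_eq (by ring))

/-- The constant 4 combines the two ends of the lozenge with the factor 2 from the geometric series
over chain lengths. -/
theorem sum_isLost_not_confined_le (hm : m.Small t) (hb : 0 ≤ b) {x : S.V} {x' : S'.V} {R : ℕ}
    (hA : Agree S S' x x' R) :
    ∑ z : S.State M × S'.State M, (if S.IsLost z.1.1.1 (2, x) ∧ ¬ Confined x x' R z then
        pairWeight m b M z else 0) ≤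
      4 * Real.exp (-b) * Real.exp (-t * R) * (S.partition m b M * S'.partition m b M) := by
  have hZ := mul_pos (partition_pos (S := S) m b M) (partition_pos (S := S') m b M)
  by_cases hx : S.bit 2 x = 1
  swap
  · have : ∀ Δ : S.Conf, ¬ S.IsLost Δ.1 (2, x) := fun Δ h => hx h.1
    simp only [this, false_and, if_false, Finset.sum_const_zero]
    positivity
  have hq : ∀ q, (q = x ∨ q = x - S.u 2) →
      ∑ z : S.State M × S'.State M, (if z.1.1.1 q ≠ 0 ∧ ¬ Confined x x' R z then
        pairWeight m b M z else 0) ≤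
      2 * Real.exp (-b) * Real.exp (-t * R) * (S.partition m b M * S'.partition m b M) := by
    intro q hq
    have h := sum_not_confined_le (b := b) (M := M) hm hA {q} ∅ (Real.exp (-b)) 1
      (Real.exp_pos _).le zero_le_one
      (fun Δ hΔ => exp_horizontal_le hb (x := x) ⟨hx, by
        have := mem_supp.1 (hΔ (Finset.mem_singleton_self q))
        rcases hq with rfl | rfl
        · exact Or.inl this
        · exact Or.inr this⟩) (fun Δ _ => exp_horizontal_le_one hb _)
    rw [mul_one] at h
    refine (Finset.sum_le_sum fun ω _ => ?_).trans h
    refine le_of_eq (if_congr ?_ rfl rfl)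
    simp [mem_supp]
  calc _ ≤ ∑ z : S.State M × S'.State M,
        ((if z.1.1.1 x ≠ 0 ∧ ¬ Confined x x' R z then pairWeight m b M z else 0) +
        if z.1.1.1 (x - S.u 2) ≠ 0 ∧ ¬ Confined x x' R z then pairWeight m b M z else 0) := by
        refine Finset.sum_le_sum fun z _ => ?_
        have hw := pairWeight_nonneg m b M z
        by_cases h : S.IsLost z.1.1.1 (2, x) ∧ ¬ Confined x x' R z
        · rw [if_pos h]
          rcases h.1.2 with h' | h'
          · rw [if_pos ⟨h', h.2⟩]
            split_ifs <;> linarith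
          · rw [if_pos (c := z.1.1.1 (x - S.u 2) ≠ 0 ∧ ¬ Confined x x' R z) ⟨h', h.2⟩]
            split_ifs <;> linarith
        · rw [if_neg h]
          split_ifs <;> linarith
    _ ≤ _ := by
        rw [Finset.sum_add_distrib]
        refine (add_le_add (hq x (Or.inl rfl)) (hq _ (Or.inr rfl))).trans (le_of_eq (by ring))

theorem confined_symm {x : S.V} {x' : S'.V} {R : ℕ} {z : S.State M × S'.State M} :
    Confined x' x R z.swap ↔ Confined x x' R z := by
  simp only [Confined, stateCluster, Prod.fst_swap, Prod.snd_swap]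
  rw [pairCluster_symm]

/-- Write the difference as the mean, over independent states of the two tori, of the difference of
the two indicators. Confined pairs cancel under the exchange; for the rest each indicator is bounded
separately. -/
theorem abs_lossProb_sub_le (hm : m.Small t) (hb : 0 ≤ b) {x : S.V} {x' : S'.V} {R : ℕ}
    (hA : Agree S S' x x' R) :
    |S.lossProb m b M x - S'.lossProb m b M x'| ≤ 8 * Real.exp (-b) * Real.exp (-t * R) := by
  have hZ := mul_pos (partition_pos (S := S) m b M) (partition_pos (S := S') m b M)
  let F : S.State M × S'.State M → ℝ := fun z => pairWeight m b M z *
    ((if S.IsLost z.1.1.1 (2, x) then 1 else 0) - if S'.IsLost z.2.1.1 (2, x') then 1 else 0)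
  have hsum : ∑ z, F z = (S.lossProb m b M x - S'.lossProb m b M x') *
      (S.partition m b M * S'.partition m b M) := by
    have h1 := sum_state_isLost (m := m) (b := b) (M := M) x
    have h2 := sum_state_isLost (m := m) (b := b) (M := M) x'
    have h3 := sum_weight_eq_partition (S := S) m b M
    have h4 := sum_weight_eq_partition (S := S') m b M
    calc _ = (∑ ω : S.State M, if S.IsLost ω.1.1 (2, x) then weight m b M ω else 0) *
          (∑ ω : S'.State M, weight m b M ω) - (∑ ω : S.State M, weight m b M ω) *
          ∑ ω : S'.State M, if S'.IsLost ω.1.1 (2, x') then weight m b M ω else 0 := by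
          rw [Finset.sum_mul_sum, Finset.sum_mul_sum, ← Fintype.sum_prod_type',
            ← Fintype.sum_prod_type', ← Finset.sum_sub_distrib]
          refine Finset.sum_congr rfl fun z _ => ?_
          simp only [F, pairWeight]
          split_ifs <;> ring
      _ = _ := by
          rw [h1, h2, h3, h4]
          ring
  -- The exchange keeps the weight and reverses the sign of the difference of indicators; on a fixed
  -- point the difference is zero.
  have hgood : ∑ z ∈ Finset.univ.filter (Confined (M := M) x x' R), F z = 0 := by
    refine Finset.sum_involution
      (fun z hz => swapStates hA z (Finset.mem_filter.1 hz).2) (fun z hz => ?_)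
      (fun z hz hne heq => hne ?_)
      (fun z hz => Finset.mem_filter.2 ⟨Finset.mem_univ _, confined_swapStates hA z _⟩)
      (fun z hz => swapStates_swapStates hA z (Finset.mem_filter.1 hz).2)
    · simp only [F]
      rw [pairWeight_swapStates]
      simp only [isLost_swapStates]
      ring
    · have h := isLost_swapStates hA z (Finset.mem_filter.1 hz).2
      rw [heq] at h
      simp only [F, h.1, sub_self, mul_zero]
  have hbad : |∑ z ∈ Finset.univ.filter (fun z => ¬ Confined (M := M) x x' R z), F z| ≤
      8 * Real.exp (-b) * Real.exp (-t * R) * (S.partition m b M * S'.partition m b M) := by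
    refine (Finset.abs_sum_le_sum_abs _ _).trans ?_
    rw [Finset.sum_filter]
    have e1 := sum_isLost_not_confined_le (M := M) hm hb hA
    have e2 := sum_isLost_not_confined_le (M := M) hm hb hA.symm
    rw [← (Equiv.prodComm (S.State M) (S'.State M)).sum_comp] at e2
    calc _ ≤ ∑ z : S.State M × S'.State M,
          ((if S.IsLost z.1.1.1 (2, x) ∧ ¬ Confined x x' R z then pairWeight m b M z else 0) +
          if S'.IsLost z.swap.1.1.1 (2, x') ∧ ¬ Confined x' x R z.swap then
            pairWeight m b M z.swap else 0) := by
          refine Finset.sum_le_sum fun z _ => ?_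
          have hw := pairWeight_nonneg m b M z
          have hsw : pairWeight m b M z.swap = pairWeight m b M z := mul_comm _ _
          rw [hsw]
          simp only [F, confined_symm, Prod.fst_swap]
          by_cases h : Confined x x' R z
          · simp [h]
          · simp only [h, not_false_eq_true, if_true, and_true]
            rw [abs_mul, abs_of_nonneg hw]
            split_ifs <;> simp [hw]
      _ ≤ _ := by
          rw [Finset.sum_add_distrib]
          refine (add_le_add e1 e2).trans (le_of_eq (by ring))
  rw [← mul_le_mul_iff_of_pos_right hZ]
  calc _ = |∑ z, F z| := by rw [hsum, abs_mul, abs_of_pos hZ]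
    _ ≤ _ := by
        rw [← Finset.sum_filter_add_sum_filter_not Finset.univ (Confined (M := M) x x' R), hgood,
          zero_add]
        exact hbad

end LozengeTorus

/-! ### Integrating Gibbs means -/

section GibbsIntegral

variable {ι : Type*} [Fintype ι] {w G : ι → ℝ} {i₀ : ι}

theorem sum_exp_mul_pos (hw : ∀ i, 0 < w i) (i₀ : ι) (a : ℝ) :
    0 < ∑ i, Real.exp (-a * G i) * w i :=
  Finset.sum_pos (fun i _ => mul_pos (Real.exp_pos _) (hw i)) ⟨i₀, Finset.mem_univ _⟩

theorem hasDerivAt_neg_log_sum_exp (hw : ∀ i, 0 < w i) (i₀ : ι) (a : ℝ) :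
    HasDerivAt (fun a => -Real.log (∑ i, Real.exp (-a * G i) * w i))
      (gibbsMean (fun i => Real.exp (-a * G i) * w i) G) a := by
  have h1 : HasDerivAt (fun a => ∑ i, Real.exp (-a * G i) * w i)
      (∑ i, Real.exp (-a * G i) * (-G i) * w i) a := by
    refine HasDerivAt.fun_sum fun i _ => ?_
    refine HasDerivAt.mul_const (HasDerivAt.exp ?_) _
    simpa using ((hasDerivAt_id a).neg.mul_const (G i))
  have h2 := (h1.log (sum_exp_mul_pos hw i₀ a).ne').neg
  refine HasDerivAt.congr_deriv h2 ?_
  simp only [gibbsMean, tsum_fintype]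
  rw [← neg_div, ← Finset.sum_neg_distrib]
  congr 1
  exact Finset.sum_congr rfl fun i _ => by ring

/-- Only the unique minimiser of `G` survives in the limit. -/
theorem tendsto_neg_log_sum_exp (hw : ∀ i, 0 < w i) (h0 : G i₀ = 0) (hG : ∀ i, i ≠ i₀ → 0 < G i) :
    Filter.Tendsto (fun a => -Real.log (∑ i, Real.exp (-a * G i) * w i)) Filter.atTop
      (nhds (-Real.log (w i₀))) := by
  have h1 : Filter.Tendsto (fun a => ∑ i, Real.exp (-a * G i) * w i) Filter.atTop
      (nhds (∑ i, if i = i₀ then w i₀ else 0)) := by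
    refine tendsto_finsetSum _ fun i _ => ?_
    split_ifs with h
    · subst h
      simp [h0]
    · have : Filter.Tendsto (fun a : ℝ => -a * G i) Filter.atTop Filter.atBot :=
        Filter.tendsto_neg_atTop_atBot.atBot_mul_const (hG i h)
      simpa using (Real.tendsto_exp_atBot.comp this).mul_const (w i)
  rw [Finset.sum_ite_eq' Finset.univ i₀, if_pos (Finset.mem_univ _)] at h1
  exact (h1.log (hw i₀).ne').neg

theorem gibbsMean_exp_nonneg (hw : ∀ i, 0 < w i) (h0 : G i₀ = 0) (hG : ∀ i, i ≠ i₀ → 0 < G i)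
    (a : ℝ) : 0 ≤ gibbsMean (fun i => Real.exp (-a * G i) * w i) G := by
  rw [gibbsMean, tsum_fintype, tsum_fintype]
  refine div_nonneg (Finset.sum_nonneg fun i _ => mul_nonneg ?_ ?_) (sum_exp_mul_pos hw i₀ a).le
  · by_cases h : i = i₀
    · exact (h ▸ h0).ge
    · exact (hG i h).le
  · exact mul_nonneg (Real.exp_pos _).le (hw i).le

theorem integrableOn_gibbsMean (hw : ∀ i, 0 < w i) (h0 : G i₀ = 0) (hG : ∀ i, i ≠ i₀ → 0 < G i)
    (α : ℝ) : IntegrableOn (fun a => gibbsMean (fun i => Real.exp (-a * G i) * w i) G)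
      (Set.Ioi α) :=
  integrableOn_Ioi_deriv_of_nonneg' (fun a _ => hasDerivAt_neg_log_sum_exp hw i₀ a)
    (fun a _ => gibbsMean_exp_nonneg hw h0 hG a) (tendsto_neg_log_sum_exp hw h0 hG)

theorem integral_gibbsMean (hw : ∀ i, 0 < w i) (h0 : G i₀ = 0) (hG : ∀ i, i ≠ i₀ → 0 < G i)
    (α : ℝ) : ∫ a in Set.Ioi α, gibbsMean (fun i => Real.exp (-a * G i) * w i) G =
      Real.log (∑ i, Real.exp (-α * G i) * w i) - Real.log (w i₀) := by
  rw [integral_Ioi_of_hasDerivAt_of_nonneg' (fun a _ => hasDerivAt_neg_log_sum_exp hw i₀ a)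
    (fun a _ => gibbsMean_exp_nonneg hw h0 hG a) (tendsto_neg_log_sum_exp hw h0 hG)]
  ring

end GibbsIntegral

/-! ### The free energy as a sum of losses -/

namespace LozengeTorus

variable {S S' : LozengeTorus} {m : Potential} {t b : ℝ} {M : ℕ}

/-- The number of lost horizontal lozenges. -/
def horizontal (Δ : S.V → ℤ) : ℕ := ((S.lost Δ).filter fun p => p.1 = 2).card

theorem horizontal_eq_sum (Δ : S.V → ℤ) :
    (horizontal Δ : ℝ) = ∑ x, if S.IsLost Δ (2, x) then 1 else 0 := by
  rw [← Finset.sum_filter, Finset.sum_const, nsmul_eq_mul, mul_one, horizontal]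
  congr 1
  refine (Finset.card_bij (fun x _ => ((2 : Fin 3), x)) ?_ ?_ ?_).symm
  · intro x hx
    exact Finset.mem_filter.2 ⟨mem_lost.2 (Finset.mem_filter.1 hx).2, rfl⟩
  · intro x _ y _ h
    exact (Prod.mk.inj h).2
  · rintro ⟨i, x⟩ h
    obtain ⟨h1, rfl⟩ := Finset.mem_filter.1 h
    exact ⟨x, Finset.mem_filter.2 ⟨Finset.mem_univ _, mem_lost.1 h1⟩, rfl⟩

theorem horizontal_zero : horizontal (0 : S.V → ℤ) = 0 := by
  simp [horizontal, lost, IsLost]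

/-- If no horizontal lozenge is lost, `Δ` is monotone along every line in the direction `(1, 1)`:
across the base of a horizontal lozenge it is zero at both ends, and elsewhere admissibility gives
the inequality. The lines are closed on the torus, so `Δ` is constant on each, and each contains a
horizontal lozenge, where `Δ` vanishes. -/
theorem eq_zero_of_horizontal_eq_zero {Δ : S.V → ℤ} (hΔ : S.Adm Δ) (h : horizontal Δ = 0) :
    Δ = 0 := by
  have hl : ∀ x, ¬ S.IsLost Δ (2, x) := by
    intro x hx
    have := Finset.card_eq_zero.1 h
    have hmem : ((2 : Fin 3), x) ∈ (S.lost Δ).filter fun p => p.1 = 2 :=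
      Finset.mem_filter.2 ⟨mem_lost.2 hx, rfl⟩
    rw [this] at hmem
    simp at hmem
  have hl' : ∀ x, S.bit 2 x = 1 → Δ x = 0 ∧ Δ (x + S.proj (1, 1)) = 0 := by
    intro x hx
    have := hl x
    simp only [IsLost, hx, true_and, u_two, sub_neg_eq_add] at this
    push Not at this
    exact this
  have hmono : ∀ x, Δ x ≤ Δ (x + S.proj (1, 1)) := by
    intro x
    rcases bit_eq_zero_or_one 2 x with h0 | h1
    · have := (hΔ 2 x).1
      simp only [moved, u_two, sub_neg_eq_add, h0] at this
      lia
    · rw [(hl' x h1).1, (hl' x h1).2]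
  funext c
  have hm : Monotone fun n : ℕ => Δ (c + n • S.proj (1, 1)) := by
    refine monotone_nat_of_le_succ fun n => ?_
    rw [succ_nsmul, ← add_assoc]
    exact hmono _
  obtain ⟨n, hn⟩ := S.exists_bit_two c
  have h1 := hm (Nat.zero_le n)
  -- A number of steps divisible by the order of the group leads back to `c`.
  have h2 := hm (Nat.le_mul_of_pos_right n (Fintype.card_pos (α := S.V)))
  simp only [zero_smul, add_zero, mul_nsmul', card_nsmul_eq_zero, (hl' _ hn).1] at h1 h2
  exact le_antisymm h1 (by simpa using h2)

theorem tilt_sum (hM : S.size ≤ M) (Δ : S.V → ℤ) : ∑ q, S.tilt m M Δ q =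
    ∑ c, ∑ r ∈ scales S.size,
      (m.g r (S.pattern 0 c r) - m.g r (S.pattern Δ c r) + 2 * m.ε r) := by
  rw [Fintype.sum_prod_type]
  refine Finset.sum_congr rfl fun c _ => ?_
  simp only [tilt]
  rw [Fin.sum_univ_eq_sum_range (fun r => if r ∈ scales S.size then
    m.g r (S.pattern 0 c r) - m.g r (S.pattern Δ c r) + 2 * m.ε r else 0), Finset.sum_ite_mem]
  congr 1
  refine Finset.inter_eq_right.2 fun r hr => Finset.mem_range.2 ?_
  have := Finset.mem_range.1 (Finset.mem_filter.1 hr).1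
  lia

theorem confWeight_eq (Δ : S.V → ℤ) : confWeight m b M Δ =
    Real.exp (-b * horizontal Δ) * confWeight m 0 M Δ := by
  rw [confWeight, confWeight, prod_edgeWeight, prod_edgeWeight, ← mul_assoc, ← Real.exp_add]
  congr 2
  rw [horizontal]
  ring

theorem confWeight_size (hM : S.size ≤ M) (Δ : S.V → ℤ) :
    confWeight m b M Δ = confWeight m b S.size Δ := by
  rw [confWeight, confWeight, ← Real.exp_sum, ← Real.exp_sum, tilt_sum hM, tilt_sum le_rfl]

/-- Comparing tori of different sizes needs a common range `M` of radii; radii beyond the scales of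
a torus have no effect on it. -/
theorem lossProb_size (hM : S.size ≤ M) (x : S.V) :
    S.lossProb m b M x = S.lossProb m b S.size x := by
  simp only [lossProb, partition, confWeight_size hM]

/-- The integrated probability that the horizontal lozenge with base `x` is lost. -/
def loss (S : LozengeTorus) (m : Potential) (x : S.V) : ℝ :=
  ∫ b in Set.Ioi 0, S.lossProb m b S.size x

theorem continuous_lossProb (x : S.V) : Continuous fun b => S.lossProb m b S.size x := by
  have h : ∀ Δ : S.V → ℤ, Continuous fun b => confWeight m b S.size Δ := by
    intro Δ
    have e : (fun b => confWeight m b S.size Δ) =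
        fun b => Real.exp (-b * horizontal Δ) * confWeight m 0 S.size Δ :=
      funext fun b => confWeight_eq Δ
    rw [e]
    fun_prop
  refine Continuous.div ?_ (continuous_finsetSum _ fun Δ _ => h Δ.1)
    fun b => (partition_pos m b S.size).ne'
  refine continuous_finsetSum _ fun Δ _ => ?_
  split_ifs
  · exact h Δ.1
  · exact continuous_const

theorem integrableOn_lossProb (hm : m.Small t) (x : S.V) :
    IntegrableOn (fun b => S.lossProb m b S.size x) (Set.Ioi 0) := by
  refine Integrable.mono' ((integrableOn_exp_neg_Ioi 0).const_mul (2 * siteCost m))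
    (continuous_lossProb x).aestronglyMeasurable ?_
  refine (ae_restrict_iff' measurableSet_Ioi).2 (Filter.Eventually.of_forall fun b hb => ?_)
  rw [Real.norm_of_nonneg (lossProb_nonneg x)]
  exact lossProb_le hm (Set.mem_Ioi.1 hb).le x

theorem loss_nonneg (x : S.V) : 0 ≤ S.loss m x :=
  setIntegral_nonneg measurableSet_Ioi fun _ _ => lossProb_nonneg x

theorem loss_le (hm : m.Small t) (x : S.V) : S.loss m x ≤ 2 * siteCost m := by
  have h := setIntegral_mono_on (integrableOn_lossProb hm x)
    ((integrableOn_exp_neg_Ioi 0).const_mul (2 * siteCost m)) measurableSet_Ioi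
    fun b hb => lossProb_le hm (Set.mem_Ioi.1 hb).le x
  rwa [integral_const_mul, integral_exp_neg_Ioi_zero, mul_one] at h

theorem loss_eq_zero {x : S.V} (hx : S.bit 2 x ≠ 1) : S.loss m x = 0 := by
  simp [loss, lossProb_eq_zero hx]

theorem abs_loss_sub_le (hm : m.Small t) {x : S.V} {x' : S'.V} {R : ℕ}
    (hA : Agree S S' x x' R) : |S.loss m x - S'.loss m x'| ≤ 8 * Real.exp (-t * R) := by
  rw [loss, loss, ← integral_sub (integrableOn_lossProb hm x) (integrableOn_lossProb hm x')]
  have hi : IntegrableOn (fun b => 8 * Real.exp (-t * R) * Real.exp (-b)) (Set.Ioi 0) :=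
    (integrableOn_exp_neg_Ioi 0).const_mul _
  have h := norm_integral_le_of_norm_le hi
    (f := fun b => S.lossProb m b S.size x - S'.lossProb m b S'.size x')
    ((ae_restrict_iff' measurableSet_Ioi).2 (Filter.Eventually.of_forall fun b hb => by
      rw [← lossProb_size (le_max_left S.size S'.size), ← lossProb_size (le_max_right S.size S'.size),
        Real.norm_eq_abs]
      refine (abs_lossProb_sub_le hm (Set.mem_Ioi.1 hb).le hA).trans (le_of_eq (by ring))))
  rwa [integral_const_mul, integral_exp_neg_Ioi_zero, mul_one, Real.norm_eq_abs] at h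

/-- The logarithm of the sum over all tilings that meet the given one, with interaction `g`. -/
def freeEnergy (S : LozengeTorus) (α : ℝ) (g : ℕ → Set Lozenge → ℝ) : ℝ :=
  Real.log (∑ Δ : S.Conf, Real.exp (-α * (S.lost Δ.1).card +
    ∑ c, ∑ r ∈ scales S.size, (g r (S.pattern 0 c r) - g r (S.pattern Δ.1 c r))))

/-- Summing the loss probabilities over the sites gives the Gibbs mean of `horizontal`, which
vanishes only at the zero configuration. Its integral over `b > 0` is therefore the logarithm of the
partition function at `b = 0` minus that of the ground state weight. -/
theorem freeEnergy_eq_sum_loss (hm : m.Small t) : S.freeEnergy m.α m.g = ∑ x, S.loss m x := by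
  have hsum : ∀ b, ∑ x, S.lossProb m b S.size x =
      gibbsMean (fun Δ : S.Conf => Real.exp (-b * horizontal Δ.1) * confWeight m 0 S.size Δ.1)
        (fun Δ => horizontal Δ.1) := by
    intro b
    simp only [lossProb]
    rw [gibbsMean, tsum_fintype, tsum_fintype, ← Finset.sum_div, Finset.sum_comm, partition]
    simp only [← confWeight_eq]
    congr 1
    refine Finset.sum_congr rfl fun Δ _ => ?_
    rw [horizontal_eq_sum, Finset.sum_mul]
    exact Finset.sum_congr rfl fun x _ => by split_ifs <;> simp
  have hint := integral_gibbsMean (i₀ := (zeroConf : S.Conf))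
    (w := fun Δ => confWeight m 0 S.size Δ.1) (G := fun Δ => (horizontal Δ.1 : ℝ))
    (fun Δ => confWeight_pos m 0 S.size Δ.1) (by exact_mod_cast horizontal_zero (S := S))
    (fun Δ hΔ => by
      refine Nat.cast_pos.2 (Nat.pos_of_ne_zero fun h => hΔ (Subtype.ext ?_))
      exact eq_zero_of_horizontal_eq_zero Δ.2.1 h) 0
  simp only [← hsum] at hint
  rw [integral_finsetSum _ fun x _ => integrableOn_lossProb hm x] at hint
  rw [show ∑ x, S.loss m x = ∑ x, ∫ b in Set.Ioi 0, S.lossProb m b S.size x from rfl, hint]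
  -- The shift that made the tilts non-negative multiplies all weights by `exp E`, and cancels
  -- against the ground state.
  set E : ℝ := ∑ c : S.V, ∑ r ∈ scales S.size, 2 * m.ε r with hE
  have hw : ∀ Δ : S.V → ℤ, confWeight m 0 S.size Δ = Real.exp (-m.α * (S.lost Δ).card +
      ∑ c, ∑ r ∈ scales S.size, (m.g r (S.pattern 0 c r) - m.g r (S.pattern Δ c r))) *
        Real.exp E := by
    intro Δ
    rw [confWeight, prod_edgeWeight, ← Real.exp_sum, tilt_sum le_rfl, ← Real.exp_add,
      ← Real.exp_add]
    simp only [Finset.sum_add_distrib, hE]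
    congr 1
    ring
  have hw0 : confWeight m 0 S.size (zeroConf : S.Conf).1 = Real.exp E := by
    have h0 : S.lost (0 : S.V → ℤ) = ∅ :=
      Finset.eq_empty_of_forall_notMem fun p hp => by simpa [IsLost] using mem_lost.1 hp
    rw [hw]
    simp [zeroConf, h0]
  rw [hw0]
  simp only [hw, neg_zero, zero_mul, Real.exp_zero, one_mul]
  rw [← Finset.sum_mul, Real.log_mul _ (Real.exp_pos _).ne', freeEnergy]
  · ring
  · exact (Finset.sum_pos (fun Δ _ => Real.exp_pos _) ⟨(zeroConf : S.Conf), Finset.mem_univ _⟩).ne'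

end LozengeTorus

/-! ### Exponentially decaying potentials are small -/

theorem exists_forall_mul_exp_le {a : ℝ} (ha : 0 < a) (B : ℝ) {η : ℝ} (hη : 0 < η) :
    ∃ A : ℝ, ∀ α, A ≤ α → B * Real.exp (-(a * α)) ≤ η := by
  have h : Filter.Tendsto (fun α : ℝ => B * Real.exp (-(a * α))) Filter.atTop (nhds (B * 0)) :=
    (Real.tendsto_exp_neg_atTop_nhds_zero.comp
      (Filter.tendsto_id.const_mul_atTop ha)).const_mul B
  rw [mul_zero] at h
  obtain ⟨A, hA⟩ := Filter.eventually_atTop.1 (h.eventually (gt_mem_nhds hη))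
  exact ⟨A, fun α hα => (hA α hα).le⟩

/-- The potential with `|g r| ≤ c * exp (-α * r / c)`. -/
def decayPotential (c α : ℝ) (g : ℕ → Set Lozenge → ℝ)
    (hg : ∀ r T, |g r T| ≤ c * Real.exp (-α * r / c)) : Potential where
  α := α
  g r T := if r = 0 then 0 else g r T
  ε r := if r = 0 then 0 else c * Real.exp (-α * r / c)
  abs_le r T := by
    split_ifs
    · simp
    · exact hg r T

theorem card_triBall_sq_le {r : ℕ} (hr : r ≠ 0) :
    ((triBall r).card : ℝ) ^ 2 ≤ 1944 * Real.exp r := by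
  have h1 : ((triBall r).card : ℝ) ≤ 9 * (r : ℝ) ^ 2 := by
    have h := card_triBall_le r
    have h' : (2 * r + 1) ^ 2 ≤ 9 * r ^ 2 := by
      have : 2 * r + 1 ≤ 3 * r := by lia
      nlinarith
    exact_mod_cast h.trans h'
  have h2 := Real.pow_div_factorial_le_exp (r : ℝ) (Nat.cast_nonneg r) 4
  have h3 : ((triBall r).card : ℝ) ^ 2 ≤ (9 * (r : ℝ) ^ 2) ^ 2 :=
    pow_le_pow_left₀ (Nat.cast_nonneg _) h1 2
  -- From `r ^ 4 / 4! ≤ exp r`, with `1944 = 9 ^ 2 * 24`.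
  norm_num [Nat.factorial] at h2
  nlinarith

theorem card_triBall_two_le : (triBall 2).card ≤ 25 := card_triBall_le 2

theorem LozengeTorus.ballCost_le {m : Potential} {r : ℕ} (h : 4 * m.ε r ≤ 1) :
    LozengeTorus.ballCost m r ≤ 8 * m.ε r := by
  have h0 := m.eps_nonneg r
  have h1 := Real.abs_exp_sub_one_le (x := 4 * m.ε r) (by rwa [abs_of_nonneg (by linarith)])
  rw [abs_of_nonneg (by linarith : 0 ≤ 4 * m.ε r)] at h1
  exact (le_abs_self _).trans (h1.trans (by linarith))

theorem sum_half_pow_le (M : ℕ) : ∑ r : Fin M, (1 / 2 : ℝ) ^ (r : ℕ) ≤ 2 := by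
  rw [Fin.sum_univ_eq_sum_range (fun r => (1 / 2 : ℝ) ^ r)]
  exact sum_geometric_two_le M

/-- The rate is `α / (4 * c)` and a move through a ball of radius `r` has length at most `2 * r`, so
it uses up half of the decay `α * r / c`. The other half beats the number of such moves. A move to a
site has length two, and `6 ≤ c` makes its exponential factor small against `siteCost`. -/
theorem exists_small (c : ℝ) (hc : 6 ≤ c) : ∃ A : ℝ, ∀ α, A ≤ α →
    (∀ g hg, (decayPotential c α g hg).Small (α / (4 * c)) ∧
      LozengeTorus.siteCost (decayPotential c α g hg) ≤ Real.exp (-α / 4)) ∧ 64 * c ≤ α := by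
  have hc0 : 0 < c := by linarith
  -- Here `1 / 12 = 1 / 3 - 1 / 4` is the margin between the exponent in `siteCost` and the one
  -- claimed.
  obtain ⟨A₁, h₁⟩ := exists_forall_mul_exp_le (a := 1 / 12) (by norm_num) (16 ^ 7 * Real.exp 1)
    one_pos
  obtain ⟨A₂, h₂⟩ := exists_forall_mul_exp_le (a := 1 / 4) (by norm_num)
    (50 * (16 ^ 7 * Real.exp 1)) (η := 1 / 4) (by norm_num)
  obtain ⟨A₃, h₃⟩ := exists_forall_mul_exp_le (a := 1 / (2 * c)) (by positivity)
    (124416 * c * Real.exp 1) (η := 1 / 4) (by norm_num)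
  refine ⟨max (max A₁ A₂) (max A₃ (64 * c)), fun α hα => ?_⟩
  simp only [max_le_iff] at hα
  obtain ⟨⟨k₁, k₂⟩, k₃, k₄⟩ := hα
  have k₁ := h₁ α k₁
  have k₂ := h₂ α k₂
  have k₃ := h₃ α k₃
  have hα0 : 0 < α := by linarith
  refine ⟨fun g hg => ?_, k₄⟩
  set m := decayPotential c α g hg with hm
  have hmα : m.α = α := rfl
  set y := Real.exp 1 * Real.exp (-(1 / (2 * c) * α)) with hy
  have hy0 : 0 < y := by positivity
  have hcy : 124416 * (c * y) ≤ 1 / 4 := by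
    refine le_trans (le_of_eq ?_) k₃
    rw [hy]; ring
  have hyhalf : y ≤ 1 / 2 := by nlinarith
  have hsite : LozengeTorus.siteCost m ≤ Real.exp (-α / 4) := by
    rw [LozengeTorus.siteCost, hmα]
    have e : 16 ^ 7 * Real.exp (1 - α / 3) =
        16 ^ 7 * Real.exp 1 * Real.exp (-(1 / 12 * α)) * Real.exp (-α / 4) := by
      rw [mul_assoc, mul_assoc, ← Real.exp_add, ← Real.exp_add]
      congr 2; ring
    rw [e]
    exact mul_le_of_le_one_left (Real.exp_pos _).le k₁
  -- This bounds the total price of the moves through balls of radius `r`: the square counts the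
  -- entry and exit points relative to the centre. It decays like `y ^ r`, with `y` small for large
  -- `α`.
  set D : ℕ → ℝ := fun r => 8 * m.ε r * ((triBall r).card : ℝ) ^ 2 *
    Real.exp (α / (4 * c) * (2 * r)) with hD
  have hDle : ∀ r, D r ≤ 31104 * (c * y) * (1 / 2) ^ r := by
    intro r
    rcases Nat.eq_zero_or_pos r with rfl | hr
    · have : m.ε 0 = 0 := by simp [hm, decayPotential]
      simp only [hD, this]
      simpa using (by positivity : (0 : ℝ) ≤ 31104 * (c * y))
    · have he : m.ε r = c * Real.exp (-α * r / c) := by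
        simp [hm, decayPotential, hr.ne']
      have hb := card_triBall_sq_le hr.ne'
      have e1 : D r ≤ 8 * (c * Real.exp (-α * r / c)) * (1944 * Real.exp r) *
          Real.exp (α / (4 * c) * (2 * r)) := by
        simp only [hD, he]
        gcongr
      have e2 : 8 * (c * Real.exp (-α * r / c)) * (1944 * Real.exp r) *
          Real.exp (α / (4 * c) * (2 * r)) = 15552 * c * y ^ r := by
        rw [hy, ← Real.exp_add, ← Real.exp_nat_mul]
        have : Real.exp (r * (1 + -(1 / (2 * c) * α))) = Real.exp (-α * r / c) * Real.exp r *
            Real.exp (α / (4 * c) * (2 * r)) := by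
          rw [← Real.exp_add, ← Real.exp_add]
          congr 1
          field_simp
          ring
        rw [this]; ring
      have e3 : y ^ r ≤ 2 * y * (1 / 2) ^ r := by
        obtain ⟨k, rfl⟩ := Nat.exists_eq_add_of_le' hr
        have := pow_le_pow_left₀ hy0.le hyhalf k
        rw [pow_succ, pow_succ]
        nlinarith
      rw [e2] at e1
      refine e1.trans ?_
      have := mul_le_mul_of_nonneg_left e3 (by positivity : (0 : ℝ) ≤ 15552 * c)
      linarith
  have hDsum : ∀ M, ∑ r : Fin M, D r ≤ 1 / 8 := by
    intro M
    calc ∑ r : Fin M, D r ≤ ∑ r : Fin M, 31104 * (c * y) * (1 / 2) ^ (r : ℕ) :=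
          Finset.sum_le_sum fun r _ => hDle r
      _ ≤ 31104 * (c * y) * 2 := by
          rw [← Finset.mul_sum]
          exact mul_le_mul_of_nonneg_left (sum_half_pow_le M) (by positivity)
      _ ≤ 1 / 8 := by linarith
  have hball : ∀ r, 1 ≤ ((triBall r).card : ℝ) := by
    intro r
    have : 0 < (triBall r).card :=
      Finset.card_pos.2 ⟨0, mem_triBall.2 (by rw [triDist_self]; positivity)⟩
    exact_mod_cast this
  have hexp : ∀ r : ℕ, 1 ≤ Real.exp (α / (4 * c) * (2 * r)) := fun r =>
    Real.one_le_exp (by positivity)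
  have heD : ∀ r, 8 * m.ε r * (triBall r).card ≤ D r := by
    intro r
    have h0 := m.eps_nonneg r
    have h1 := hball r
    calc 8 * m.ε r * (triBall r).card ≤ 8 * m.ε r * ((triBall r).card : ℝ) ^ 2 := by
          refine mul_le_mul_of_nonneg_left ?_ (by positivity)
          nlinarith
      _ ≤ D r := le_mul_of_one_le_right (by positivity) (hexp r)
  have heps : ∀ r, 4 * m.ε r ≤ 1 := by
    intro r
    have h0 := m.eps_nonneg r
    have h1 := heD r
    have h2 := hDle r
    have h3 := hball r
    have h4 : (1 / 2 : ℝ) ^ r ≤ 1 := pow_le_one₀ (by norm_num) (by norm_num)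
    have h5 : 8 * m.ε r ≤ 8 * m.ε r * (triBall r).card := le_mul_of_one_le_right (by positivity) h3
    have h6 : 31104 * (c * y) * (1 / 2) ^ r ≤ 31104 * (c * y) * 1 := by gcongr
    linarith
  refine ⟨⟨hα0.le, by positivity, hsite.trans (Real.exp_le_one_iff.2 (by linarith)), ?_, ?_⟩, hsite⟩
  · intro M
    refine le_trans (Finset.sum_le_sum fun r _ => ?_) ((hDsum M).trans (by norm_num))
    refine le_trans ?_ (heD r)
    have := m.eps_nonneg r
    gcongr
    norm_num
  · intro M
    rw [moves, Finset.sum_product, Fintype.sum_bool]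
    suffices h : ∀ i : Bool, ∑ y ∈ (triBall 2).disjSum
        (Finset.univ.sigma fun ρ : Fin M => triBall ρ ×ˢ triBall ρ),
        Move.cost m ((i, y) : Move M) * Real.exp (α / (4 * c) * Move.length ((i, y) : Move M)) ≤
          1 / 4 by
      have := h true
      have := h false
      linarith
    intro i
    rw [Finset.sum_disjSum, Finset.sum_sigma]
    have s1 : ∑ x ∈ triBall 2, Move.cost m ((i, Sum.inl x) : Move M) *
        Real.exp (α / (4 * c) * Move.length ((i, Sum.inl x) : Move M)) ≤ 1 / 8 := by
      simp only [Move.cost, Move.length]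
      rw [Finset.sum_const, nsmul_eq_mul]
      have hle : LozengeTorus.siteCost m * Real.exp (α / (4 * c) * 2) ≤
          16 ^ 7 * Real.exp 1 * Real.exp (-(1 / 4 * α)) := by
        rw [LozengeTorus.siteCost, hmα, mul_assoc, mul_assoc, ← Real.exp_add, ← Real.exp_add]
        refine mul_le_mul_of_nonneg_left (Real.exp_le_exp.2 ?_) (by positivity)
        have : α / (4 * c) * 2 ≤ α / 12 := by
          rw [div_mul_eq_mul_div, div_le_div_iff₀ (by positivity) (by norm_num)]
          nlinarith
        linarith
      have h25 : ((triBall 2).card : ℝ) ≤ 25 := by exact_mod_cast card_triBall_two_le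
      have hpos : 0 ≤ LozengeTorus.siteCost m * Real.exp (α / (4 * c) * 2) :=
        mul_nonneg (LozengeTorus.siteCost_pos m).le (Real.exp_pos _).le
      have := mul_le_mul_of_nonneg_right h25 hpos
      linarith
    have s2 : ∑ ρ : Fin M, ∑ q ∈ triBall ρ ×ˢ triBall ρ,
        Move.cost m ((i, Sum.inr ⟨ρ, q⟩) : Move M) *
          Real.exp (α / (4 * c) * Move.length ((i, Sum.inr ⟨ρ, q⟩) : Move M)) ≤ 1 / 8 := by
      refine le_trans (Finset.sum_le_sum fun ρ _ => ?_) (hDsum M)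
      simp only [Move.cost, Move.length]
      rw [Finset.sum_const, nsmul_eq_mul, Finset.card_product]
      have := LozengeTorus.ballCost_le (heps ρ)
      have h' : LozengeTorus.ballCost m ρ * Real.exp (α / (4 * c) * (2 * (ρ : ℕ))) ≤
          8 * m.ε ρ * Real.exp (α / (4 * c) * (2 * (ρ : ℕ))) := by gcongr
      calc _ ≤ (((triBall ρ).card * (triBall ρ).card : ℕ) : ℝ) *
            (8 * m.ε ρ * Real.exp (α / (4 * c) * (2 * (ρ : ℕ)))) := by gcongr
        _ = D ρ := by simp only [hD]; push_cast; ring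
    linarith [add_le_add s1 s2]

/-! ### Local functions -/

theorem mem_scales {n r : ℕ} : r ∈ scales n ↔ (∃ k, r = 2 ^ k) ∧ 2 * r < n := by
  have h : (r : ℝ) < (n : ℝ) / 2 ↔ 2 * r < n := by
    rw [lt_div_iff₀ two_pos, mul_comm]
    exact_mod_cast Iff.rfl
  simp only [scales, Finset.mem_filter, Finset.mem_range, h]
  exact ⟨fun h => h.2, fun h => ⟨by lia, h⟩⟩

theorem exists_scales_eq (n : ℕ) : ∃ K : ℕ, scales n = (Finset.range K).image (2 ^ ·) ∧
    n ≤ 2 * 2 ^ K ∧ ∀ k < K, 2 * 2 ^ k < n := by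
  have hex : ∃ K : ℕ, n ≤ 2 * 2 ^ K := ⟨n, by have := Nat.lt_two_pow_self (n := n); lia⟩
  refine ⟨Nat.find hex, ?_, Nat.find_spec hex, fun k hk => not_le.1 (Nat.find_min hex hk)⟩
  ext r
  simp only [mem_scales, Finset.mem_image, Finset.mem_range]
  constructor
  · rintro ⟨⟨k, rfl⟩, h⟩
    refine ⟨k, ?_, rfl⟩
    by_contra hk
    have h1 := Nat.find_spec hex
    have h2 : 2 ^ Nat.find hex ≤ 2 ^ k := Nat.pow_le_pow_right two_pos (not_lt.1 hk)
    lia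
  · rintro ⟨k, hk, rfl⟩
    exact ⟨⟨k, rfl⟩, not_le.1 (Nat.find_min hex hk)⟩

theorem Lozenge.MeetsBall.mono {r r' : ℕ} (h : r ≤ r') {l : Lozenge} (hl : l.MeetsBall r) :
    l.MeetsBall r' := by
  obtain ⟨t, ht, hv⟩ := hl
  exact ⟨t, ht, fun v hvt => (hv v hvt).trans (by exact_mod_cast h)⟩

theorem Lozenge.meetsBall_of_lt {r : ℕ} {l : Lozenge} (h : triDist l.base 0 + 1 ≤ r) :
    l.MeetsBall r := by
  have h' := (triDist_le_iff (r := (r : ℤ) - 1)).1 (by linarith : triDist l.base 0 ≤ (r : ℤ) - 1)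
  refine ⟨_, Or.inl rfl, ?_⟩
  obtain ⟨d, v⟩ := l
  simp only [Set.mem_insert_iff, Set.mem_singleton_iff]
  rintro w (rfl | rfl | rfl) <;> rw [triDist_le_iff] <;> fin_cases d <;>
    simp [unitVec] at h' ⊢ <;> lia

namespace LozengeTorus

variable {S S' : LozengeTorus} {m : Potential} {t : ℝ}

theorem pattern_inter {Δ : S.V → ℤ} {c : S.V} {r r' : ℕ} (h : r' ≤ r) :
    S.pattern Δ c r ∩ {l | l.MeetsBall r'} = S.pattern Δ c r' := by
  ext l
  exact ⟨fun ⟨h1, h2⟩ => ⟨h1.1, h2⟩, fun ⟨h1, h2⟩ => ⟨⟨h1, h2.mono h⟩, h2⟩⟩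

theorem bit_eq_of_pattern_eq {x : S.V} {x' : S'.V} {r : ℕ}
    (h : S.pattern 0 x r = S'.pattern 0 x' r) (i : Fin 3) (v : ℤ × ℤ) (hv : triDist v 0 + 1 ≤ r) :
    S.bit i (x + S.proj v) = S'.bit i (x' + S'.proj v) := by
  have hl : (⟨i, v⟩ : Lozenge).MeetsBall r := Lozenge.meetsBall_of_lt hv
  have e : (⟨i, v⟩ : Lozenge) ∈ S.pattern 0 x r ↔ (⟨i, v⟩ : Lozenge) ∈ S'.pattern 0 x' r := by
    rw [h]
  simp only [pattern, moved_zero, Set.mem_ofPred_eq, hl, and_true] at e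
  rcases bit_eq_zero_or_one i (x + S.proj v) with h1 | h1 <;>
    rcases bit_eq_zero_or_one i (x' + S'.proj v) with h2 | h2 <;> simp_all

/-- A pattern of radius `r` determines the bits at distance up to `r - 1`, and `Agree` with radius
`R` requires them up to `R + 1`. -/
theorem agree_of_pattern_eq {x : S.V} {x' : S'.V} {r : ℕ} (hr : 2 ≤ r)
    (h : S.pattern 0 x r = S'.pattern 0 x' r) (hS : 2 * r < S.size) (hS' : 2 * r < S'.size) :
    Agree S S' x x' (r - 2) where
  size_left := by lia
  size_right := by lia
  bit_eq i v hv := bit_eq_of_pattern_eq h i v (by push_cast [hr] at hv; linarith)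

/-- The pattern of radius `r` around the site `x` is `T`, in a torus that is large enough. -/
def Realizes (S : LozengeTorus) (x : S.V) (r : ℕ) (T : Set Lozenge) : Prop :=
  2 * r < S.size ∧ S.pattern 0 x r = T

theorem Realizes.inter {x : S.V} {r r' : ℕ} {T : Set Lozenge} (h : S.Realizes x r T)
    (hr : r' ≤ r) : S.Realizes x r' (T ∩ {l | l.MeetsBall r'}) :=
  ⟨by have := h.1; lia, by rw [← h.2, pattern_inter hr]⟩

end LozengeTorus

open LozengeTorus

/-! ### Dyadic increments of the loss -/

/-- A value of `loss` at a site with the given pattern. -/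
def localLoss (m : Potential) (r : ℕ) (T : Set Lozenge) : ℝ :=
  if h : r ≠ 0 ∧ ∃ v, ∃ (S : LozengeTorus) (x : S.V), S.Realizes x r T ∧ v = S.loss m x then
    h.2.choose else 0

/-- The increment of `localLoss` between two consecutive scales. -/
def localIncrement (m : Potential) (r : ℕ) (T : Set Lozenge) : ℝ :=
  if ∃ (S : LozengeTorus) (x : S.V), S.Realizes x r T then
    localLoss m r T - localLoss m (r / 2) (T ∩ {l | l.MeetsBall (r / 2)}) else 0

variable {m : Potential} {c t : ℝ} {S : LozengeTorus} {x : S.V} {r : ℕ} {T : Set Lozenge}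

theorem localLoss_zero : localLoss m 0 T = 0 := by simp [localLoss]

theorem exists_localLoss_eq (hr : r ≠ 0) (h : S.Realizes x r T) :
    ∃ (S' : LozengeTorus) (x' : S'.V), S'.Realizes x' r T ∧ localLoss m r T = S'.loss m x' := by
  have hex : r ≠ 0 ∧ ∃ v, ∃ (S : LozengeTorus) (x : S.V), S.Realizes x r T ∧ v = S.loss m x :=
    ⟨hr, _, S, x, h, rfl⟩
  rw [localLoss, dif_pos hex]
  exact hex.2.choose_spec

theorem loss_le_exp (hm : m.Small t) (hs : siteCost m ≤ Real.exp (-m.α / 4)) (x : S.V) :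
    S.loss m x ≤ 2 * Real.exp (-m.α / 4) :=
  (loss_le hm x).trans (by linarith)

section Bounds

variable (hc : 6 ≤ c) (hm : m.Small (m.α / (4 * c))) (hs : siteCost m ≤ Real.exp (-m.α / 4))

include hc hm hs

theorem abs_loss_sub_le_of_pattern_eq {S' : LozengeTorus} {x' : S'.V} (hr : r ≠ 0)
    (h : S.Realizes x r T) (h' : S'.Realizes x' r T) :
    |S.loss m x - S'.loss m x'| ≤ 8 * Real.exp (-m.α * r / (8 * c)) := by
  have hα := hm.alpha_nonneg
  -- For small `r` the smallness of `loss` itself suffices; from 4 on, `r - 2 ≥ r / 2`, which halves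
  -- the rate.
  rcases lt_or_ge r 4 with h4 | h4
  · have a1 := loss_le_exp hm hs x
    have a2 := loss_le_exp hm hs x'
    have a3 := loss_nonneg (m := m) x
    have a4 := loss_nonneg (m := m) x'
    have a5 : Real.exp (-m.α / 4) ≤ Real.exp (-m.α * r / (8 * c)) := by
      refine Real.exp_le_exp.2 ?_
      have hr4 : (r : ℝ) ≤ 4 := by exact_mod_cast h4.le
      rw [div_le_div_iff₀ (by norm_num) (by positivity)]
      nlinarith [mul_le_mul_of_nonneg_left (by linarith : (r : ℝ) * 4 ≤ 8 * c) hα]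
    have := Real.exp_pos (-m.α / 4)
    rw [abs_le]
    constructor <;> linarith
  · refine (abs_loss_sub_le hm (agree_of_pattern_eq (by lia) (h.2.trans h'.2.symm) h.1 h'.1)).trans
      (mul_le_mul_of_nonneg_left (Real.exp_le_exp.2 ?_) (by norm_num))
    have hr4 : (4 : ℝ) ≤ r := by exact_mod_cast h4
    rw [Nat.cast_sub (by lia)]
    have e : -m.α * r / (8 * c) = -(m.α / (4 * c)) * (r / 2) := by
      field_simp
      ring
    rw [e]
    have := hm.rate_nonneg
    push_cast
    nlinarith

theorem abs_localLoss_sub_le (hr : r ≠ 0) (h : S.Realizes x r T) :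
    |S.loss m x - localLoss m r T| ≤ 8 * Real.exp (-m.α * r / (8 * c)) := by
  obtain ⟨S', x', h', e⟩ := exists_localLoss_eq (m := m) hr h
  rw [e]
  exact abs_loss_sub_le_of_pattern_eq hc hm hs hr h h'

theorem abs_localIncrement_le (r : ℕ) (T : Set Lozenge) :
    |localIncrement m r T| ≤ 16 * Real.exp (-m.α * r / (24 * c)) := by
  have hα := hm.alpha_nonneg
  rw [localIncrement]
  split_ifs with h
  swap
  · rw [abs_zero]; positivity
  obtain ⟨S, x, h⟩ := h
  rcases Nat.eq_zero_or_pos r with rfl | hr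
  · rw [localLoss_zero, localLoss_zero, sub_zero, abs_zero]; positivity
  -- Radii need not be powers of two here, so the integer half of `r` may be as small as `r / 3`, at
  -- `r = 3`.
  have mono : ∀ k : ℕ, r ≤ 3 * k →
      Real.exp (-m.α * k / (8 * c)) ≤ Real.exp (-m.α * r / (24 * c)) := by
    intro k hk
    refine Real.exp_le_exp.2 ?_
    have hk' : (r : ℝ) ≤ 3 * k := by exact_mod_cast hk
    rw [div_le_div_iff₀ (by positivity) (by positivity)]
    nlinarith [mul_le_mul_of_nonneg_left hk' (by positivity : 0 ≤ m.α * c)]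
  rcases Nat.eq_zero_or_pos (r / 2) with h2 | h2
  · have hr1 : r = 1 := by lia
    rw [h2, localLoss_zero, sub_zero]
    obtain ⟨S', x', h', e⟩ := exists_localLoss_eq (m := m) hr.ne' h
    have a2 := loss_le_exp hm hs x'
    have a4 := loss_nonneg (m := m) x'
    rw [e, abs_of_nonneg a4]
    have a5 : Real.exp (-m.α / 4) ≤ Real.exp (-m.α * r / (24 * c)) := by
      refine Real.exp_le_exp.2 ?_
      rw [hr1, div_le_div_iff₀ (by norm_num) (by positivity)]
      push_cast
      nlinarith
    have := Real.exp_pos (-m.α / 4)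
    linarith
  · have a1 := abs_localLoss_sub_le hc hm hs hr.ne' h
    have a2 := abs_localLoss_sub_le hc hm hs h2.ne' (h.inter (Nat.div_le_self r 2))
    have a3 := mono r (by lia)
    have a4 := mono (r / 2) (by lia)
    rw [abs_le] at a1 a2 ⊢
    constructor <;> linarith

/-- Every pattern around `x` at an allowed scale is realised, by `S` itself, so the increments
telescope to `localLoss` at the largest scale, which is comparable to the size of the torus. -/
theorem abs_loss_sub_sum_le (x : S.V) :
    |S.loss m x - ∑ r ∈ scales S.size, localIncrement m r (S.pattern 0 x r)| ≤
      if S.bit 2 x = 1 then 8 * Real.exp (-m.α * S.size / (32 * c)) else 0 := by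
  have hα := hm.alpha_nonneg
  obtain ⟨K, hK, hle, hlt⟩ := exists_scales_eq S.size
  have hre : ∀ k < K, S.Realizes x (2 ^ k) (S.pattern 0 x (2 ^ k)) := fun k hk => ⟨hlt k hk, rfl⟩
  have htel : ∑ r ∈ scales S.size, localIncrement m r (S.pattern 0 x r) =
      localLoss m (2 ^ K / 2) (S.pattern 0 x (2 ^ K / 2)) := by
    rw [hK, Finset.sum_image fun a _ b _ h => Nat.pow_right_injective le_rfl h]
    -- Integer division gives radius zero, where `localLoss` is zero by convention; the telescoping
    -- sum starts there.
    have h0 : localLoss m (2 ^ 0 / 2) (S.pattern 0 x (2 ^ 0 / 2)) = 0 := localLoss_zero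
    rw [← sub_zero (localLoss m (2 ^ K / 2) _), ← h0,
      ← Finset.sum_range_sub fun k => localLoss m (2 ^ k / 2) (S.pattern 0 x (2 ^ k / 2))]
    refine Finset.sum_congr rfl fun k hk => ?_
    rw [localIncrement, if_pos ⟨S, x, hre k (Finset.mem_range.1 hk)⟩,
      pattern_inter (Nat.div_le_self _ _), pow_succ, Nat.mul_div_cancel _ two_pos]
  rw [htel]
  rcases K with _ | k
  · rw [pow_zero, Nat.div_eq_of_lt one_lt_two, localLoss_zero, sub_zero,
      abs_of_nonneg (loss_nonneg x)]
    split_ifs with hb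
    · have a5 : Real.exp (-m.α / 4) ≤ Real.exp (-m.α * S.size / (32 * c)) := by
        refine Real.exp_le_exp.2 ?_
        have h2 : (S.size : ℝ) ≤ 2 := by exact_mod_cast hle
        rw [div_le_div_iff₀ (by norm_num) (by positivity)]
        nlinarith [mul_le_mul_of_nonneg_left (by linarith : (S.size : ℝ) * 4 ≤ 32 * c) hα]
      have := loss_le_exp hm hs x
      have := Real.exp_pos (-m.α / 4)
      linarith
    · exact (loss_eq_zero hb).le
  · rw [pow_succ, Nat.mul_div_cancel _ two_pos]
    have hk := hre k k.lt_succ_self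
    have hk0 : 2 ^ k ≠ 0 := (Nat.two_pow_pos k).ne'
    split_ifs with hb
    · refine (abs_localLoss_sub_le hc hm hs hk0 hk).trans
        (mul_le_mul_of_nonneg_left (Real.exp_le_exp.2 ?_) (by norm_num))
      have h4 : (S.size : ℝ) ≤ 4 * (2 ^ k : ℕ) := by
        exact_mod_cast (by rw [pow_succ] at hle; lia : S.size ≤ 4 * 2 ^ k)
      rw [div_le_div_iff₀ (by positivity) (by positivity)]
      nlinarith [mul_le_mul_of_nonneg_left h4 (by positivity : 0 ≤ m.α * c)]
    -- The pattern shows whether a horizontal lozenge is based at the centre, so without one both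
    -- losses vanish exactly.
    · obtain ⟨S', x', h', e⟩ := exists_localLoss_eq (m := m) hk0 hk
      have hb' := bit_eq_of_pattern_eq (hk.2.trans h'.2.symm) 2 0
        (by rw [triDist_self]; exact_mod_cast Nat.two_pow_pos k)
      rw [map_zero, map_zero, add_zero, add_zero] at hb'
      rw [e, loss_eq_zero hb, loss_eq_zero (hb' ▸ hb), sub_zero, abs_zero]

/-- Errors occur only at the bases of horizontal lozenges. There are at most `size ^ 2` of them,
independently of the slope, and half of the exponential decay absorbs this factor. -/
theorem abs_sum_loss_sub_le (hα : 64 * c ≤ m.α) :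
    |∑ x, S.loss m x - ∑ x, ∑ r ∈ scales S.size, localIncrement m r (S.pattern 0 x r)| ≤
      16 * Real.exp (-m.α * S.size / (64 * c)) := by
  rw [← Finset.sum_sub_distrib]
  refine (Finset.abs_sum_le_sum_abs _ _).trans
    ((Finset.sum_le_sum fun x _ => abs_loss_sub_sum_le hc hm hs x).trans ?_)
  rw [← Finset.sum_filter, Finset.sum_const, nsmul_eq_mul]
  have h1 : ((Finset.univ.filter fun x => S.bit 2 x = 1).card : ℝ) ≤ (S.size : ℝ) ^ 2 := by
    exact_mod_cast S.card_bit_two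
  have h2 := Real.pow_div_factorial_le_exp (S.size : ℝ) (Nat.cast_nonneg _) 2
  have h3 : ((Finset.univ.filter fun x => S.bit 2 x = 1).card : ℝ) ≤ 2 * Real.exp S.size := by
    norm_num [Nat.factorial] at h2
    linarith
  have h4 : Real.exp S.size * Real.exp (-m.α * S.size / (32 * c)) ≤
      Real.exp (-m.α * S.size / (64 * c)) := by
    rw [← Real.exp_add]
    refine Real.exp_le_exp.2 ?_
    have e : -m.α * S.size / (32 * c) = -m.α * S.size / (64 * c) - m.α / (64 * c) * S.size := by
      field_simp
      ring
    have h5 : 1 ≤ m.α / (64 * c) := by rwa [le_div_iff₀ (by positivity), one_mul]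
    rw [e]
    nlinarith [mul_le_mul_of_nonneg_right h5 (Nat.cast_nonneg (α := ℝ) S.size)]
  calc _ ≤ 2 * Real.exp S.size * (8 * Real.exp (-m.α * S.size / (32 * c))) := by gcongr
    _ = 16 * (Real.exp S.size * Real.exp (-m.α * S.size / (32 * c))) := by ring
    _ ≤ _ := by gcongr

end Bounds

/-- The free energy is a sum of exponentially decaying local functions. -/
theorem exists_local_expansion (c : ℝ) (hc : 6 ≤ c) : ∃ A : ℝ, ∀ α, A ≤ α →
    ∀ g : ℕ → Set Lozenge → ℝ, (∀ r T, |g r T| ≤ c * Real.exp (-α * r / c)) →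
    ∃ g' : ℕ → Set Lozenge → ℝ, (∀ r T, |g' r T| ≤ 64 * c * Real.exp (-α * r / (64 * c))) ∧
      ∀ S : LozengeTorus,
        |S.freeEnergy α g - ∑ x, ∑ r ∈ scales S.size, g' r (S.pattern 0 x r)| ≤
          64 * c * Real.exp (-α * S.size / (64 * c)) := by
  obtain ⟨A, hA⟩ := exists_small c hc
  refine ⟨A, fun α hα g hg => ?_⟩
  obtain ⟨h, hα'⟩ := hA α hα
  obtain ⟨hm, hs⟩ := h g hg
  have hα0 : 0 ≤ α := by linarith
  refine ⟨localIncrement (decayPotential c α g hg), fun r T => ?_, fun S => ?_⟩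
  · refine (abs_localIncrement_le hc hm hs r T).trans ?_
    refine mul_le_mul (by linarith) (Real.exp_le_exp.2 ?_) (Real.exp_pos _).le (by linarith)
    change -α * r / (24 * c) ≤ -α * r / (64 * c)
    rw [div_le_div_iff₀ (by positivity) (by positivity)]
    nlinarith [(by positivity : 0 ≤ α * r * c)]
  -- Setting the potential to zero at radius 0, where it would not be small, changes nothing: all
  -- scales are powers of two.
  · have e : S.freeEnergy α g = S.freeEnergy (decayPotential c α g hg).α
        (decayPotential c α g hg).g := by
      rw [freeEnergy, freeEnergy]
      congr 1
      refine Finset.sum_congr rfl fun Δ _ => ?_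
      congr 2
      refine Finset.sum_congr rfl fun x _ => Finset.sum_congr rfl fun r hr => ?_
      obtain ⟨k, rfl⟩ := (mem_scales.1 hr).1
      simp [decayPotential]
    rw [e, freeEnergy_eq_sum_loss hm]
    refine (abs_sum_loss_sub_le hc hm hs hα').trans ?_
    exact mul_le_mul_of_nonneg_right (by linarith) (Real.exp_pos _).le

/-! ### Heights along the direction `(1, 1, 1)` -/

theorem int_eq_of_forall_lt_iff {a b : ℤ} (h : ∀ k, k < a ↔ k < b) : a = b := by
  have := h a
  have := h b
  lia

theorem exists_threshold {p : ℤ → Prop} (hp : ∀ j k, j ≤ k → p k → p j) {a b : ℤ} (ha : p a)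
    (hb : ¬ p b) : ∃ n, ∀ k, p k ↔ k < n := by
  obtain ⟨n, hn, hmin⟩ := Int.exists_least_of_bdd (P := fun k => ¬ p k)
    ⟨a, fun k hk => (le_of_not_ge fun h => hk (hp _ _ h ha))⟩ ⟨b, hb⟩
  exact ⟨n, fun k => ⟨fun hk => lt_of_not_ge fun h => hn (hp _ _ h hk),
    fun hk => by_contra fun h => absurd (hmin k h) (not_le.2 hk)⟩⟩

variable {θ : ℝ × ℝ} {N : ℕ}

/-- Along the diagonal the height does not increase while `k` does, so the inequality holds exactly
below some threshold. -/
theorem Tiling.exists_level (φ : Tiling θ N) (v : ℤ × ℤ) :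
    ∃ n, ∀ k, k < φ.height (v.1 + k, v.2 + k) ↔ k < n := by
  have hanti : ∀ j k, j ≤ k → φ.height (v.1 + k, v.2 + k) ≤ φ.height (v.1 + j, v.2 + j) :=
    fun j k h => φ.antitone (Prod.mk_le_mk.2 ⟨by lia, by lia⟩)
  refine exists_threshold (a := min (φ.height (v.1 + 0, v.2 + 0)) 0 - 1)
    (b := max (φ.height (v.1 + 0, v.2 + 0)) 0) (fun j k h hk => ?_) ?_ ?_
  · have := hanti j k h
    lia
  · have := hanti (min (φ.height (v.1 + 0, v.2 + 0)) 0 - 1) 0 (by lia)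
    lia
  · have := hanti 0 (max (φ.height (v.1 + 0, v.2 + 0)) 0) (by lia)
    lia

/-- The height, along the direction `(1, 1, 1)`, of the surface over a vertex of the triangular
lattice. -/
def Tiling.level (φ : Tiling θ N) (v : ℤ × ℤ) : ℤ := (φ.exists_level v).choose

theorem Tiling.lt_level (φ : Tiling θ N) (v : ℤ × ℤ) (k : ℤ) :
    k < φ.height (v.1 + k, v.2 + k) ↔ k < φ.level v := (φ.exists_level v).choose_spec k

theorem Tiling.lt_height (φ : Tiling θ N) (x y k : ℤ) :
    k < φ.height (x, y) ↔ k < φ.level (x - k, y - k) := by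
  rw [← φ.lt_level]
  simp

/-- The indicator of the lozenges, in terms of the heights of the vertices. -/
def levelBit (H : ℤ × ℤ → ℤ) (i : Fin 3) (v : ℤ × ℤ) : ℤ :=
  H (v - unitVec i) + (if i = 2 then 1 else 0) - H v

theorem levelBit_zero (H : ℤ × ℤ → ℤ) (a b : ℤ) : levelBit H 0 (a, b) = H (a - 1, b) - H (a, b) := by
  simp [levelBit, unitVec]

theorem levelBit_one (H : ℤ × ℤ → ℤ) (a b : ℤ) : levelBit H 1 (a, b) = H (a, b - 1) - H (a, b) := by
  simp [levelBit, unitVec]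

theorem levelBit_two (H : ℤ × ℤ → ℤ) (a b : ℤ) :
    levelBit H 2 (a, b) = H (a + 1, b + 1) + 1 - H (a, b) := by
  simp [levelBit, unitVec]

/-- The general period of the torus. -/
def period (θ : ℝ × ℝ) (N : ℕ) (a b : ℤ) : ℤ × ℤ :=
  (a * (N + ⌊θ.1 * N⌋) + b * ⌊θ.2 * N⌋, a * ⌊θ.1 * N⌋ + b * (N + ⌊θ.2 * N⌋))

theorem mem_periodLattice {p : ℤ × ℤ} : p ∈ periodLattice θ N ↔ ∃ a b, p = period θ N a b := by
  rw [periodLattice, AddSubgroup.mem_closure_pair]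
  refine exists_congr fun a => exists_congr fun b => ?_
  rw [eq_comm]
  simp [period]

/-- The functions that are heights of tilings. -/
structure IsLevel (θ : ℝ × ℝ) (N : ℕ) (H : ℤ × ℤ → ℤ) : Prop where
  bit_nonneg : ∀ i v, 0 ≤ levelBit H i v
  bit_le_one : ∀ i v, levelBit H i v ≤ 1
  add_period : ∀ v a b, H (v + period θ N a b) = H v - a * ⌊θ.1 * N⌋ - b * ⌊θ.2 * N⌋

theorem Tiling.level_add_period (φ : Tiling θ N) (v : ℤ × ℤ) (a b : ℤ) :
    φ.level (v + period θ N a b) = φ.level v - a * ⌊θ.1 * N⌋ - b * ⌊θ.2 * N⌋ := by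
  refine int_eq_of_forall_lt_iff fun k => ?_
  rw [← φ.lt_level]
  have h := φ.height_add a b (v.1 + (k + a * ⌊θ.1 * N⌋ + b * ⌊θ.2 * N⌋))
    (v.2 + (k + a * ⌊θ.1 * N⌋ + b * ⌊θ.2 * N⌋))
  have h' := φ.lt_level v (k + a * ⌊θ.1 * N⌋ + b * ⌊θ.2 * N⌋)
  have e : ((v + period θ N a b).1 + k, (v + period θ N a b).2 + k) =
      (v.1 + (k + a * ⌊θ.1 * N⌋ + b * ⌊θ.2 * N⌋) + a * N,
        v.2 + (k + a * ⌊θ.1 * N⌋ + b * ⌊θ.2 * N⌋) + b * N) := by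
    simp only [period, Prod.fst_add, Prod.snd_add]
    refine Prod.ext ?_ ?_ <;> simp only <;> ring
  rw [e, h]
  constructor
  · intro hk
    have := h'.1 (by linarith)
    linarith
  · intro hk
    have := h'.2 (by linarith)
    linarith

theorem Tiling.level_bits (φ : Tiling θ N) (a b : ℤ) :
    (φ.level (a, b) ≤ φ.level (a - 1, b) ∧ φ.level (a - 1, b) ≤ φ.level (a, b) + 1) ∧
    (φ.level (a, b) ≤ φ.level (a, b - 1) ∧ φ.level (a, b - 1) ≤ φ.level (a, b) + 1) ∧
    (φ.level (a + 1, b + 1) ≤ φ.level (a, b) ∧ φ.level (a, b) ≤ φ.level (a + 1, b + 1) + 1) := by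
  have anti : ∀ x y x' y', x ≤ x' → y ≤ y' → φ.height (x', y') ≤ φ.height (x, y) :=
    fun x y x' y' h h' => φ.antitone (Prod.mk_le_mk.2 ⟨h, h'⟩)
  have mono : ∀ x y x' y', x ≤ x' → y ≤ y' → φ.level (x', y') ≤ φ.level (x, y) := by
    intro x y x' y' h h'
    by_contra! hlt
    have h1 := (φ.lt_level (x', y') _).2 hlt
    have h2 := mt (φ.lt_level (x, y) (φ.level (x, y))).1 (lt_irrefl _)
    have := anti (x + φ.level (x, y)) (y + φ.level (x, y)) (x' + φ.level (x, y))
      (y' + φ.level (x, y)) (by lia) (by lia)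
    simp only at h1 h2
    lia
  have up : φ.level (a - 1, b - 1) ≤ φ.level (a, b) + 1 := by
    by_contra! hlt
    have h1 := (φ.lt_level (a - 1, b - 1) _).2 hlt
    have h2 := mt (φ.lt_level (a, b) (φ.level (a, b))).1 (lt_irrefl _)
    simp only at h1 h2
    rw [show a - 1 + (φ.level (a, b) + 1) = a + φ.level (a, b) by ring,
      show b - 1 + (φ.level (a, b) + 1) = b + φ.level (a, b) by ring] at h1
    lia
  have up' : φ.level (a, b) ≤ φ.level (a + 1, b + 1) + 1 := by
    by_contra! hlt
    have h1 := (φ.lt_level (a, b) _).2 hlt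
    have h2 := mt (φ.lt_level (a + 1, b + 1) (φ.level (a + 1, b + 1))).1 (lt_irrefl _)
    simp only at h1 h2
    rw [show a + (φ.level (a + 1, b + 1) + 1) = a + 1 + φ.level (a + 1, b + 1) by ring,
      show b + (φ.level (a + 1, b + 1) + 1) = b + 1 + φ.level (a + 1, b + 1) by ring] at h1
    lia
  have m1 := mono (a - 1) (b - 1) (a - 1) b le_rfl (by lia)
  have m2 := mono (a - 1) (b - 1) a (b - 1) (by lia) le_rfl
  exact ⟨⟨mono _ _ _ _ (by lia) le_rfl, by lia⟩, ⟨mono _ _ _ _ le_rfl (by lia), by lia⟩,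
    mono _ _ _ _ (by lia) (by lia), up'⟩

theorem Tiling.isLevel (φ : Tiling θ N) : IsLevel θ N φ.level where
  bit_nonneg i v := by
    obtain ⟨a, b⟩ := v
    have h := φ.level_bits a b
    fin_cases i
    · rw [Fin.zero_eta, levelBit_zero]; lia
    · rw [Fin.mk_one, levelBit_one]; lia
    · rw [show (⟨2, by lia⟩ : Fin 3) = 2 from rfl, levelBit_two]; lia
  bit_le_one i v := by
    obtain ⟨a, b⟩ := v
    have h := φ.level_bits a b
    fin_cases i
    · rw [Fin.zero_eta, levelBit_zero]; lia
    · rw [Fin.mk_one, levelBit_one]; lia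
    · rw [show (⟨2, by lia⟩ : Fin 3) = 2 from rfl, levelBit_two]; lia
  add_period := φ.level_add_period

theorem Tiling.level_injective : Function.Injective (Tiling.level : Tiling θ N → ℤ × ℤ → ℤ) := by
  intro φ ψ h
  have e : φ.height = ψ.height := by
    funext ⟨x, y⟩
    refine int_eq_of_forall_lt_iff fun k => ?_
    rw [φ.lt_height, ψ.lt_height, h]
  rcases φ with ⟨⟨a, _, _⟩, _⟩
  rcases ψ with ⟨⟨b, _, _⟩, _⟩
  simp only at e
  subst e
  rfl

/-- By monotonicity the conditions on a face become comparisons of two heights with `z`, hence of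
the levels at the two ends of the short diagonal. `level_bits` allows only two values for each
difference. -/
theorem Tiling.mem_faces_iff (φ : Tiling θ N) (f : Plaquette) :
    f ∈ φ.faces ↔ φ.level f.proj = f.z ∧ levelBit φ.level f.dir f.proj = 1 := by
  obtain ⟨i, x, y, z⟩ := f
  have b := φ.level_bits (x - z) (y - z)
  have h0 := φ.lt_height x y z
  simp only [Plaquette.proj, Surface.faces, Set.mem_ofPred_eq]
  have a1 : φ.height (x, y) ≤ φ.height (x - 1, y) :=
    φ.antitone (Prod.mk_le_mk.2 ⟨by lia, le_rfl⟩)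
  have a2 : φ.height (x, y) ≤ φ.height (x, y - 1) :=
    φ.antitone (Prod.mk_le_mk.2 ⟨le_rfl, by lia⟩)
  rw [min_eq_right a1, max_eq_left a1, min_eq_right a2, max_eq_left a2]
  fin_cases i
  · have h1 := φ.lt_height (x - 1) y z
    rw [show x - 1 - z = x - z - 1 by ring] at h1
    simp [levelBit_zero]
    lia
  · have h1 := φ.lt_height x (y - 1) z
    rw [show y - 1 - z = y - z - 1 by ring] at h1
    simp [levelBit_one]
    lia
  · have h1 := φ.lt_height x y (z - 1)
    rw [show x - (z - 1) = x - z + 1 by ring, show y - (z - 1) = y - z + 1 by ring] at h1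
    simp [levelBit_two]
    lia

theorem Tiling.mem_lozenges_iff (φ : Tiling θ N) (l : Lozenge) :
    l ∈ φ.lozenges ↔ levelBit φ.level l.dir l.base = 1 := by
  constructor
  · rintro ⟨f, hf, rfl⟩
    exact ((φ.mem_faces_iff f).1 hf).2
  · intro h
    have e : (⟨l.dir, l.base.1 + φ.level l.base, l.base.2 + φ.level l.base,
        φ.level l.base⟩ : Plaquette).proj = l.base := by simp [Plaquette.proj]
    exact ⟨⟨l.dir, l.base.1 + φ.level l.base, l.base.2 + φ.level l.base, φ.level l.base⟩,
      (φ.mem_faces_iff _).2 ⟨by rw [e], by rw [e]; exact h⟩, Lozenge.ext rfl e⟩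

namespace IsLevel

variable {H : ℤ × ℤ → ℤ} (hH : IsLevel θ N H)

include hH

theorem succ_le (a b : ℤ) : H (a + 1, b) ≤ H (a, b) ∧ H (a, b + 1) ≤ H (a, b) ∧
    H (a, b) ≤ H (a + 1, b + 1) + 1 := by
  have h0 := hH.bit_nonneg 0 (a + 1, b)
  have h1 := hH.bit_nonneg 1 (a, b + 1)
  have h2 := hH.bit_nonneg 2 (a, b)
  rw [levelBit_zero, add_sub_cancel_right] at h0
  rw [levelBit_one, add_sub_cancel_right] at h1
  rw [levelBit_two] at h2
  lia

theorem le_of_le {x y x' y' : ℤ} (hx : x ≤ x') (hy : y ≤ y') : H (x', y') ≤ H (x, y) := by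
  have h1 : Antitone fun x => H (x, y') := antitone_int_of_succ_le fun x => (hH.succ_le x y').1
  have h2 : Antitone fun y => H (x, y) := antitone_int_of_succ_le fun y => (hH.succ_le x y).2.1
  exact (h1 hx).trans (h2 hy)

theorem diag (v : ℤ × ℤ) (n : ℤ) :
    H (v.1 + n * (N + ⌊θ.1 * N⌋ + ⌊θ.2 * N⌋), v.2 + n * (N + ⌊θ.1 * N⌋ + ⌊θ.2 * N⌋)) =
      H v - n * (⌊θ.1 * N⌋ + ⌊θ.2 * N⌋) := by
  have h := hH.add_period v n n
  rw [show H v - n * (⌊θ.1 * N⌋ + ⌊θ.2 * N⌋) = H v - n * ⌊θ.1 * N⌋ - n * ⌊θ.2 * N⌋ by ring, ← h]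
  congr 1
  refine Prod.ext ?_ ?_ <;> simp [period] <;> ring

/-- The function `k - H (x - k, y - k)` is monotone, and by `diag` it gains exactly `N` over a
diagonal period, so it takes both signs. -/
theorem exists_height (hN : 1 ≤ N) (x y : ℤ) : ∃ n, ∀ k, k < H (x - k, y - k) ↔ k < n := by
  have hN' : (1 : ℤ) ≤ N := by exact_mod_cast hN
  have hmono : Monotone fun k => k - H (x - k, y - k) := by
    refine monotone_int_of_le_succ fun k => ?_
    have h := (hH.succ_le (x - (k + 1)) (y - (k + 1))).2.2
    rw [show x - (k + 1) + 1 = x - k by ring, show y - (k + 1) + 1 = y - k by ring] at h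
    lia
  set n := |H (x, y)| with hn
  have hle := abs_le.1 (hn ▸ le_refl n : |H (x, y)| ≤ n)
  set L : ℤ := N + ⌊θ.1 * N⌋ + ⌊θ.2 * N⌋ with hL
  refine exists_threshold (a := -(n + 1) * L) (b := n * L) (fun j k h hk => ?_) ?_ ?_
  · have := hmono h
    simp only at this
    lia
  · have d := hH.diag (x, y) (n + 1)
    rw [← hL] at d
    simp only at d
    rw [show x - -(n + 1) * L = x + (n + 1) * L by ring,
      show y - -(n + 1) * L = y + (n + 1) * L by ring, d, hL]
    nlinarith
  · have d := hH.diag (x, y) (-n)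
    rw [← hL] at d
    simp only at d
    rw [show x - n * L = x + -n * L by ring, show y - n * L = y + -n * L by ring, d, hL]
    nlinarith

theorem exists_tiling (hN : 1 ≤ N) : ∃ φ : Tiling θ N, φ.level = H := by
  choose h hh using fun p : ℤ × ℤ => hH.exists_height hN p.1 p.2
  have hper : ∀ a b x y, h (x + a * N, y + b * N) = h (x, y) - a * ⌊θ.1 * N⌋ - b * ⌊θ.2 * N⌋ := by
    intro a b x y
    refine int_eq_of_forall_lt_iff fun k => ?_
    rw [← hh]
    have h1 := hh (x, y) (k + a * ⌊θ.1 * N⌋ + b * ⌊θ.2 * N⌋)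
    have h2 := hH.add_period (x - (k + a * ⌊θ.1 * N⌋ + b * ⌊θ.2 * N⌋),
      y - (k + a * ⌊θ.1 * N⌋ + b * ⌊θ.2 * N⌋)) a b
    have e : (x - (k + a * ⌊θ.1 * N⌋ + b * ⌊θ.2 * N⌋), y - (k + a * ⌊θ.1 * N⌋ + b * ⌊θ.2 * N⌋)) +
        period θ N a b = (x + a * N - k, y + b * N - k) := by
      refine Prod.ext ?_ ?_ <;> simp [period] <;> ring
    rw [e] at h2
    simp only at h1 h2 ⊢
    rw [h2]
    constructor
    · intro hk
      have := h1.1 (by linarith)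
      linarith
    · intro hk
      have := h1.2 (by linarith)
      linarith
  refine ⟨⟨⟨h, fun x y => by simpa using hper 1 0 x y, fun x y => by simpa using hper 0 1 x y⟩, ?_⟩,
    ?_⟩
  · rintro ⟨x, y⟩ ⟨x', y'⟩ hle
    obtain ⟨hx, hy⟩ := Prod.mk_le_mk.1 hle
    by_contra! hlt
    have h1 := (hh (x', y') _).2 hlt
    have h2 := mt (hh (x, y) (h (x, y))).1 (lt_irrefl _)
    simp only at h1 h2
    have := hH.le_of_le (sub_le_sub_right hx (h (x, y))) (sub_le_sub_right hy (h (x, y)))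
    lia
  · funext v
    refine int_eq_of_forall_lt_iff fun k => ?_
    rw [← Tiling.lt_level]
    have := hh (v.1 + k, v.2 + k) k
    simpa using this.symm

end IsLevel

/-! ### The torus of a tiling -/

variable {θ : ℝ × ℝ} {N : ℕ}

theorem IsLevel.levelBit_add_period {H : ℤ × ℤ → ℤ} (hH : IsLevel θ N H) (i : Fin 3) (v : ℤ × ℤ)
    (a b : ℤ) : levelBit H i (v + period θ N a b) = levelBit H i v := by
  have e : v + period θ N a b - unitVec i = v - unitVec i + period θ N a b := by abel
  rw [levelBit, levelBit, e, hH.add_period, hH.add_period]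
  ring

theorem exists_out_eq (v : ℤ × ℤ) : ∃ a b, v =
    Quotient.out (QuotientAddGroup.mk v : TorusVertex θ N) + period θ N a b := by
  have h : (QuotientAddGroup.mk (Quotient.out (QuotientAddGroup.mk v : TorusVertex θ N)) :
      TorusVertex θ N) = QuotientAddGroup.mk v := QuotientAddGroup.out_eq' _
  obtain ⟨a, b, e⟩ := mem_periodLattice.1 (QuotientAddGroup.eq.1 h)
  exact ⟨a, b, by rw [← e]; abel⟩

theorem Tiling.levelBit_out (φ : Tiling θ N) (i : Fin 3) (v : ℤ × ℤ) :
    levelBit φ.level i (Quotient.out (QuotientAddGroup.mk v : TorusVertex θ N)) =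
      levelBit φ.level i v := by
  obtain ⟨a, b, e⟩ := exists_out_eq (θ := θ) (N := N) v
  conv_rhs => rw [e, φ.isLevel.levelBit_add_period]

/-- The difference of the heights of two tilings, on the torus. -/
def levelDiff (φ ψ : Tiling θ N) (c : TorusVertex θ N) : ℤ :=
  ψ.level (Quotient.out c) - φ.level (Quotient.out c)

theorem levelDiff_mk (φ ψ : Tiling θ N) (v : ℤ × ℤ) :
    levelDiff φ ψ (QuotientAddGroup.mk v) = ψ.level v - φ.level v := by
  obtain ⟨a, b, e⟩ := exists_out_eq (θ := θ) (N := N) v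
  conv_rhs => rw [e, φ.level_add_period, ψ.level_add_period]
  rw [levelDiff]
  ring

/-- The faces of the tiling, one from each orbit. -/
def Tiling.window (φ : Tiling θ N) : Set Plaquette :=
  {f ∈ φ.faces | 0 ≤ f.x ∧ f.x < N ∧ 0 ≤ f.y ∧ f.y < N}

/-- The class of a plaquette on the torus. -/
def Plaquette.toTorus (θ : ℝ × ℝ) (N : ℕ) (f : Plaquette) : Fin 3 × TorusVertex θ N :=
  (f.dir, QuotientAddGroup.mk f.proj)

theorem eq_zero_of_mem_window {x a : ℤ} (h0 : 0 ≤ x) (h1 : x < N) (h0' : 0 ≤ x + a * N)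
    (h1' : x + a * N < N) : a = 0 := by
  by_contra h
  rcases lt_or_gt_of_ne h with h | h <;> nlinarith

/-- The level recovers `z` from the projection, so two faces with the same class differ by a period
of `ℤ³`, and within one window that period is zero. -/
theorem Tiling.injOn_toTorus (φ : Tiling θ N) :
    Set.InjOn (Plaquette.toTorus θ N) φ.window := by
  rintro f ⟨hf, hx, hx', hy, hy'⟩ f' ⟨hf', kx, kx', ky, ky'⟩ e
  obtain ⟨e1, e2⟩ := Prod.mk.inj e
  obtain ⟨a, b, e3⟩ := mem_periodLattice.1 (QuotientAddGroup.eq.1 e2)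
  have e4 : f'.proj = f.proj + period θ N a b := by rw [← e3]; abel
  have z := ((φ.mem_faces_iff f).1 hf).1
  have z' := ((φ.mem_faces_iff f').1 hf').1
  rw [e4, φ.level_add_period, z] at z'
  have p1 := congrArg Prod.fst e4
  have p2 := congrArg Prod.snd e4
  simp only [Plaquette.proj, period, Prod.fst_add, Prod.snd_add] at p1 p2
  have x' : f'.x = f.x + a * N := by linarith
  have y' : f'.y = f.y + b * N := by linarith
  obtain rfl := eq_zero_of_mem_window hx hx' (x' ▸ kx) (x' ▸ kx')
  obtain rfl := eq_zero_of_mem_window hy hy' (y' ▸ ky) (y' ▸ ky')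
  refine Plaquette.ext e1 ?_ ?_ ?_ <;> linarith

theorem Tiling.image_toTorus (φ : Tiling θ N) (hN : 1 ≤ N) (Q : Fin 3 × TorusVertex θ N → Prop) :
    Plaquette.toTorus θ N '' {f ∈ φ.window | Q (f.toTorus θ N)} =
      {p | levelBit φ.level p.1 (Quotient.out p.2) = 1 ∧ Q p} := by
  have hN' : (0 : ℤ) < N := by exact_mod_cast hN
  ext p
  constructor
  · rintro ⟨f, ⟨⟨hf, -⟩, hQ⟩, rfl⟩
    exact ⟨(φ.levelBit_out _ _).trans ((φ.mem_faces_iff f).1 hf).2, hQ⟩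
  · rintro ⟨hp, hQ⟩
    set v := Quotient.out p.2 with hv
    have hv' : QuotientAddGroup.mk v = p.2 := QuotientAddGroup.out_eq' _
    let f : Plaquette := ⟨p.1, v.1 + φ.level v, v.2 + φ.level v, φ.level v⟩
    have hproj : f.proj = v := by simp [f, Plaquette.proj]
    have hf : f ∈ φ.faces := (φ.mem_faces_iff f).2 ⟨by rw [hproj], by rw [hproj]; exact hp⟩
    have hf' := (φ.mem_faces_add (-(f.x / N)) (-(f.y / N)) f).2 hf
    refine ⟨_, ⟨⟨hf', ?_⟩, ?_⟩, ?_⟩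
    · have ex : f.x + -(f.x / N) * N = f.x % N := by
        have := Int.emod_add_ediv_mul f.x N; linarith
      have ey : f.y + -(f.y / N) * N = f.y % N := by
        have := Int.emod_add_ediv_mul f.y N; linarith
      simp only [ex, ey]
      exact ⟨Int.emod_nonneg _ hN'.ne', Int.emod_lt_of_pos _ hN', Int.emod_nonneg _ hN'.ne',
        Int.emod_lt_of_pos _ hN'⟩
    all_goals
      have e : Plaquette.toTorus θ N ⟨f.dir, f.x + -(f.x / N) * N, f.y + -(f.y / N) * N,
          f.z - -(f.x / N) * ⌊θ.1 * N⌋ - -(f.y / N) * ⌊θ.2 * N⌋⟩ = p := by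
        refine Prod.ext rfl ?_
        rw [← hv', ← hproj]
        refine (QuotientAddGroup.eq.2 (mem_periodLattice.2
          ⟨-(f.x / N), -(f.y / N), ?_⟩)).symm
        refine Prod.ext ?_ ?_ <;> simp only [Plaquette.proj, period, Prod.fst_add, Prod.snd_add,
          Prod.fst_neg, Prod.snd_neg] <;> ring
    · rw [e]; exact hQ
    · exact e

theorem Tiling.ncard_window (φ : Tiling θ N) (hN : 1 ≤ N) (Q : Fin 3 × TorusVertex θ N → Prop) :
    {f ∈ φ.window | Q (f.toTorus θ N)}.ncard =
      {p | levelBit φ.level p.1 (Quotient.out p.2) = 1 ∧ Q p}.ncard := by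
  rw [← φ.image_toTorus hN]
  exact (Set.InjOn.ncard_image (φ.injOn_toTorus.mono fun f hf => hf.1)).symm

theorem Tiling.finite_window (φ : Tiling θ N) (h₁ : 0 < θ.1) (h₂ : 0 < θ.2) (hN : 1 ≤ N) :
    φ.window.Finite :=
  have := finite_torusVertex h₁ h₂ hN
  Set.Finite.of_finite_image (Set.toFinite _) φ.injOn_toTorus

/-- There is one horizontal face over each square of the window. This bound is uniform in the slope,
unlike the number of vertices of the torus. -/
theorem Tiling.ncard_horizontal_le (φ : Tiling θ N) (hN : 1 ≤ N) :
    {c : TorusVertex θ N | levelBit φ.level 2 (Quotient.out c) = 1}.ncard ≤ N ^ 2 := by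
  have h := φ.ncard_window hN fun p => p.1 = 2
  have e : {p : Fin 3 × TorusVertex θ N | levelBit φ.level p.1 (Quotient.out p.2) = 1 ∧ p.1 = 2} =
      (fun c => ((2 : Fin 3), c)) '' {c : TorusVertex θ N | levelBit φ.level 2 (Quotient.out c) = 1} := by
    ext ⟨i, c⟩
    constructor
    · rintro ⟨h1, rfl⟩
      exact ⟨c, h1, rfl⟩
    · rintro ⟨c', h1, h2⟩
      obtain ⟨rfl, rfl⟩ := Prod.mk.inj h2
      exact ⟨h1, rfl⟩
  rw [e, Set.ncard_image_of_injective _ (Prod.mk_right_injective _)] at h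
  rw [← h]
  have hsub : {f ∈ φ.window | (f.toTorus θ N).1 = 2} ⊆
      ((Finset.range N ×ˢ Finset.range N).image fun q : ℕ × ℕ =>
        (⟨2, q.1, q.2, φ.height (q.1, q.2)⟩ : Plaquette) : Finset Plaquette) := by
    rintro ⟨i, x, y, z⟩ ⟨⟨hf, hx, hx', hy, hy'⟩, hi⟩
    simp only [Plaquette.toTorus] at hi hx hx' hy hy'
    subst hi
    have hz : z = φ.height (x, y) := by simpa [Surface.faces] using hf
    lift x to ℕ using hx
    lift y to ℕ using hy
    refine Finset.mem_coe.2 (Finset.mem_image.2 ⟨(x, y), ?_, ?_⟩)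
    · simp only [Finset.mem_product, Finset.mem_range]
      exact ⟨by exact_mod_cast hx', by exact_mod_cast hy'⟩
    · simp [hz]
  refine (Set.ncard_le_ncard hsub (Finset.finite_toSet _)).trans ?_
  rw [Set.ncard_coe_finset]
  refine Finset.card_image_le.trans (le_of_eq ?_)
  rw [Finset.card_product, Finset.card_range, sq]

/-- For the period with coefficients `a`, `b`, the difference of the coordinates is `(a - b) * N`.
If `a = b`, both coordinates are `a` times a number that is at least `N`. -/
theorem le_triDist_of_mem_periodLattice (h₁ : 0 < θ.1) (h₂ : 0 < θ.2) {v : ℤ × ℤ}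
    (hv : v ∈ periodLattice θ N) (h0 : v ≠ 0) : (N : ℤ) ≤ triDist v 0 := by
  obtain ⟨a, b, rfl⟩ := mem_periodLattice.1 hv
  have k₁ : (0 : ℤ) ≤ ⌊θ.1 * N⌋ := Int.floor_nonneg.2 (by positivity)
  have k₂ : (0 : ℤ) ≤ ⌊θ.2 * N⌋ := Int.floor_nonneg.2 (by positivity)
  have kN : (0 : ℤ) ≤ N := Nat.cast_nonneg N
  simp only [triDist, Prod.fst_zero, Prod.snd_zero, sub_zero]
  by_cases hab : a = b
  · subst hab
    have ha : a ≠ 0 := by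
      rintro rfl
      exact h0 (by simp [period])
    refine le_max_of_le_left (le_max_of_le_left ?_)
    have e : (period θ N a a).1 = a * (N + ⌊θ.1 * N⌋ + ⌊θ.2 * N⌋) := by simp [period]; ring
    rw [e, abs_mul, abs_of_nonneg (by positivity : (0 : ℤ) ≤ N + ⌊θ.1 * N⌋ + ⌊θ.2 * N⌋)]
    have := Int.one_le_abs ha
    nlinarith
  · refine le_max_of_le_right ?_
    have e : (period θ N a b).1 - (period θ N a b).2 = (a - b) * N := by simp [period]; ring
    rw [e, abs_mul, abs_of_nonneg kN]
    have := Int.one_le_abs (sub_ne_zero.2 hab)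
    nlinarith

/-- Without horizontal lozenges the level drops by one at every diagonal step. Over a diagonal
period it would then drop by `N` more than periodicity permits. -/
theorem Tiling.exists_levelBit_two (φ : Tiling θ N) (h₁ : 0 < θ.1) (h₂ : 0 < θ.2) (hN : 1 ≤ N)
    (v : ℤ × ℤ) : ∃ n : ℕ, levelBit φ.level 2 (v.1 + n, v.2 + n) = 1 := by
  by_contra! hcon
  have hbit : ∀ n : ℕ, levelBit φ.level 2 (v.1 + n, v.2 + n) = 0 := fun n => by
    have := φ.isLevel.bit_nonneg 2 (v.1 + n, v.2 + n)
    have := φ.isLevel.bit_le_one 2 (v.1 + n, v.2 + n)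
    have := hcon n
    lia
  have hlev : ∀ n : ℕ, φ.level (v.1 + n, v.2 + n) = φ.level v - n := by
    intro n
    induction n with
    | zero => simp
    | succ n ih =>
      have := hbit n
      rw [levelBit_two, ih] at this
      push_cast
      rw [← add_assoc, ← add_assoc]
      linarith
  have k₁ : (0 : ℤ) ≤ ⌊θ.1 * N⌋ := Int.floor_nonneg.2 (by positivity)
  have k₂ : (0 : ℤ) ≤ ⌊θ.2 * N⌋ := Int.floor_nonneg.2 (by positivity)
  have d := φ.isLevel.diag v 1
  obtain ⟨n, hn⟩ := Int.eq_ofNat_of_zero_le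
    (by positivity : (0 : ℤ) ≤ N + ⌊θ.1 * N⌋ + ⌊θ.2 * N⌋)
  rw [one_mul, hn, hlev n] at d
  lia

/-- The torus with the lozenges of the tiling. -/
def Tiling.torus (φ : Tiling θ N) (h₁ : 0 < θ.1) (h₂ : 0 < θ.2) (hN : 1 ≤ N) : LozengeTorus where
  V := TorusVertex θ N
  fin := @Fintype.ofFinite _ (finite_torusVertex h₁ h₂ hN)
  size := N
  proj := QuotientAddGroup.mk' _
  proj_surj := QuotientAddGroup.mk_surjective
  systole v hv h0 := le_triDist_of_mem_periodLattice h₁ h₂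
    ((QuotientAddGroup.eq_zero_iff v).1 hv) h0
  bit i c := levelBit φ.level i (Quotient.out c)
  bit_nonneg i c := φ.isLevel.bit_nonneg i _
  bit_le_one i c := φ.isLevel.bit_le_one i _
  triangle c := by
    obtain ⟨⟨a, b⟩, rfl⟩ := QuotientAddGroup.mk_surjective c
    have e0 : levelBit φ.level 0 (Quotient.out (QuotientAddGroup.mk ((a, b) + (1, 0)) :
        TorusVertex θ N)) = φ.level (a, b) - φ.level (a + 1, b) := by
      rw [φ.levelBit_out, Prod.mk_add_mk, levelBit_zero]
      simp
    have e1 : levelBit φ.level 1 (Quotient.out (QuotientAddGroup.mk ((a, b) + (1, 1)) :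
        TorusVertex θ N)) = φ.level (a + 1, b) - φ.level (a + 1, b + 1) := by
      rw [φ.levelBit_out, Prod.mk_add_mk, levelBit_one]
      simp
    have e2 := φ.levelBit_out 2 (a, b)
    rw [levelBit_two φ.level a b] at e2
    refine (congrArg₂ (· + ·) (congrArg₂ (· + ·) e0 e1) e2).trans ?_
    ring
  exists_bit_two c := by
    obtain ⟨v, rfl⟩ := QuotientAddGroup.mk_surjective c
    obtain ⟨n, hn⟩ := φ.exists_levelBit_two h₁ h₂ hN v
    refine ⟨n, ?_⟩
    have e : v + n • ((1, 1) : ℤ × ℤ) = (v.1 + n, v.2 + n) := by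
      refine Prod.ext ?_ ?_ <;> simp
    rw [QuotientAddGroup.mk'_apply, ← QuotientAddGroup.mk_nsmul, ← QuotientAddGroup.mk_add,
      φ.levelBit_out, e, hn]
  card_bit_two := by
    refine le_trans (le_of_eq ?_) (φ.ncard_horizontal_le hN)
    rw [← Set.ncard_coe_finset]
    congr 1
    ext c
    simp

namespace LozengeTorus

/-- Sum the `triangle` identity over all sites. -/
theorem ncard_bit (S : LozengeTorus) :
    {p : Fin 3 × S.V | S.bit p.1 p.2 = 1}.ncard = Nat.card S.V := by
  rw [Nat.card_eq_fintype_card, ← Finset.coe_filter_univ, Set.ncard_coe_finset]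
  have h : ((Finset.univ.filter fun p : Fin 3 × S.V => S.bit p.1 p.2 = 1).card : ℤ) =
      ∑ p : Fin 3 × S.V, S.bit p.1 p.2 := by
    rw [Finset.card_filter]
    push_cast
    refine Finset.sum_congr rfl fun p _ => ?_
    rcases bit_eq_zero_or_one p.1 p.2 with e | e <;> simp [e]
  have h0 := Equiv.sum_comp (Equiv.addRight (S.proj (1, 0))) fun c => S.bit 0 c
  have h1 := Equiv.sum_comp (Equiv.addRight (S.proj (1, 1))) fun c => S.bit 1 c
  rw [Fintype.sum_prod_type, Fin.sum_univ_three, ← h0, ← h1, ← Finset.sum_add_distrib,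
    ← Finset.sum_add_distrib] at h
  simp only [Equiv.coe_addRight, S.triangle] at h
  rw [Finset.sum_const, nsmul_eq_mul, mul_one, Finset.card_univ] at h
  exact_mod_cast h

end LozengeTorus

section Compare

variable (φ ψ : Tiling θ N) (h₁ : 0 < θ.1) (h₂ : 0 < θ.2) (hN : 1 ≤ N)

theorem Tiling.torus_bit (i : Fin 3) (v : ℤ × ℤ) :
    (φ.torus h₁ h₂ hN).bit i ((φ.torus h₁ h₂ hN).proj v) = levelBit φ.level i v :=
  φ.levelBit_out i v

theorem Tiling.torus_moved (i : Fin 3) (v : ℤ × ℤ) :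
    (φ.torus h₁ h₂ hN).moved (levelDiff φ ψ) i ((φ.torus h₁ h₂ hN).proj v) =
      levelBit ψ.level i v := by
  change levelBit φ.level i (Quotient.out (QuotientAddGroup.mk v : TorusVertex θ N)) +
    levelDiff φ ψ (QuotientAddGroup.mk (v - unitVec i)) - levelDiff φ ψ (QuotientAddGroup.mk v) = _
  rw [φ.levelBit_out, levelDiff_mk, levelDiff_mk, levelBit, levelBit]
  ring

theorem Tiling.restrict_eq_pattern (v : ℤ × ℤ) (r : ℕ) :
    ψ.restrict v r = (φ.torus h₁ h₂ hN).pattern (levelDiff φ ψ) ((φ.torus h₁ h₂ hN).proj v) r := by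
  ext l
  refine and_congr_left fun _ => ?_
  rw [ψ.mem_lozenges_iff, ← map_add, φ.torus_moved]

theorem levelDiff_self : levelDiff φ φ = 0 := funext fun _ => sub_self _

theorem localSum_eq (g : ℕ → Set Lozenge → ℝ) : localSum g ψ =
    ∑ c, ∑ r ∈ scales N, g r ((φ.torus h₁ h₂ hN).pattern (levelDiff φ ψ) c r) := by
  let : Fintype (TorusVertex θ N) := (φ.torus h₁ h₂ hN).fin
  rw [localSum, tsum_fintype]
  refine Finset.sum_congr rfl fun c _ => Finset.sum_congr rfl fun r _ => ?_
  rw [φ.restrict_eq_pattern ψ h₁ h₂ hN]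
  congr 2
  exact QuotientAddGroup.out_eq' c

theorem mem_faces_both_iff {f : Plaquette} (hf : f ∈ φ.faces) : f ∈ ψ.faces ↔
    levelDiff φ ψ (QuotientAddGroup.mk f.proj) = 0 ∧
      levelDiff φ ψ (QuotientAddGroup.mk (f.proj - unitVec f.dir)) = 0 := by
  obtain ⟨h1, h2⟩ := (φ.mem_faces_iff f).1 hf
  rw [ψ.mem_faces_iff, levelDiff_mk, levelDiff_mk]
  rw [levelBit] at h2 ⊢
  lia

theorem torusCard_sdiff_eq :
    torusCard N (φ.faces \ ψ.faces) = ((φ.torus h₁ h₂ hN).lost (levelDiff φ ψ)).card := by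
  have h := φ.ncard_window hN fun p => levelDiff φ ψ p.2 ≠ 0 ∨
    levelDiff φ ψ (p.2 - QuotientAddGroup.mk (unitVec p.1)) ≠ 0
  have e : {f ∈ φ.faces \ ψ.faces | 0 ≤ f.x ∧ f.x < N ∧ 0 ≤ f.y ∧ f.y < N} =
      {f ∈ φ.window | levelDiff φ ψ (f.toTorus θ N).2 ≠ 0 ∨
        levelDiff φ ψ ((f.toTorus θ N).2 - QuotientAddGroup.mk (unitVec (f.toTorus θ N).1)) ≠ 0} := by
    ext f
    have key : f ∈ φ.faces → (f ∉ ψ.faces ↔ (levelDiff φ ψ (f.toTorus θ N).2 ≠ 0 ∨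
        levelDiff φ ψ ((f.toTorus θ N).2 -
          QuotientAddGroup.mk (unitVec (f.toTorus θ N).1)) ≠ 0)) := fun hf => by
      rw [mem_faces_both_iff φ ψ hf, Plaquette.toTorus, QuotientAddGroup.mk_sub, not_and_or]
    constructor
    · rintro ⟨⟨a, b⟩, w⟩
      exact ⟨⟨a, w⟩, (key a).1 b⟩
    · rintro ⟨⟨a, w⟩, b⟩
      exact ⟨⟨a, (key a).2 b⟩, w⟩
  rw [torusCard, e, h, ← Set.ncard_coe_finset]
  congr 1
  ext p
  exact Iff.symm (Finset.mem_coe.trans LozengeTorus.mem_lost)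

include h₁ h₂ hN in
theorem torusCard_faces : torusCard N φ.faces = Nat.card (TorusVertex θ N) := by
  have h := φ.ncard_window hN fun _ => True
  simp only [and_true] at h
  refine Eq.trans h ?_
  exact (φ.torus h₁ h₂ hN).ncard_bit

include h₁ h₂ hN in
theorem overlap_add_sdiff :
    overlap φ.toSurface ψ + torusCard N (φ.faces \ ψ.faces) = torusCard N φ.faces := by
  have h := Set.ncard_inter_add_ncard_sdiff_eq_ncard φ.window ψ.faces (φ.finite_window h₁ h₂ hN)
  rw [overlap, torusCard, torusCard, torusCard]
  refine Eq.trans ?_ h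
  congr 2 <;> ext f <;> simp only [Tiling.window, Set.mem_inter_iff, Set.mem_sdiff,
    Set.mem_ofPred_eq] <;> tauto

theorem overlap_comm : overlap φ.toSurface ψ = overlap ψ.toSurface φ := by
  rw [overlap, overlap, Set.inter_comm]

/-- Both tilings have as many faces as the torus has vertices, so as many faces are gained as lost.
-/
theorem halfDiff_eq : halfDiff φ ψ = ((φ.torus h₁ h₂ hN).lost (levelDiff φ ψ)).card := by
  have e1 := overlap_add_sdiff φ ψ h₁ h₂ hN
  have e2 := overlap_add_sdiff ψ φ h₁ h₂ hN
  rw [torusCard_faces _ h₁ h₂ hN] at e1 e2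
  rw [← overlap_comm] at e2
  have e3 : torusCard N (symmDiff φ.faces ψ.faces) =
      torusCard N (φ.faces \ ψ.faces) + torusCard N (ψ.faces \ φ.faces) := by
    have hf := φ.finite_window h₁ h₂ hN
    have hg := ψ.finite_window h₁ h₂ hN
    rw [torusCard, torusCard, torusCard, ← Set.ncard_union_eq
      (Set.disjoint_left.2 fun f hf hf' => hf.1.2 hf'.1.1)
      (hf.subset fun f hf => ⟨hf.1.1, hf.2⟩) (hg.subset fun f hf => ⟨hf.1.1, hf.2⟩)]
    congr 1
    ext f
    simp only [Set.mem_symmDiff, Set.mem_union, Set.mem_sdiff, Set.mem_ofPred_eq]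
    tauto
  rw [halfDiff, e3, ← torusCard_sdiff_eq]
  have : torusCard N (ψ.faces \ φ.faces) = torusCard N (φ.faces \ ψ.faces) := by lia
  rw [this]
  push_cast
  ring

include h₁ h₂ hN in
theorem Gbar_eq_halfDiff : Gbar φ.toSurface ψ = halfDiff φ ψ := by
  have hle : ∀ ψ : Tiling θ N, overlap φ.toSurface ψ ≤ torusCard N φ.faces := fun ψ => by
    have := overlap_add_sdiff φ ψ h₁ h₂ hN
    lia
  have hself : overlap φ.toSurface φ = torusCard N φ.faces := by
    rw [overlap, Set.inter_self]
  have hsup : (⨆ ψ₀ : Tiling θ N, overlap φ.toSurface ψ₀) = torusCard N φ.faces := by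
    have : Nonempty (Tiling θ N) := ⟨φ⟩
    refine le_antisymm (ciSup_le' hle) (hself ▸ le_ciSup (f := fun ψ₀ => overlap φ.toSurface ψ₀)
      ⟨torusCard N φ.faces, ?_⟩ φ)
    rintro _ ⟨ψ₀, rfl⟩
    exact hle ψ₀
  rw [Gbar, hsup, halfDiff_eq φ ψ h₁ h₂ hN, ← torusCard_sdiff_eq,
    ← overlap_add_sdiff φ ψ h₁ h₂ hN]
  push_cast
  ring

theorem halfDiff_comm : halfDiff φ ψ = halfDiff ψ φ := by
  rw [halfDiff, halfDiff, symmDiff_comm]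

/-- The tilings that meet `φ` are described by the height differences on the torus. -/
def meetingToConf (ψ : Meeting φ.toSurface) : (φ.torus h₁ h₂ hN).Conf :=
  ⟨levelDiff φ ψ.1, by
    constructor
    · intro i c
      obtain ⟨v, rfl⟩ := (φ.torus h₁ h₂ hN).proj_surj c
      rw [φ.torus_moved ψ.1 h₁ h₂ hN]
      exact ⟨ψ.1.isLevel.bit_nonneg i v, ψ.1.isLevel.bit_le_one i v⟩
    · obtain ⟨f, hf, hf'⟩ := ψ.2
      have h := (mem_faces_both_iff φ ψ.1 hf).1 hf'
      exact ⟨f.dir, (φ.torus h₁ h₂ hN).proj f.proj,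
        (φ.torus_bit h₁ h₂ hN _ _).trans ((φ.mem_faces_iff f).1 hf).2, h.1, h.2⟩⟩

theorem levelDiff_injective : Function.Injective (levelDiff φ) := by
  intro ψ ψ' h
  refine Tiling.level_injective (funext fun v => ?_)
  have := congrFun h (QuotientAddGroup.mk v)
  rw [levelDiff_mk, levelDiff_mk] at this
  linarith

/-- For surjectivity, adding an admissible difference to the level of `φ` gives a function with bits
in `{0, 1}` and the right periods, which `IsLevel.exists_tiling` turns into a tiling. -/
theorem meetingToConf_bijective : Function.Bijective (meetingToConf φ h₁ h₂ hN) := by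
  refine ⟨fun ψ ψ' h => Subtype.ext (levelDiff_injective φ (congrArg Subtype.val h)), ?_⟩
  rintro ⟨Δ, hΔ, i, c, hb, h0, h0'⟩
  have hbit : ∀ i v, levelBit (fun v => φ.level v + Δ ((φ.torus h₁ h₂ hN).proj v)) i v =
      (φ.torus h₁ h₂ hN).moved Δ i ((φ.torus h₁ h₂ hN).proj v) := by
    intro i v
    rw [LozengeTorus.moved, φ.torus_bit, LozengeTorus.u, ← map_sub, levelBit, levelBit]
    ring
  have hH : IsLevel θ N fun v => φ.level v + Δ ((φ.torus h₁ h₂ hN).proj v) := by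
    refine ⟨fun i v => ?_, fun i v => ?_, fun v a b => ?_⟩
    · rw [hbit]; exact (hΔ i _).1
    · rw [hbit]; exact (hΔ i _).2
    · have hp : (φ.torus h₁ h₂ hN).proj (period θ N a b) = 0 :=
        (QuotientAddGroup.eq_zero_iff _).2 (mem_periodLattice.2 ⟨a, b, rfl⟩)
      simp only [map_add, hp, add_zero, φ.level_add_period]
      ring
  obtain ⟨ψ, hψ⟩ := hH.exists_tiling hN
  have hΔψ : levelDiff φ ψ = Δ := by
    funext c
    obtain ⟨v, rfl⟩ := QuotientAddGroup.mk_surjective c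
    rw [levelDiff_mk, hψ]
    exact add_sub_cancel_left _ _
  obtain ⟨v, rfl⟩ := (φ.torus h₁ h₂ hN).proj_surj c
  have hproj : (⟨i, v.1 + φ.level v, v.2 + φ.level v, φ.level v⟩ : Plaquette).proj = v := by
    simp [Plaquette.proj]
  have hf : (⟨i, v.1 + φ.level v, v.2 + φ.level v, φ.level v⟩ : Plaquette) ∈ φ.faces := by
    rw [φ.mem_faces_iff, hproj]
    exact ⟨rfl, (φ.torus_bit h₁ h₂ hN i v).symm.trans hb⟩
  refine ⟨⟨ψ, _, hf, (mem_faces_both_iff φ ψ hf).2 ?_⟩, Subtype.ext hΔψ⟩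
  rw [hproj, hΔψ]
  exact ⟨h0, h0'⟩

end Compare

/-! ### The integrals are free energies -/

variable {θ : ℝ × ℝ} {N : ℕ}

theorem abs_log_sum_exp_sub_le {ι : Type*} [Fintype ι] [Nonempty ι] {f g : ι → ℝ} {δ : ℝ}
    (h : ∀ i, |f i - g i| ≤ δ) :
    |Real.log (∑ i, Real.exp (f i)) - Real.log (∑ i, Real.exp (g i))| ≤ δ := by
  have key : ∀ f g : ι → ℝ, (∀ i, |f i - g i| ≤ δ) →
      Real.log (∑ i, Real.exp (f i)) ≤ δ + Real.log (∑ i, Real.exp (g i)) := by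
    intro f g h
    have pos : ∀ f : ι → ℝ, 0 < ∑ i, Real.exp (f i) := fun f =>
      Finset.sum_pos (fun i _ => Real.exp_pos _) Finset.univ_nonempty
    nth_rewrite 1 [← Real.log_exp δ]
    rw [← Real.log_mul (Real.exp_pos δ).ne' (pos g).ne', Finset.mul_sum]
    refine Real.log_le_log (pos f) (Finset.sum_le_sum fun i _ => ?_)
    rw [← Real.exp_add]
    refine Real.exp_le_exp.2 ?_
    have := (abs_le.1 (h i)).2
    linarith
  have h1 := key f g h
  have h2 := key g f fun i => by rw [abs_sub_comm]; exact h i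
  rw [abs_le]
  constructor <;> linarith

/-- A tiling meets itself. -/
def selfMeeting (φ : Tiling θ N) : Meeting φ.toSurface :=
  ⟨φ, ⟨2, 0, 0, φ.height (0, 0)⟩, Or.inl ⟨rfl, rfl⟩, Or.inl ⟨rfl, rfl⟩⟩

theorem halfDiff_self (φ : Tiling θ N) : halfDiff φ φ = 0 := by
  simp [halfDiff, torusCard]

theorem nuMean_eq (φ : Tiling θ N) (α b : ℝ) : nuMean α φ b (fun η => halfDiff η φ) =
    gibbsMean (fun η : Meeting φ.toSurface =>
      Real.exp (-b * halfDiff φ η.1) * Real.exp (-muIntegral α η.1))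
      fun η => halfDiff φ η.1 := by
  simp only [nuMean, halfDiff_comm _ φ, ← Real.exp_add, sub_eq_add_neg]

section FreeEnergy

variable (h₁ : 0 < θ.1) (h₂ : 0 < θ.2) (hN : 1 ≤ N)

include h₁ h₂ hN

theorem halfDiff_pos {φ : Tiling θ N} {ψ : Meeting φ.toSurface} (h : ψ ≠ selfMeeting φ) :
    0 < halfDiff φ ψ.1 := by
  rw [halfDiff_eq φ ψ.1 h₁ h₂ hN, Nat.cast_pos, Finset.card_pos]
  have hne : levelDiff φ ψ.1 ≠ 0 := fun e =>
    h (Subtype.ext (levelDiff_injective φ (e.trans (levelDiff_self φ).symm)))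
  obtain ⟨c, hc⟩ := Function.ne_iff.1 hne
  obtain ⟨p, hp, -⟩ := LozengeTorus.exists_lost_of_ne_zero
    (meetingToConf φ h₁ h₂ hN ψ).2.1 (c := c) hc
  exact ⟨p, LozengeTorus.mem_lost.2 hp⟩

theorem integral_gibbsMean_halfDiff (φ : Tiling θ N) {w : Meeting φ.toSurface → ℝ}
    (hw : ∀ ψ, 0 < w ψ) (α : ℝ) :
    IntegrableOn (fun a => gibbsMean (fun ψ : Meeting φ.toSurface =>
      Real.exp (-a * halfDiff φ ψ.1) * w ψ) fun ψ => halfDiff φ ψ.1) (Set.Ioi α) ∧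
    ∫ a in Set.Ioi α, gibbsMean (fun ψ : Meeting φ.toSurface =>
      Real.exp (-a * halfDiff φ ψ.1) * w ψ) (fun ψ => halfDiff φ ψ.1) =
    Real.log (∑' ψ : Meeting φ.toSurface, Real.exp (-α * halfDiff φ ψ.1) * w ψ) -
      Real.log (w (selfMeeting φ)) := by
  let : Fintype (Meeting φ.toSurface) := @Fintype.ofFinite _ (finite_meeting hN _)
  rw [tsum_fintype]
  have h0 : (fun ψ : Meeting φ.toSurface => halfDiff φ ψ.1) (selfMeeting φ) = 0 := halfDiff_self φ
  have hpos : ∀ ψ, ψ ≠ selfMeeting φ →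
      0 < (fun ψ : Meeting φ.toSurface => halfDiff φ ψ.1) ψ := fun ψ hψ =>
    halfDiff_pos h₁ h₂ hN hψ
  exact ⟨integrableOn_gibbsMean hw h0 hpos α, integral_gibbsMean hw h0 hpos α⟩

theorem tsum_meeting (φ : Tiling θ N) (f : (TorusVertex θ N → ℤ) → ℝ) :
    ∑' ψ : Meeting φ.toSurface, f (levelDiff φ ψ.1) = ∑ Δ : (φ.torus h₁ h₂ hN).Conf, f Δ.1 := by
  have h := (Equiv.ofBijective _ (meetingToConf_bijective φ h₁ h₂ hN)).tsum_eq
    fun Δ : (φ.torus h₁ h₂ hN).Conf => f Δ.1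
  exact h.trans (tsum_fintype fun Δ : (φ.torus h₁ h₂ hN).Conf => f Δ.1)

theorem muMean_eq (φ : Tiling θ N) (a : ℝ) : muMean φ.toSurface a (fun ψ => halfDiff φ ψ) =
    gibbsMean (fun ψ : Meeting φ.toSurface => Real.exp (-a * halfDiff φ ψ.1) * 1)
      fun ψ => halfDiff φ ψ.1 := by
  simp only [muMean, Gbar_eq_halfDiff φ _ h₁ h₂ hN, mul_one]

theorem integrableOn_muMean (φ : Tiling θ N) (α : ℝ) :
    IntegrableOn (fun a => muMean φ.toSurface a (fun ψ => halfDiff φ ψ)) (Set.Ioi α) := by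
  simp only [muMean_eq h₁ h₂ hN φ]
  exact (integral_gibbsMean_halfDiff h₁ h₂ hN φ (fun _ => one_pos) α).1

theorem muIntegral_eq (φ : Tiling θ N) (α : ℝ) :
    muIntegral α φ = (φ.torus h₁ h₂ hN).freeEnergy α fun _ _ => 0 := by
  rw [muIntegral]
  simp only [muMean_eq h₁ h₂ hN φ]
  rw [(integral_gibbsMean_halfDiff h₁ h₂ hN φ (fun _ => one_pos) α).2, Real.log_one, sub_zero,
    LozengeTorus.freeEnergy]
  simp only [halfDiff_eq φ _ h₁ h₂ hN, mul_one, sub_zero, Finset.sum_const_zero, add_zero]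
  rw [tsum_meeting h₁ h₂ hN φ fun Δ => Real.exp (-α * ((φ.torus h₁ h₂ hN).lost Δ).card)]

theorem integrableOn_nuMean (φ : Tiling θ N) (α : ℝ) :
    IntegrableOn (fun b => nuMean α φ b (fun η => halfDiff η φ)) (Set.Ioi α) := by
  simp only [nuMean_eq φ]
  exact (integral_gibbsMean_halfDiff h₁ h₂ hN φ (fun _ => Real.exp_pos _) α).1

/-- The integral is the logarithm of a sum of exponentials containing `muIntegral` at `φ` (from the
ground state) minus `muIntegral` at `η`. Replacing both by local sums moves each exponent by at most
`2 * δ`, and the logarithm moves no more than that. -/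
theorem abs_nuIntegral_sub_le (φ : Tiling θ N) {α δ : ℝ} {g : ℕ → Set Lozenge → ℝ}
    (h : ∀ η : Tiling θ N, |muIntegral α η - localSum g η| ≤ δ) :
    |nuIntegral α φ - (φ.torus h₁ h₂ hN).freeEnergy α g| ≤ 2 * δ := by
  let : Fintype (Meeting φ.toSurface) := @Fintype.ofFinite _ (finite_meeting hN _)
  have : Nonempty (Meeting φ.toSurface) := ⟨selfMeeting φ⟩
  have e1 : nuIntegral α φ = Real.log (∑ η : Meeting φ.toSurface,
      Real.exp (-α * halfDiff φ η.1 + (muIntegral α φ - muIntegral α η.1))) := by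
    rw [nuIntegral]
    simp only [nuMean_eq φ]
    rw [(integral_gibbsMean_halfDiff h₁ h₂ hN φ (fun _ => Real.exp_pos _) α).2, tsum_fintype,
      ← Real.log_div (Finset.sum_pos (fun η _ => by positivity) Finset.univ_nonempty).ne'
        (Real.exp_pos _).ne', Finset.sum_div]
    congr 1
    refine Finset.sum_congr rfl fun η _ => ?_
    rw [← Real.exp_add, ← Real.exp_sub]
    congr 1
    simp only [selfMeeting]
    ring
  have e2 : (φ.torus h₁ h₂ hN).freeEnergy α g = Real.log (∑' η : Meeting φ.toSurface,
      Real.exp (-α * halfDiff φ η.1 + (localSum g φ - localSum g η.1))) := by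
    rw [LozengeTorus.freeEnergy]
    simp only [halfDiff_eq φ _ h₁ h₂ hN, localSum_eq φ _ h₁ h₂ hN, levelDiff_self,
      ← Finset.sum_sub_distrib]
    exact congrArg Real.log (tsum_meeting h₁ h₂ hN φ fun Δ =>
      Real.exp (-α * ((φ.torus h₁ h₂ hN).lost Δ).card + ∑ c, ∑ r ∈ scales N,
        (g r ((φ.torus h₁ h₂ hN).pattern 0 c r) - g r ((φ.torus h₁ h₂ hN).pattern Δ c r)))).symm
  rw [e1, e2, tsum_fintype]
  refine abs_log_sum_exp_sub_le fun η => ?_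
  have a1 := abs_le.1 (h φ)
  have a2 := abs_le.1 (h η.1)
  rw [abs_le]
  constructor <;> linarith

end FreeEnergy

theorem const_mul_exp_le {C₁ C₂ α r : ℝ} (h0 : 0 < C₁) (h : C₁ ≤ C₂) (hα : 0 ≤ α) (hr : 0 ≤ r) :
    C₁ * Real.exp (-α * r / C₁) ≤ C₂ * Real.exp (-α * r / C₂) := by
  refine mul_le_mul h (Real.exp_le_exp.2 ?_) (Real.exp_pos _).le (h0.le.trans h)
  rw [neg_mul, neg_div, neg_div, neg_le_neg_iff]
  exact div_le_div_of_nonneg_left (mul_nonneg hα hr) h0 h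

end TiltedSOS

end

/-! ### The two expansions combined -/

theorem mainTheorem6 :
    ∃ C : ℝ, 0 < C ∧
      ∀ α β lam : ℝ, C < min α β → C / min α β < lam →
        ∃ gμ gν : ℕ → Set TiltedSOS.Lozenge → ℝ,
          (∀ (r : ℕ) (T : Set TiltedSOS.Lozenge), (∃ k : ℕ, r = 2 ^ k) →
            |gμ r T| ≤ C * Real.exp (-α * r / C) ∧ |gν r T| ≤ C * Real.exp (-α * r / C)) ∧
          ∀ (θ : ℝ × ℝ), 0 < θ.1 → 0 < θ.2 → ∀ N : ℕ, 1 ≤ N →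
            ∀ φ : TiltedSOS.Tiling θ N,
              (MeasureTheory.IntegrableOn
                (fun a => TiltedSOS.muMean φ.toSurface a (fun ψ => TiltedSOS.halfDiff φ ψ))
                (Set.Ioi α) ∧
              |TiltedSOS.muIntegral α φ - TiltedSOS.localSum gμ φ|
                ≤ C * Real.exp (-α * N / C)) ∧
              (MeasureTheory.IntegrableOn
                (fun b => TiltedSOS.nuMean α φ b (fun η => TiltedSOS.halfDiff η φ))
                (Set.Ioi α) ∧
              |TiltedSOS.nuIntegral α φ - TiltedSOS.localSum gν φ|
                ≤ C * Real.exp (-α * N / C)) := by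
  obtain ⟨A₁, hA₁⟩ := TiltedSOS.exists_local_expansion 6 le_rfl
  obtain ⟨A₂, hA₂⟩ := TiltedSOS.exists_local_expansion (64 * 6) (by norm_num)
  -- Each expansion multiplies the constant by 64, so the second error has constant `64 * (64 * 6)`.
  -- The factor 3 makes room for it and for twice the first error.
  refine ⟨max (max A₁ A₂) (3 * (64 * (64 * 6))), lt_max_of_lt_right (by norm_num), ?_⟩
  intro α β lam hα _
  set C := max (max A₁ A₂) (3 * (64 * (64 * 6))) with hC
  have hC' : 3 * (64 * (64 * 6)) ≤ C := le_max_right _ _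
  have hαC : C < α := hα.trans_le (min_le_left _ _)
  have hα0 : 0 ≤ α := by linarith
  obtain ⟨gμ, hgμ, hμ⟩ := hA₁ α (((le_max_left _ _).trans (le_max_left _ _)).trans hαC.le)
    (fun _ _ => 0) fun r T => by rw [abs_zero]; positivity
  -- The local functions of the first expansion are the interaction of the second.
  obtain ⟨gν, hgν, hν⟩ := hA₂ α (((le_max_right _ _).trans (le_max_left _ _)).trans hαC.le) gμ hgμ
  have hexp : ∀ {c : ℝ} (r : ℕ), 0 < c → c ≤ C →
      c * Real.exp (-α * r / c) ≤ C * Real.exp (-α * r / C) := fun r h0 h =>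
    TiltedSOS.const_mul_exp_le h0 h hα0 (Nat.cast_nonneg r)
  refine ⟨gμ, gν, fun r T _ => ⟨(hgμ r T).trans (hexp r (by norm_num) (by linarith)),
    (hgν r T).trans (hexp r (by norm_num) (by linarith))⟩, ?_⟩
  intro θ h₁ h₂ N hN φ
  have hmu : ∀ η : TiltedSOS.Tiling θ N, |TiltedSOS.muIntegral α η - TiltedSOS.localSum gμ η| ≤
      64 * 6 * Real.exp (-α * N / (64 * 6)) := by
    intro η
    have h := hμ (η.torus h₁ h₂ hN)
    rw [← TiltedSOS.muIntegral_eq] at h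
    rw [TiltedSOS.localSum_eq η η h₁ h₂ hN, TiltedSOS.levelDiff_self]
    exact h
  refine ⟨⟨TiltedSOS.integrableOn_muMean h₁ h₂ hN φ α,
    (hmu φ).trans (hexp N (by norm_num) (by linarith))⟩,
    TiltedSOS.integrableOn_nuMean h₁ h₂ hN φ α, ?_⟩
  have h1 := TiltedSOS.abs_nuIntegral_sub_le h₁ h₂ hN φ hmu
  have h2 := hν (φ.torus h₁ h₂ hN)
  change _ ≤ _ * Real.exp (-α * N / _) at h2
  rw [TiltedSOS.localSum_eq φ φ h₁ h₂ hN, TiltedSOS.levelDiff_self]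
  refine (abs_sub_le _ _ _).trans ((add_le_add h1 h2).trans ?_)
  have h3 : 64 * 6 * Real.exp (-α * N / (64 * 6)) ≤
      64 * (64 * 6) * Real.exp (-α * N / (64 * (64 * 6))) :=
    TiltedSOS.const_mul_exp_le (by norm_num) (by norm_num) hα0 (Nat.cast_nonneg N)
  have h4 : 3 * (64 * (64 * 6)) * Real.exp (-α * N / (3 * (64 * (64 * 6)))) ≤
      C * Real.exp (-α * N / C) := hexp N (by norm_num) hC'
  have h5 : Real.exp (-α * N / (64 * (64 * 6))) ≤ Real.exp (-α * N / (3 * (64 * (64 * 6)))) := by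
    refine Real.exp_le_exp.2 ?_
    rw [div_le_div_iff₀ (by norm_num) (by norm_num)]
    nlinarith [mul_nonneg hα0 (Nat.cast_nonneg (α := ℝ) N)]
  linarith
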